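/- Let $\mathcal H,\mathcal K$ be separable complex Hilbert spaces. Let $H_0$ be a densely defined closed linear operator in $\mathcal H$, and let $A,B$ be densely defined closed linear operators from $\mathcal H$ to $\mathcal K$ with $\operatorname{dom}(A)\supseteq\operatorname{dom}(H_0)$ and $\operatorname{dom}(B)\supseteq\operatorname{dom}(H_0^*)$. For $z$ in the resolvent set $\rho(H_0)$ put $R_0(z)=(H_0-z)^{-1}$. Assume that (i) $\rho(H_0)\ne\emptyset$, and for some (hence for all) $z\in\rho(H_0)$ the operator $-AR_0(z)B^*$, defined on $\operatorname{dom}(B^*)$, has a bounded extension $K(z)=-\overline{AR_0(z)B^*}\in\mathcal B(\mathcal K)$; (ii) $1\in\rho(K(z_0))$ for some $z_0\in\rho(H_0)$; (iii) $K(z)$ is compact for all $z\in\rho(H_0)$; (iv) for some $p\in\mathbb N$, $p\ge1$, $K(z)$ belongs to the Schatten class $\mathcal B_p(\mathcal K)$ for all $z\in\rho(H_0)$, and $z\mapsto K(z)$ is analytic on $\rho(H_0)$ with respect to the norm of $\mathcal B_p(\mathcal K)$. Let $H$ be the (densely defined, closed) operator in $\mathcal H$ with $$(H-z)^{-1}=R_0(z)-\overline{R_0(z)B^*}\,[I-K(z)]^{-1}AR_0(z),\qquad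 z\in\rho(H_0),\ 1\in\rho(K(z)).$$ For a closed operator $T$ in $\mathcal H$ let $m(z,T)=0$ if $z\in\rho(T)$; let $m(z,T)=\dim\operatorname{ran}P(z,T)$, with the Riesz projection $P(z,T)=-\frac1{2\pi i}\oint_{|\zeta-z|=\varepsilon}(T-\zeta)^{-1}d\zeta$ ($\varepsilon>0$ small), if $z$ is an isolated point of $\sigma(T)$ and an eigenvalue of finite algebraic multiplicity $\dim\operatorname{ran}P(z,T)$; and let $m(z,T)=+\infty$ otherwise. Let $\widetilde\Phi(T)$ be the set of all $z\in\mathbb C$ that lie in $\rho(T)$ or are isolated eigenvalues of $T$ of finite algebraic multiplicity. Let $f$ be analytic in a punctured neighbourhood of $z$. If $f$ vanishes identically near $z$, put $m(z;f)=+\infty$. If $f$ is meromorphic at $z$ and does not vanish identically near $z$, let $m(z;f)$ be $k$ at a zero of order $k$, $-k$ at a pole of order $k$, and $0$ otherwise. If $z$ is an isolated essential singularity of $f$ to which no zeros of $f$ accumulate, put $m(z;f)=\frac1{2\pi i}\oint_{|\zeta-z|=\varepsilon}\frac{f'(\zeta)}{f(\zeta)}\,d\zeta$ for small $\varepsilon>0$.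 Finally, for $L\in\mathcal B_p(\mathcal K)$ let $\det_p(I-L)$ be the regularized determinant, i.e. the $\mathcal B_p$-continuous extension of $F\mapsto\det(I-F)\exp\big(\operatorname{tr}\sum_{j=1}^{p-1}j^{-1}F^j\big)$ from the finite rank operators $F$. Then $f(z)=\det_p(I-K(z))$ is analytic on $\rho(H_0)$. For every $z\in\widetilde\Phi(H_0)$, $f$ either vanishes identically in a punctured neighbourhood of $z$ or has no zeros in some punctured neighbourhood of $z$, so that $m(z;f)\in\mathbb Z\cup\{+\infty\}$ is defined, and the global Weinstein–Aronszajn formula holds: $$m(z,H)=m(z,H_0)+m\big(z;\det\nolimits_p(I-K(\cdot))\big),\qquad z\in\widetilde\Phi(H_0).$$ -/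

import Mathlib

open Filter Topology
open scoped ENNReal

noncomputable section

namespace WA

section Unbounded

variable {E F G : Type*}
  [NormedAddCommGroup E] [NormedSpace ℂ E]
  [NormedAddCommGroup F] [NormedSpace ℂ F]
  [NormedAddCommGroup G] [NormedSpace ℂ G]

/-- The product `S T` of two operators on its natural domain `{x ∈ dom T | T x ∈ dom S}`. -/
def prodOp (S : F →ₗ.[ℂ] G) (T : E →ₗ.[ℂ] F) : E →ₗ.[ℂ] G :=
  S.comp (T.domRestrict ((S.domain.comap T.toFun).map T.domain.subtype)) (by
    rintro ⟨x, hx1, hx2⟩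
    obtain ⟨y, hy, rfl⟩ := hx1
    exact hy)

/-- A bounded, everywhere defined operator, regarded as an operator with domain. -/
def ofBdd (T : E →L[ℂ] F) : E →ₗ.[ℂ] F := (T : E →ₗ[ℂ] F).toPMap ⊤

/-- `S` has a bounded, everywhere defined extension. -/
def HasBddExt (S : E →ₗ.[ℂ] F) : Prop :=
  ∃ T : E →L[ℂ] F, ∀ x : S.domain, T x = S x

open Classical in
/-- The bounded everywhere defined extension of `S` (unique if `S` is densely defined);
`0` if there is none. -/
def bddExt (S : E →ₗ.[ℂ] F) : E →L[ℂ] F :=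
  if h : HasBddExt S then h.choose else 0

/-- `R = (T - z)⁻¹`: the bounded operator `R` is a two-sided inverse of `T - z : dom T → E`. -/
def IsResolventAt (T : E →ₗ.[ℂ] E) (z : ℂ) (R : E →L[ℂ] E) : Prop :=
  (∀ x : E, ∃ h : R x ∈ T.domain, T ⟨R x, h⟩ - z • R x = x) ∧
    ∀ x : T.domain, R (T x - z • (x : E)) = x

/-- The resolvent set `ρ(T)`. -/
def rho (T : E →ₗ.[ℂ] E) : Set ℂ := {z | ∃ R : E →L[ℂ] E, IsResolventAt T z R}

open Classical in
/-- The resolvent `(T - z)⁻¹`, for `z ∈ ρ(T)`; `0` otherwise. -/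
def res (T : E →ₗ.[ℂ] E) (z : ℂ) : E →L[ℂ] E :=
  if h : ∃ R : E →L[ℂ] E, IsResolventAt T z R then h.choose else 0

/-- The integral `-(2πi)⁻¹ ∮ (T - ζ)⁻¹ dζ` over the circle of radius `ε` about `z`. -/
def rieszIntegral (T : E →ₗ.[ℂ] E) (z : ℂ) (ε : ℝ) : E →L[ℂ] E :=
  -((2 * (Real.pi : ℂ) * Complex.I)⁻¹ • ∮ ζ in C(z, ε), res T ζ)

/-- The Riesz projection of `T` at an isolated point `z` of its spectrum: the value of
`rieszIntegral T z ε` for all sufficiently small `ε > 0`, on which it does not depend. -/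
def rieszProj (T : E →ₗ.[ℂ] E) (z : ℂ) : E →L[ℂ] E :=
  limUnder (𝓝[>] (0 : ℝ)) (rieszIntegral T z)

/-- `z` is an isolated point of the spectrum of `T`, an eigenvalue of `T`, and its algebraic
multiplicity (the dimension of the range of the Riesz projection) is finite. -/
def IsIsolatedFiniteEigenvalue (T : E →ₗ.[ℂ] E) (z : ℂ) : Prop :=
  z ∉ rho T ∧ (∀ᶠ ζ in 𝓝[≠] z, ζ ∈ rho T) ∧
    (∃ x : T.domain, (x : E) ≠ 0 ∧ T x = z • (x : E)) ∧
    FiniteDimensional ℂ (LinearMap.range (rieszProj T z : E →ₗ[ℂ] E))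

open Classical in
/-- The multiplicity function `m(z, T)`, with values in `{0, 1, 2, …, +∞}`, regarded as elements
of `ℤ ∪ {+∞}`. -/
def opMult (z : ℂ) (T : E →ₗ.[ℂ] E) : WithTop ℤ :=
  if z ∈ rho T then 0
  else if IsIsolatedFiniteEigenvalue T z then
    ((Module.finrank ℂ (LinearMap.range (rieszProj T z : E →ₗ[ℂ] E)) : ℤ) : WithTop ℤ)
  else ⊤

/-- The set `σ̃ₑ(T)` of all points of the spectrum of `T` which are not isolated eigenvalues of
finite algebraic multiplicity. -/
def sigmaTilde (T : E →ₗ.[ℂ] E) : Set ℂ :=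
  {z | z ∉ rho T ∧ ¬ IsIsolatedFiniteEigenvalue T z}

/-- `Φ̃(T)`, the complement of `σ̃ₑ(T)`. -/
def phiTilde (T : E →ₗ.[ℂ] E) : Set ℂ := (sigmaTilde T)ᶜ

end Unbounded

section Perturbation

variable {H K : Type*}
  [NormedAddCommGroup H] [InnerProductSpace ℂ H] [CompleteSpace H]
  [NormedAddCommGroup K] [InnerProductSpace ℂ K] [CompleteSpace K]

/-- The operator `A R₀(z) B*` on its natural domain
(which is `dom B*` if `z ∈ ρ(H₀)` and `dom A ⊇ dom H₀`). -/
def sandwich (H₀ : H →ₗ.[ℂ] H) (A B : H →ₗ.[ℂ] K) (z : ℂ) : K →ₗ.[ℂ] K :=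
  prodOp A (prodOp (ofBdd (res H₀ z)) B.adjoint)

/-- `K(z)`, the negative of the bounded extension of `A R₀(z) B*`. -/
def bsKernel (H₀ : H →ₗ.[ℂ] H) (A B : H →ₗ.[ℂ] K) (z : ℂ) : K →L[ℂ] K :=
  -bddExt (sandwich H₀ A B z)

/-- The operator
`R(z) = R₀(z) - (bounded extension of R₀(z) B*) (1 - K(z))⁻¹ A R₀(z)`. -/
def pertRes (H₀ : H →ₗ.[ℂ] H) (A B : H →ₗ.[ℂ] K) (z : ℂ) : H →L[ℂ] H :=
  res H₀ z -
    (bddExt (prodOp (ofBdd (res H₀ z)) B.adjoint)).comp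
      ((Ring.inverse (1 - bsKernel H₀ A B z)).comp (bddExt (prodOp A (ofBdd (res H₀ z)))))

/-- The perturbed operator `H = R(z)⁻¹ + z`, i.e. the operator `H` with `(H - z)⁻¹ = R(z)`.
It is the same for all `z ∈ ρ(H₀)` with `1 ∈ ρ(K(z))`. -/
def pertOp (H₀ : H →ₗ.[ℂ] H) (A B : H →ₗ.[ℂ] K) (z : ℂ) : H →ₗ.[ℂ] H :=
  (z • (LinearMap.id : H →ₗ[ℂ] H)) +ᵥ (ofBdd (pertRes H₀ A B z)).inverse

end Perturbation

section Schatten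

variable {K : Type*} [NormedAddCommGroup K] [InnerProductSpace ℂ K]

/-- The singular numbers (indexed from `0`) of a bounded operator `T` on a Hilbert space:
the distance in operator norm of `T` to the operators of rank at most `n`. -/
def singNum (n : ℕ) (T : K →L[ℂ] K) : ℝ≥0∞ :=
  ⨅ F : {F : K →L[ℂ] K // LinearMap.rank (F : K →ₗ[ℂ] K) ≤ n}, ‖T - F.1‖ₑ

/-- The Schatten norm `‖T‖_p = (∑ₙ sₙ(T) ^ p) ^ (1 / p)`, possibly infinite. -/
def schattenNorm (p : ℕ) (T : K →L[ℂ] K) : ℝ≥0∞ :=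
  (∑' n, singNum n T ^ p) ^ (1 / (p : ℝ))

/-- `T` belongs to the Schatten class `𝓑_p`. -/
def MemSchatten (p : ℕ) (T : K →L[ℂ] K) : Prop := schattenNorm p T < ∞

/-- `L` is analytic on the open set `U` with respect to the norm of `𝓑_p`:
it has a complex derivative, in the norm of `𝓑_p`, at each point of `U`. -/
def SchattenAnalyticOn (p : ℕ) (L : ℂ → K →L[ℂ] K) (U : Set ℂ) : Prop :=
  ∀ z ∈ U, ∃ D : K →L[ℂ] K, MemSchatten p D ∧
    Tendsto (fun ζ => schattenNorm p ((ζ - z)⁻¹ • (L ζ - L z) - D)) (𝓝[≠] z) (𝓝 0)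

/-- The restriction of `F` to its own range. -/
def onRange (F : K →L[ℂ] K) :
    LinearMap.range (F : K →ₗ[ℂ] K) →ₗ[ℂ] LinearMap.range (F : K →ₗ[ℂ] K) :=
  (F : K →ₗ[ℂ] K).restrict (fun x _ => LinearMap.mem_range_self (F : K →ₗ[ℂ] K) x)

/-- For `F` of finite rank,
`det_p (1 - F) = det (1 - F) exp (tr (F + F ^ 2 / 2 + ⋯ + F ^ (p - 1) / (p - 1)))`; determinant
and trace of a finite rank operator are those of its restriction to its range. -/
def finRankDet (p : ℕ) (F : K →L[ℂ] K) : ℂ :=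
  LinearMap.det (1 - onRange F) *
    Complex.exp (LinearMap.trace ℂ _ (∑ j ∈ Finset.Ico 1 p, (j : ℂ)⁻¹ • onRange F ^ j))

/-- The regularized determinant `det_p (1 - L)`, for `L` in `𝓑_p`, as the continuous extension
from the finite rank operators: the limit of `det_p (1 - F)` as `F` tends to `L` in the norm of
`𝓑_p` within the finite rank operators. -/
def detP (p : ℕ) (L : K →L[ℂ] K) : ℂ :=
  limUnder (comap (fun F : K →L[ℂ] K => schattenNorm p (F - L)) (𝓝 0) ⊓
    𝓟 {F | FiniteDimensional ℂ (LinearMap.range (F : K →ₗ[ℂ] K))}) (finRankDet p)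

end Schatten

/-- The integral `(2πi)⁻¹ ∮ f'(ζ) / f(ζ) dζ` over the circle of radius `ε` about `z`. -/
def logIntegral (f : ℂ → ℂ) (z : ℂ) (ε : ℝ) : ℂ :=
  (2 * (Real.pi : ℂ) * Complex.I)⁻¹ * ∮ ζ in C(z, ε), deriv f ζ / f ζ

open Classical in
/-- The multiplicity function `m(z; f)`. If `f` is meromorphic at `z`, it is `k` at a zero of
order `k`, `-k` at a pole of order `k`, `+∞` if `f` vanishes identically near `z`, and `0`
otherwise. If `z` is an isolated essential singularity of `f`, with no zeros of `f` near `z`, it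
is the integer which is the value of `logIntegral f z ε` for all sufficiently small `ε > 0`. -/
def funMult (z : ℂ) (f : ℂ → ℂ) : WithTop ℤ :=
  if MeromorphicAt f z then meromorphicOrderAt f z
  else if h : ∃ k : ℤ, ∀ᶠ ε in 𝓝[>] (0 : ℝ), logIntegral f z ε = k then (h.choose : ℤ)
  else 0

end WA

end

/-! Write w = z₀, let Λ and Γ be `leftFactor` and `rightFactor` at w, and put U(ζ) = 1 + (ζ - w)
R₀(ζ) (`resQuot`). Everything is expressed by U: the factors at ζ are Λ U(ζ) and U(ζ) Γ, K(ζ) = K(w)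
- (ζ - w) Λ U(ζ) Γ with K' = -Λ U² Γ, and the difference of the two resolvents is R₀ - R = U Γ (1 -
K)⁻¹ Λ U.

At z in `phiTilde H₀` the Riesz projection splits U into a part analytic at z and a meromorphic part
living on a finite-dimensional space (`nonempty_resolventSplitting`). Consequently K = G + Y S near
z, where G is analytic at z with ‖G(z)‖ < 1/4 and Y S is meromorphic and factors through a
finite-dimensional space (`IsKatoTriple.nonempty_kernelSplitting`). Multiplicativity of the
determinant and Sylvester's identity then give det_p(1 - K) = d · exp g with d = det(1 - S (1 - G)⁻¹
Y) (`detP_eq`). The function d is meromorphic at z. The exponent g is holomorphic only on a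
punctured neighbourhood, but that is enough: exp g has no zeros and g' integrates to zero over small
circles, so the multiplicity of det_p is that of d even at an essential singularity
(`funMult_eq_of_eq_mul_exp`).

If d vanishes identically near z, then 1 - K(ζ) is never invertible there, and by compactness each
such ζ is a spectral point of H (`IsKatoTriple.isUnit_of_mem_rho_pertOp`); both sides are +∞.
Otherwise R₀ - R is integrated over a small circle. Its analytic piece drops out and the other
pieces factor through finite-dimensional spaces, so the trace may be taken under the integral
(`eventually_hasTrace_circleIntegral`). Cyclicity of the trace turns the integrand into d'/d
(`trace_pieces_eq`). Since the trace of a projection is its rank, the ranks of the Riesz projections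
of H and H₀ differ by (2πi)⁻¹ ∮ d'/d (`IsKatoTriple.eventually_hasTrace_rieszProj`).

The analysis of det_p rests on det_p(1 - G) = exp(-∑_{j ≥ p} tr G^j / j) for finite rank G with ‖G‖
< 1. The dimension-free bound |tr G^j| ≤ p (∑ s_n(G)^p) ‖G‖^(j - p) and the Schwarz lemma make the
exponent locally Lipschitz for the topology of 𝓑_p (`dist_logTail_le`). It therefore extends from
finite rank operators to small operators in 𝓑_p, and it is differentiable along 𝓑_p-differentiable
curves (`differentiableAt_logTailExt_comp`). -/

noncomputable section
namespace WA

/-! ### Singular numbers and Schatten sums -/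

section SingularNumbers

variable {K : Type*} [NormedAddCommGroup K] [InnerProductSpace ℂ K]

theorem singNum_le_of_rank_le {n : ℕ} (T F : K →L[ℂ] K)
    (hF : LinearMap.rank (F : K →ₗ[ℂ] K) ≤ n) : singNum n T ≤ ‖T - F‖ₑ :=
  iInf_le (fun F : {F : K →L[ℂ] K // LinearMap.rank (F : K →ₗ[ℂ] K) ≤ n} => ‖T - F.1‖ₑ) ⟨F, hF⟩

theorem singNum_le_enorm (n : ℕ) (T : K →L[ℂ] K) : singNum n T ≤ ‖T‖ₑ := by
  simpa using singNum_le_of_rank_le (n := n) T 0 (by simp)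

theorem singNum_zero_eq (T : K →L[ℂ] K) : singNum 0 T = ‖T‖ₑ := by
  refine le_antisymm (singNum_le_enorm 0 T) (le_iInf ?_)
  rintro ⟨F, hF⟩
  have h0 : F = 0 := by
    have : (F : K →ₗ[ℂ] K) = 0 := by
      rw [← LinearMap.range_eq_bot]
      have h1 : Module.rank ℂ (LinearMap.range (F : K →ₗ[ℂ] K)) = 0 := by simpa using hF
      exact Submodule.rank_eq_zero.1 h1
    ext x
    exact congrArg (fun g : K →ₗ[ℂ] K => g x) this
  simp [h0]

theorem singNum_antitone (T : K →L[ℂ] K) : Antitone fun n => singNum n T := by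
  intro m n hmn
  refine le_iInf ?_
  rintro ⟨F, hF⟩
  exact singNum_le_of_rank_le T F (hF.trans (by exact_mod_cast hmn))

theorem singNum_ne_top (n : ℕ) (T : K →L[ℂ] K) : singNum n T ≠ ∞ :=
  ne_top_of_le_ne_top enorm_ne_top (singNum_le_enorm n T)

instance instNonemptyRankLe (n : ℕ) :
    Nonempty {F : K →L[ℂ] K // LinearMap.rank (F : K →ₗ[ℂ] K) ≤ n} :=
  ⟨⟨0, by simp⟩⟩

theorem singNum_add_le (m n : ℕ) (S T : K →L[ℂ] K) :
    singNum (m + n) (S + T) ≤ singNum m S + singNum n T := by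
  rw [singNum.eq_def m, singNum.eq_def n, ENNReal.iInf_add]
  refine le_iInf ?_
  rintro ⟨F, hF⟩
  rw [ENNReal.add_iInf]
  refine le_iInf ?_
  rintro ⟨G, hG⟩
  refine (singNum_le_of_rank_le (S + T) (F + G) ?_).trans ?_
  · refine (LinearMap.rank_add_le (F : K →ₗ[ℂ] K) (G : K →ₗ[ℂ] K)).trans ?_
    push_cast
    exact add_le_add hF hG
  · rw [add_sub_add_comm]
    exact enorm_add_le (S - F) (T - G)

theorem singNum_mul_le (m n : ℕ) (S T : K →L[ℂ] K) :
    singNum (m + n) (S * T) ≤ singNum m S * singNum n T := by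
  have hn := singNum_ne_top n T
  rw [singNum.eq_def m, ENNReal.iInf_mul (fun h => absurd h hn)]
  refine le_iInf ?_
  rintro ⟨F, hF⟩
  rw [singNum.eq_def n, ENNReal.mul_iInf (fun h => absurd h enorm_ne_top)]
  refine le_iInf ?_
  rintro ⟨G, hG⟩
  -- This approximant is chosen so that the error factors exactly as (S - F)(T - G), while its rank
  -- is at most m + n.
  refine (singNum_le_of_rank_le (S * T) (F * T + (S - F) * G) ?_).trans ?_
  · refine (LinearMap.rank_add_le ((F * T : K →L[ℂ] K) : K →ₗ[ℂ] K)
      (((S - F) * G : K →L[ℂ] K) : K →ₗ[ℂ] K)).trans ?_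
    push_cast
    exact add_le_add ((LinearMap.rank_comp_le_left (T : K →ₗ[ℂ] K) (F : K →ₗ[ℂ] K)).trans hF)
      ((LinearMap.rank_comp_le_right (G : K →ₗ[ℂ] K) ((S - F : K →L[ℂ] K) : K →ₗ[ℂ] K)).trans hG)
  · have h : S * T - (F * T + (S - F) * G) = (S - F) * (T - G) := by noncomm_ring
    rw [h]
    simp only [enorm_eq_nnnorm]
    exact_mod_cast ContinuousLinearMap.opNNNorm_comp_le (S - F) (T - G)

theorem singNum_pow_le (p n : ℕ) (T : K →L[ℂ] K) : singNum (p * n) (T ^ p) ≤ singNum n T ^ p := by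
  induction p with
  | zero =>
    rw [zero_mul, pow_zero, pow_zero, singNum_zero_eq, enorm_eq_nnnorm]
    exact_mod_cast (ContinuousLinearMap.norm_id_le : ‖ContinuousLinearMap.id ℂ K‖ ≤ 1)
  | succ p ih =>
    rw [add_mul, one_mul, pow_succ, pow_succ]
    exact (singNum_mul_le _ _ _ _).trans (mul_le_mul_left ih _)

theorem singNum_smul_le (n : ℕ) (c : ℂ) (T : K →L[ℂ] K) :
    singNum n (c • T) ≤ ‖c‖ₑ * singNum n T := by
  rw [singNum.eq_def n T, ENNReal.mul_iInf (fun h => absurd h enorm_ne_top)]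
  refine le_iInf ?_
  rintro ⟨F, hF⟩
  refine (singNum_le_of_rank_le (c • T) (c • F) ?_).trans ?_
  · refine le_trans ?_ hF
    have : ((c • F : K →L[ℂ] K) : K →ₗ[ℂ] K)
      = (c • LinearMap.id : K →ₗ[ℂ] K) ∘ₗ (F : K →ₗ[ℂ] K) := by ext; simp
    rw [this]
    exact LinearMap.rank_comp_le_right _ _
  · rw [← smul_sub, enorm_smul]

/-- Cut the sum into blocks of length p; each block is at most p times its first entry. This undoes
the index dilation in inequalities for s_{2n}(S + T) and s_{pn}(T^p). -/
theorem tsum_le_mul_tsum_of_antitone {a : ℕ → ℝ≥0∞} (ha : Antitone a) (p : ℕ) (hp : 1 ≤ p) :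
    ∑' n, a n ≤ p * ∑' n, a (p * n) := by
  have : NeZero p := ⟨by omega⟩
  rw [← (Nat.divModEquiv p).symm.tsum_eq, ENNReal.tsum_prod', ← ENNReal.tsum_mul_left]
  refine ENNReal.tsum_le_tsum fun q => ?_
  rw [tsum_fintype]
  refine (Finset.sum_le_card_nsmul _ _ (a (p * q)) fun r _ => ha ?_).trans ?_
  · simp only [Nat.divModEquiv_symm_apply]
    rw [mul_comm]; exact Nat.le_add_right _ _
  · simp

/-- The `p`-th power of the Schatten `p`-norm. -/
def schattenSum (p : ℕ) (T : K →L[ℂ] K) : ℝ≥0∞ := ∑' n, singNum n T ^ p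

theorem schattenSum_smul_le (p : ℕ) (c : ℂ) (T : K →L[ℂ] K) :
    schattenSum p (c • T) ≤ ‖c‖ₑ ^ p * schattenSum p T := by
  rw [schattenSum, schattenSum, ← ENNReal.tsum_mul_left]
  refine ENNReal.tsum_le_tsum fun n => ?_
  rw [← mul_pow]
  exact pow_le_pow_left' (singNum_smul_le n c T) p

theorem schattenSum_neg (p : ℕ) (T : K →L[ℂ] K) : schattenSum p (-T) = schattenSum p T := by
  have h : ∀ T : K →L[ℂ] K, schattenSum p (-T) ≤ schattenSum p T := fun T => by
    simpa using schattenSum_smul_le p (-1) T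
  exact le_antisymm (h T) (by simpa using h (-T))

/-- A quasi-triangle inequality suffices, since only the topology of 𝓑_p matters. It follows from
s_{2n}(S + T) ≤ 2 max(s_n(S), s_n(T)), with no appeal to Minkowski's inequality. -/
theorem schattenSum_add_le (p : ℕ) (S T : K →L[ℂ] K) :
    schattenSum p (S + T) ≤ 2 * 2 ^ p * (schattenSum p S + schattenSum p T) := by
  have hanti : Antitone fun n => singNum n (S + T) ^ p := fun m n h =>
    pow_le_pow_left' (singNum_antitone (S + T) h) p
  refine (tsum_le_mul_tsum_of_antitone hanti 2 (by norm_num)).trans ?_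
  rw [mul_assoc]
  push_cast
  refine mul_le_mul_right ?_ _
  rw [schattenSum, schattenSum, ← ENNReal.tsum_add, ← ENNReal.tsum_mul_left]
  refine ENNReal.tsum_le_tsum fun n => ?_
  have h1 : singNum (2 * n) (S + T) ≤ 2 * max (singNum n S) (singNum n T) := by
    rw [two_mul n, two_mul (max _ _)]
    exact (singNum_add_le n n S T).trans (add_le_add (le_max_left _ _) (le_max_right _ _))
  refine (pow_le_pow_left' h1 p).trans ?_
  rw [mul_pow]
  refine mul_le_mul_right ?_ _
  rcases max_cases (singNum n S) (singNum n T) with ⟨h, _⟩ | ⟨h, _⟩ <;> rw [h]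
  · exact le_self_add
  · exact le_add_self

theorem enorm_pow_le_schattenSum (p : ℕ) (T : K →L[ℂ] K) : ‖T‖ₑ ^ p ≤ schattenSum p T := by
  rw [← singNum_zero_eq]
  exact ENNReal.le_tsum (f := fun n => singNum n T ^ p) 0

theorem schattenSum_lt_top_of_rank_le (p : ℕ) (hp : 1 ≤ p) (T : K →L[ℂ] K) {r : ℕ}
    (hr : LinearMap.rank (T : K →ₗ[ℂ] K) ≤ r) : schattenSum p T ≤ r * ‖T‖ₑ ^ p := by
  have h0 : ∀ n, r ≤ n → singNum n T = 0 := fun n hn => by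
    refine le_antisymm ((singNum_antitone T hn).trans ?_) bot_le
    simpa [enorm_eq_nnnorm] using singNum_le_of_rank_le T T hr
  rw [schattenSum, tsum_eq_sum (s := Finset.range r) (fun n hn => by
    rw [h0 n (by simpa using hn), zero_pow (by omega)])]
  refine (Finset.sum_le_card_nsmul _ _ (‖T‖ₑ ^ p) fun n _ =>
    pow_le_pow_left' (singNum_le_enorm n T) p).trans ?_
  simp

/-- Plays the role of Hölder's inequality: s_{pn}(T^p) ≤ s_n(T)^p makes the singular numbers of T^p
summable, and each further factor T costs only its operator norm. -/
theorem tsum_singNum_pow_le {p j : ℕ} (hp : 1 ≤ p) (hj : p ≤ j) (T : K →L[ℂ] K) :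
    ∑' n, singNum n (T ^ j) ≤ p * schattenSum p T * ‖T‖ₑ ^ (j - p) := by
  refine (tsum_le_mul_tsum_of_antitone (singNum_antitone _) p hp).trans ?_
  rw [mul_assoc, schattenSum, ← ENNReal.tsum_mul_right]
  refine mul_le_mul_right (ENNReal.tsum_le_tsum fun n => ?_) _
  have h : T ^ j = T ^ p * T ^ (j - p) := by rw [← pow_add]; congr 1; omega
  rw [h]
  refine (singNum_mul_le (p * n) 0 _ _).trans (mul_le_mul' (singNum_pow_le p n T) ?_)
  simpa [singNum_zero_eq] using singNum_pow_le (j - p) 0 T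

theorem schattenNorm_eq (p : ℕ) (T : K →L[ℂ] K) :
    schattenNorm p T = schattenSum p T ^ (1 / (p : ℝ)) := rfl

theorem memSchatten_iff {p : ℕ} (hp : 1 ≤ p) (T : K →L[ℂ] K) :
    MemSchatten p T ↔ schattenSum p T < ∞ := by
  have : (0 : ℝ) < 1 / (p : ℝ) := by positivity
  rw [MemSchatten, schattenNorm_eq, ENNReal.rpow_lt_top_iff_of_pos this]

theorem tendsto_schattenNorm_iff {p : ℕ} (hp : 1 ≤ p) {α : Type*} {l : Filter α}
    (T : α → K →L[ℂ] K) :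
    Tendsto (fun a => schattenNorm p (T a)) l (𝓝 0) ↔
      Tendsto (fun a => schattenSum p (T a)) l (𝓝 0) := by
  have h1 : (0 : ℝ) < 1 / (p : ℝ) := by positivity
  have h2 : (0 : ℝ) < p := by positivity
  constructor
  · intro h
    have := h.ennrpow_const (p : ℝ)
    rw [ENNReal.zero_rpow_of_pos h2] at this
    refine this.congr fun a => ?_
    rw [schattenNorm_eq, ← ENNReal.rpow_mul, one_div_mul_cancel h2.ne', ENNReal.rpow_one]
  · intro h
    have := h.ennrpow_const (1 / (p : ℝ))
    rwa [ENNReal.zero_rpow_of_pos h1] at this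

theorem schattenSum_sub_le (p : ℕ) (S T : K →L[ℂ] K) :
    schattenSum p (S - T) ≤ 2 * 2 ^ p * (schattenSum p S + schattenSum p T) := by
  rw [sub_eq_add_neg, ← schattenSum_neg p T]
  exact schattenSum_add_le p S (-T)

end SingularNumbers

/-! ### Trace and determinant in finite dimension -/

section FiniteDimensional

theorem exists_ne_zero_map_eq_zero_of_rank_lt {V W : Type*} [AddCommGroup V] [Module ℂ V]
    [AddCommGroup W] [Module ℂ W] (F : V →ₗ[ℂ] W) {n : ℕ} (hF : LinearMap.rank F ≤ n)
    (L : (Fin (n + 1) → ℂ) →ₗ[ℂ] V) : ∃ c, c ≠ 0 ∧ F (L c) = 0 := by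
  by_contra! hc
  have hinj : Function.Injective (F ∘ₗ L) := by
    rw [← LinearMap.ker_eq_bot, LinearMap.ker_eq_bot']
    intro c h
    by_contra h0
    exact hc c h0 h
  have h1 : (n + 1 : ℕ) ≤ Module.finrank ℂ (LinearMap.range (F ∘ₗ L)) := by
    rw [LinearMap.finrank_range_of_inj hinj]; simp
  have h2 : Module.rank ℂ (LinearMap.range (F ∘ₗ L)) ≤ n :=
    (Submodule.rank_mono (LinearMap.range_comp_le_range L F)).trans hF
  have h3 : Module.finrank ℂ (LinearMap.range (F ∘ₗ L)) ≤ n := Module.finrank_le_of_rank_le h2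
  omega

section Inner

variable {V : Type*} [NormedAddCommGroup V] [InnerProductSpace ℂ V] [FiniteDimensional ℂ V]

theorem norm_map_sq_of_eigenvectorBasis (T : V →ₗ[ℂ] V) {N : ℕ} (hN : Module.finrank ℂ V = N)
    (c : Fin N → ℂ) :
    ‖T (∑ k, c k • T.isSymmetric_adjoint_comp_self.eigenvectorBasis hN k)‖ ^ 2 =
      ∑ k, T.isSymmetric_adjoint_comp_self.eigenvalues hN k * ‖c k‖ ^ 2 := by
  set b := T.isSymmetric_adjoint_comp_self.eigenvectorBasis hN with hb
  set l := T.isSymmetric_adjoint_comp_self.eigenvalues hN with hl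
  have h1 : (LinearMap.adjoint T ∘ₗ T) (∑ k, c k • b k) = ∑ k, (c k * l k) • b k := by
    rw [map_sum]
    refine Finset.sum_congr rfl fun k _ => ?_
    rw [map_smul, hb, T.isSymmetric_adjoint_comp_self.apply_eigenvectorBasis, mul_smul]
    rfl
  have h2 : (inner ℂ (∑ k, c k • b k) ((LinearMap.adjoint T ∘ₗ T) (∑ k, c k • b k)) : ℂ)
      = ∑ k, ((l k * ‖c k‖ ^ 2 : ℝ) : ℂ) := by
    rw [h1, b.orthonormal.inner_sum]
    refine Finset.sum_congr rfl fun k _ => ?_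
    push_cast
    rw [← Complex.conj_mul']
    ring
  rw [LinearMap.comp_apply, LinearMap.adjoint_inner_right, inner_self_eq_norm_sq_to_K] at h2
  exact Complex.ofReal_injective (by push_cast at h2 ⊢; exact h2)

/-- One half of the min-max principle. An operator F of rank at most i kills a nonzero x in the span
of the first i + 1 eigenvectors of T*T. The eigenvalues are in decreasing order, so ‖T x‖ ≥ ‖T b_i‖
‖x‖ there, whence ‖T - F‖ ≥ ‖T b_i‖. -/
theorem singularValues_le_singNum (T : V →L[ℂ] V) {N : ℕ} (hN : Module.finrank ℂ V = N)
    (i : Fin N) :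
    ‖T ((T : V →ₗ[ℂ] V).isSymmetric_adjoint_comp_self.eigenvectorBasis hN i)‖ₑ
      ≤ singNum i T := by
  set b := (T : V →ₗ[ℂ] V).isSymmetric_adjoint_comp_self.eigenvectorBasis hN with hb
  set l := (T : V →ₗ[ℂ] V).isSymmetric_adjoint_comp_self.eigenvalues hN with hl
  have key := norm_map_sq_of_eigenvectorBasis (T : V →ₗ[ℂ] V) hN
  refine le_iInf ?_
  rintro ⟨F, hF⟩
  let e : Fin (i + 1) → Fin N := fun k => ⟨k, by omega⟩
  have he : Function.Injective e := fun a b h => by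
    ext; simpa [e] using h
  let L : (Fin (i + 1) → ℂ) →ₗ[ℂ] V := Fintype.linearCombination ℂ (fun k => b (e k))
  obtain ⟨c, hc, hFc⟩ := exists_ne_zero_map_eq_zero_of_rank_lt (F : V →ₗ[ℂ] V) hF L
  have hon : Orthonormal ℂ (fun k => b (e k)) := b.orthonormal.comp e he
  have hLc : L c = ∑ k, c k • b (e k) := Fintype.linearCombination_apply ℂ _ c
  have hnorm : ‖L c‖ ^ 2 = ∑ k, ‖c k‖ ^ 2 := by
    have : (inner ℂ (L c) (L c) : ℂ) = ∑ k, ((‖c k‖ ^ 2 : ℝ) : ℂ) := by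
      rw [hLc, hon.inner_sum]
      refine Finset.sum_congr rfl fun k _ => ?_
      push_cast
      rw [← Complex.conj_mul']
    rw [inner_self_eq_norm_sq_to_K] at this
    exact Complex.ofReal_injective (by push_cast at this ⊢; exact this)
  have hext : L c = ∑ j, (Function.extend e c 0) j • b j := by
    rw [hLc, ← Finset.sum_subset (Finset.subset_univ (Finset.univ.image e)),
      Finset.sum_image (fun a _ b _ h => he h)]
    · simp [he.extend_apply]
    · intro j _ hj
      rw [Function.extend_apply' _ _ _ (by simpa using hj)]
      simp
  have hTx : l i * ‖L c‖ ^ 2 ≤ ‖T (L c)‖ ^ 2 := by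
    have h1 := key (Function.extend e c 0)
    rw [← hext] at h1
    rw [ContinuousLinearMap.coe_coe] at h1
    rw [h1, ← Finset.sum_subset (Finset.subset_univ (Finset.univ.image e)),
      Finset.sum_image (fun a _ b _ h => he h), hnorm, Finset.mul_sum]
    · refine Finset.sum_le_sum fun k _ => ?_
      rw [he.extend_apply]
      refine mul_le_mul_of_nonneg_right ?_ (sq_nonneg _)
      refine (T : V →ₗ[ℂ] V).isSymmetric_adjoint_comp_self.eigenvalues_antitone hN ?_
      exact Fin.mk_le_of_le_val (by have := k.2; omega)
    · intro j _ hj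
      rw [Function.extend_apply' _ _ _ (by simpa using hj)]
      simp
  have hbi : ‖T (b i)‖ ^ 2 = l i := by
    have h1 := key (Pi.single i 1)
    simpa [Pi.single_apply, ite_smul, apply_ite] using h1
  have hLc0 : 0 < ‖L c‖ := by
    have : 0 < ‖L c‖ ^ 2 := by
      rw [hnorm]
      obtain ⟨k, hk⟩ := Function.ne_iff.1 hc
      exact Finset.sum_pos' (fun _ _ => by positivity) ⟨k, Finset.mem_univ k, by
        have : 0 < ‖c k‖ := norm_pos_iff.2 hk
        positivity⟩
    exact (sq_pos_iff.1 this).lt_of_le' (norm_nonneg _)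
  have h2 : ‖T (L c)‖ ≤ ‖T - F‖ * ‖L c‖ := by
    have := (T - F).le_opNorm (L c)
    rwa [sub_apply, show F (L c) = 0 from hFc, sub_zero] at this
  have h3 : ‖T (b i)‖ * ‖L c‖ ≤ ‖T - F‖ * ‖L c‖ := by
    refine le_trans ?_ h2
    refine le_of_sq_le_sq ?_ (norm_nonneg _)
    rw [mul_pow, hbi]; exact hTx
  have h4 : ‖T (b i)‖ ≤ ‖T - F‖ := le_of_mul_le_mul_right h3 hLc0
  simp only [enorm_eq_nnnorm]
  exact_mod_cast h4

/-- The trace of a finite-dimensional operator is dominated by the sum of its singular numbers. -/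
theorem enorm_trace_le_tsum_singNum (T : V →L[ℂ] V) :
    ‖LinearMap.trace ℂ V (T : V →ₗ[ℂ] V)‖ₑ ≤ ∑' n, singNum n T := by
  set b := (T : V →ₗ[ℂ] V).isSymmetric_adjoint_comp_self.eigenvectorBasis rfl with hb
  -- The basis diagonalizes T*T rather than T: Cauchy–Schwarz bounds the diagonal entries of T by ‖T
  -- b_i‖, which are its singular values.
  rw [LinearMap.trace_eq_sum_inner _ b]
  refine (enorm_sum_le _ _).trans ?_
  refine le_trans (Finset.sum_le_sum (g := fun i : Fin _ => singNum (i : ℕ) T) fun i _ => ?_) ?_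
  · refine le_trans ?_ (singularValues_le_singNum T rfl i)
    have h := norm_inner_le_norm (𝕜 := ℂ) (b i) (T (b i))
    rw [b.orthonormal.1 i, one_mul] at h
    simp only [enorm_eq_nnnorm]
    exact_mod_cast h
  · rw [Fin.sum_univ_eq_sum_range (fun n => singNum n T)]
    exact ENNReal.sum_le_tsum _

end Inner

section Normed

variable {V : Type*} [NormedAddCommGroup V] [NormedSpace ℂ V] [FiniteDimensional ℂ V]

variable (V) in
/-- The trace as a continuous functional on the operators of a finite-dimensional space. -/
def trCLM : (V →L[ℂ] V) →L[ℂ] ℂ :=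
  LinearMap.toContinuousLinearMap
    ((LinearMap.trace ℂ V) ∘ₗ (ContinuousLinearMap.coeLM ℂ : (V →L[ℂ] V) →ₗ[ℂ] (V →ₗ[ℂ] V)))

theorem trCLM_apply (T : V →L[ℂ] V) : trCLM V T = LinearMap.trace ℂ V (T : V →ₗ[ℂ] V) := rfl

theorem trCLM_mul_comm (S T : V →L[ℂ] V) : trCLM V (S * T) = trCLM V (T * S) :=
  LinearMap.trace_mul_comm ℂ (S : V →ₗ[ℂ] V) (T : V →ₗ[ℂ] V)

theorem differentiable_det :
    Differentiable ℂ fun T : V →L[ℂ] V => LinearMap.det (T : V →ₗ[ℂ] V) := by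
  have h : (fun T : V →L[ℂ] V => LinearMap.det (T : V →ₗ[ℂ] V)) = fun T : V →L[ℂ] V =>
      Matrix.det (LinearMap.toMatrix (Module.finBasis ℂ V) (Module.finBasis ℂ V)
        (T : V →ₗ[ℂ] V)) := by
    ext T; rw [LinearMap.det_toMatrix]
  rw [h]
  simp only [Matrix.det_apply']
  refine ContDiff.differentiable (n := 1) (ContDiff.sum fun σ _ => contDiff_const.mul
    (contDiff_prod fun i _ => ?_)) (by norm_num)
  let φ : (V →L[ℂ] V) →ₗ[ℂ] ℂ :=
    (Matrix.entryLinearMap ℂ ℂ (σ i) i) ∘ₗ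
      (LinearMap.toMatrix (Module.finBasis ℂ V) (Module.finBasis ℂ V)).toLinearMap ∘ₗ
      (ContinuousLinearMap.coeLM ℂ : (V →L[ℂ] V) →ₗ[ℂ] (V →ₗ[ℂ] V))
  exact (LinearMap.toContinuousLinearMap φ).contDiff

theorem hasDerivAt_det_one_add_smul (M : V →L[ℂ] V) :
    HasDerivAt (fun t : ℂ => LinearMap.det ((1 + t • M : V →L[ℂ] V) : V →ₗ[ℂ] V))
      (trCLM V M) 0 := by
  set b := Module.finBasis ℂ V
  set A := LinearMap.toMatrix b b (M : V →ₗ[ℂ] V) with hA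
  have h1 : (fun t : ℂ => LinearMap.det ((1 + t • M : V →L[ℂ] V) : V →ₗ[ℂ] V)) =
      fun t => Polynomial.eval t (1 + (Polynomial.X : Polynomial ℂ) • A.map ⇑Polynomial.C).det := by
    ext t
    rw [← LinearMap.det_toMatrix b]
    change _ = Polynomial.evalRingHom t _
    rw [RingHom.map_det]
    congr 1
    have h2 : LinearMap.toMatrix b b ((1 + t • M : V →L[ℂ] V) : V →ₗ[ℂ] V) = 1 + t • A := by
      rw [hA, ← LinearMap.toMatrix_one b, ← map_smul, ← map_add]
      rfl
    rw [h2]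
    ext i j
    by_cases hij : i = j <;> simp [hij] <;> exact mul_comm _ _
  rw [h1, trCLM_apply, LinearMap.trace_eq_matrix_trace ℂ b, ← hA,
    ← Matrix.derivative_det_one_add_X_smul]
  exact Polynomial.hasDerivAt _ _

/-- Jacobi's formula. -/
theorem HasDerivAt.linearMap_det {D : ℂ → V →L[ℂ] V} {D' J : V →L[ℂ] V} {z : ℂ}
    (hD : HasDerivAt D D' z) (hJ : D z * J = 1) :
    HasDerivAt (fun ζ => LinearMap.det (D ζ : V →ₗ[ℂ] V))
      (LinearMap.det (D z : V →ₗ[ℂ] V) * trCLM V (J * D')) z := by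
  have hd1 : HasFDerivAt (fun T : V →L[ℂ] V => LinearMap.det (T : V →ₗ[ℂ] V)) (trCLM V) 1 := by
    have h := (differentiable_det (V := V) 1).hasFDerivAt
    convert h using 1
    ext M
    have h2 : HasDerivAt (fun t : ℂ => (1 + t • M : V →L[ℂ] V)) M 0 := by
      simpa using ((hasDerivAt_id (0 : ℂ)).smul_const M).const_add (1 : V →L[ℂ] V)
    have h3 := HasFDerivAt.comp_hasDerivAt (0 : ℂ)
      (l := fun T : V →L[ℂ] V => LinearMap.det (T : V →ₗ[ℂ] V)) (by simpa using h) h2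
    exact (hasDerivAt_det_one_add_smul M).unique h3
  have hJ' : J * D z = 1 := by
    have : (J : V →ₗ[ℂ] V) * (D z : V →ₗ[ℂ] V) = 1 := by
      rw [mul_eq_one_comm]
      exact congrArg (fun T : V →L[ℂ] V => (T : V →ₗ[ℂ] V)) hJ
    ext x
    exact congrArg (fun T : V →ₗ[ℂ] V => T x) this
  -- Multiplication by J moves the base point to 1, where the derivative of the determinant is the
  -- trace; the factor det (D z) is put back afterwards.
  have h4 : HasDerivAt (fun ζ => J * D ζ) (J * D') z := hD.const_mul J
  have h5 := HasFDerivAt.comp_hasDerivAt z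
      (l := fun T : V →L[ℂ] V => LinearMap.det (T : V →ₗ[ℂ] V)) (by rw [hJ']; exact hd1) h4
  have h6 := h5.const_mul (LinearMap.det (D z : V →ₗ[ℂ] V))
  refine h6.congr_of_eventuallyEq (Eventually.of_forall fun ζ => ?_)
  simp only [Function.comp]
  rw [← LinearMap.det_comp]
  congr 1
  change _ = ((D z * (J * D ζ) : V →L[ℂ] V) : V →ₗ[ℂ] V)
  rw [← mul_assoc, hJ, one_mul]

/-- Sylvester's identity, the tool for moving a determinant from one finite-dimensional space to
another through which the operator factors. -/
theorem det_one_sub_comp_comm {V W : Type*} [AddCommGroup V] [Module ℂ V] [FiniteDimensional ℂ V]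
    [AddCommGroup W] [Module ℂ W] [FiniteDimensional ℂ W] (f : V →ₗ[ℂ] W) (g : W →ₗ[ℂ] V) :
    LinearMap.det (1 - g ∘ₗ f) = LinearMap.det (1 - f ∘ₗ g) := by
  rw [← LinearMap.det_toMatrix (Module.finBasis ℂ V), ← LinearMap.det_toMatrix (Module.finBasis ℂ W),
    map_sub, map_sub, LinearMap.toMatrix_one, LinearMap.toMatrix_one,
    LinearMap.toMatrix_comp _ (Module.finBasis ℂ W) _, LinearMap.toMatrix_comp _ (Module.finBasis ℂ V) _,
    Matrix.det_one_sub_mul_comm]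

end Normed
end FiniteDimensional

/-! ### The series for the logarithm of the regularized determinant -/

section LogDet

variable {V : Type*} [NormedAddCommGroup V] [NormedSpace ℂ V] [FiniteDimensional ℂ V]

/-- The tail `∑ tr (G ^ j) / j`, `j ≥ p`, of the series for `-log det (1 - G)`. -/
def logTail (p : ℕ) (G : V →L[ℂ] V) : ℂ := ∑' j : ℕ, trCLM V (G ^ (p + j)) / ((p + j : ℕ) : ℂ)

theorem norm_trCLM_pow_div_le {p : ℕ} (hp : 1 ≤ p) (G : V →L[ℂ] V) {r : ℝ} (hr : ‖G‖ ≤ r) (j : ℕ) :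
    ‖trCLM V (G ^ (p + j)) / ((p + j : ℕ) : ℂ)‖ ≤ ‖trCLM V‖ * r ^ (p + j) := by
  have h1 : ‖trCLM V (G ^ (p + j))‖ ≤ ‖trCLM V‖ * r ^ (p + j) :=
    ((trCLM V).le_opNorm _).trans (mul_le_mul_of_nonneg_left
      ((norm_pow_le' G (by omega)).trans (pow_le_pow_left₀ (norm_nonneg _) hr _)) (norm_nonneg _))
  rw [norm_div, Complex.norm_natCast]
  refine (div_le_self (norm_nonneg _) ?_).trans h1
  exact_mod_cast (by omega : 1 ≤ p + j)

theorem summable_geometric_add (C : ℝ) (p : ℕ) {r : ℝ} (h0 : 0 ≤ r) (hr : r < 1) :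
    Summable fun j : ℕ => C * r ^ (p + j) := by
  have := (summable_geometric_of_lt_one h0 hr).mul_left (C * r ^ p)
  refine this.congr fun j => ?_
  rw [pow_add, mul_assoc]

theorem summable_logTail {p : ℕ} (hp : 1 ≤ p) (G : V →L[ℂ] V) (hG : ‖G‖ < 1) :
    Summable fun j : ℕ => trCLM V (G ^ (p + j)) / ((p + j : ℕ) : ℂ) :=
  Summable.of_norm_bounded (summable_geometric_add _ p (norm_nonneg G) hG)
    (norm_trCLM_pow_div_le hp G le_rfl)

theorem hasDerivAt_logTail_smul (G : V →L[ℂ] V) {R : ℝ} (hR : 0 < R) (hRG : R * ‖G‖ < 1) {t : ℂ}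
    (ht : t ∈ Metric.ball (0 : ℂ) R) :
    HasDerivAt (fun t : ℂ => logTail 1 (t • G)) (∑' j : ℕ, trCLM V (G * (t • G) ^ j)) t := by
  have hmain := hasDerivAt_tsum_of_isPreconnected
    (g := fun (j : ℕ) (t : ℂ) => trCLM V ((t • G) ^ (1 + j)) / ((1 + j : ℕ) : ℂ))
    (g' := fun (j : ℕ) (t : ℂ) => trCLM V (G * (t • G) ^ j))
    (u := fun j : ℕ => (‖trCLM V‖ * ‖G‖) * (R * ‖G‖) ^ j)
    (t := Metric.ball (0 : ℂ) R) (y₀ := 0) (y := t)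
    ((summable_geometric_of_lt_one (by positivity) hRG).mul_left _)
    Metric.isOpen_ball (convex_ball _ _).isPreconnected ?_ ?_ (Metric.mem_ball_self hR) ?_ ht
  · exact hmain
  · intro j s _
    have hj : ((1 + j : ℕ) : ℂ) ≠ 0 := by exact_mod_cast (by omega : 1 + j ≠ 0)
    have h1 : HasDerivAt (fun t : ℂ => t ^ (1 + j) * (trCLM V (G ^ (1 + j)) / ((1 + j : ℕ) : ℂ)))
        (((1 + j : ℕ) : ℂ) * s ^ (1 + j - 1) * (trCLM V (G ^ (1 + j)) / ((1 + j : ℕ) : ℂ))) s :=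
      (hasDerivAt_pow (1 + j) s).mul_const _
    refine (h1.congr_deriv ?_).congr_of_eventuallyEq (Eventually.of_forall fun t => ?_)
    rotate_left
    · change trCLM V ((t • G) ^ (1 + j)) / _ = _
      rw [smul_pow, map_smul, smul_eq_mul, mul_div_assoc]
    · rw [smul_pow, mul_smul_comm, map_smul, smul_eq_mul, ← pow_succ', add_comm j 1,
        Nat.add_sub_cancel_left]
      field_simp
  · intro j s hs
    have hs' : ‖s‖ ≤ R := by simpa using (Metric.mem_ball.1 hs).le
    refine ((trCLM V).le_opNorm _).trans ?_
    rw [mul_assoc]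
    refine mul_le_mul_of_nonneg_left ?_ (norm_nonneg _)
    rw [smul_pow, mul_smul_comm, ← pow_succ', norm_smul, norm_pow]
    refine (mul_le_mul_of_nonneg_left (norm_pow_le' G (Nat.succ_pos j)) (by positivity)).trans ?_
    rw [mul_pow, pow_succ]
    have : ‖s‖ ^ j ≤ R ^ j := pow_le_pow_left₀ (norm_nonneg _) hs' _
    calc ‖s‖ ^ j * (‖G‖ ^ j * ‖G‖) ≤ R ^ j * (‖G‖ ^ j * ‖G‖) :=
          mul_le_mul_of_nonneg_right this (by positivity)
      _ = _ := by ring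
  · simpa only [zero_smul] using summable_logTail (p := 1) le_rfl (0 : V →L[ℂ] V) (by simp)

/-- By Jacobi's formula and termwise differentiation, det(1 - tG) · exp(∑ tr (tG)^j / j) has
derivative zero in t. It equals 1 at t = 0, and t = 1 gives the claim without choosing a logarithm.
-/
theorem det_one_sub_eq_exp (G : V →L[ℂ] V) (hG : ‖G‖ < 1) :
    LinearMap.det ((1 - G : V →L[ℂ] V) : V →ₗ[ℂ] V) = Complex.exp (-logTail 1 G) := by
  have : CompleteSpace V := FiniteDimensional.complete ℂ V
  -- A radius slightly above 1 keeps t = 1 inside the open disc while the series still converges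
  -- uniformly.
  obtain ⟨R, hR1, hRG⟩ : ∃ R : ℝ, 1 < R ∧ R * ‖G‖ < 1 := by
    have h : Tendsto (fun R : ℝ => R * ‖G‖) (𝓝[>] 1) (𝓝 (1 * ‖G‖)) :=
      (tendsto_id.mono_left nhdsWithin_le_nhds).mul_const _
    have := (h.eventually (gt_mem_nhds (by simpa using hG))).and self_mem_nhdsWithin
    obtain ⟨R, h1, h2⟩ := this.exists
    exact ⟨R, h2, h1⟩
  have hR : 0 < R := by linarith
  have hder : ∀ t ∈ Metric.ball (0 : ℂ) R, HasDerivAt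
      (fun t : ℂ => LinearMap.det ((1 - t • G : V →L[ℂ] V) : V →ₗ[ℂ] V) *
        Complex.exp (logTail 1 (t • G))) 0 t := by
    intro t ht
    have htG : ‖t • G‖ < 1 := by
      rw [norm_smul]
      refine lt_of_le_of_lt (mul_le_mul_of_nonneg_right ?_ (norm_nonneg _)) hRG
      simpa using (Metric.mem_ball.1 ht).le
    have hinv : (1 - t • G) * ∑' j : ℕ, (t • G) ^ j = 1 := mul_neg_geom_series _ htG
    have hD : HasDerivAt (fun t : ℂ => (1 - t • G : V →L[ℂ] V)) (-G) t := by
      simpa using ((hasDerivAt_id t).smul_const G).const_sub (1 : V →L[ℂ] V)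
    have h1 := HasDerivAt.linearMap_det hD hinv
    have h2 := (hasDerivAt_logTail_smul G hR hRG ht).cexp
    have h3 := h1.mul h2
    refine h3.congr_deriv ?_
    have h4 : ∑' j : ℕ, trCLM V (G * (t • G) ^ j) = trCLM V ((∑' j : ℕ, (t • G) ^ j) * G) := by
      have hs := summable_geometric_of_norm_lt_one htG
      rw [trCLM_mul_comm, ← hs.tsum_mul_left, ContinuousLinearMap.map_tsum _ (hs.mul_left G)]
    rw [h4, mul_neg, map_neg]
    ring
  have hconst := IsOpen.is_const_of_deriv_eq_zero Metric.isOpen_ball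
    (convex_ball (0 : ℂ) R).isPreconnected
    (fun t ht => (hder t ht).differentiableAt.differentiableWithinAt)
    (fun t ht => (hder t ht).deriv)
    (show (1 : ℂ) ∈ Metric.ball (0 : ℂ) R by simpa using hR1)
    (Metric.mem_ball_self hR)
  have h0 : logTail 1 (0 : V →L[ℂ] V) = 0 := by
    rw [logTail]
    have : ∀ j : ℕ, (0 : V →L[ℂ] V) ^ (1 + j) = 0 := fun j => zero_pow (by omega)
    simp [this]
  simp only [one_smul, zero_smul, sub_zero, h0, Complex.exp_zero, mul_one] at hconst
  have h1 : LinearMap.det ((1 : V →L[ℂ] V) : V →ₗ[ℂ] V) = 1 := LinearMap.det_id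
  rw [h1] at hconst
  rw [Complex.exp_neg]
  exact eq_inv_of_mul_eq_one_left hconst

/-- The regularizing factor cancels exactly the first p - 1 terms of the series, and those are the
terms that the p-th Schatten sum cannot control. -/
theorem det_mul_exp_eq_exp_logTail {p : ℕ} (hp : 1 ≤ p) (G : V →L[ℂ] V) (hG : ‖G‖ < 1) :
    LinearMap.det ((1 - G : V →L[ℂ] V) : V →ₗ[ℂ] V) *
      Complex.exp (∑ j ∈ Finset.Ico 1 p, (j : ℂ)⁻¹ * trCLM V (G ^ j)) =
      Complex.exp (-logTail p G) := by
  rw [det_one_sub_eq_exp G hG, ← Complex.exp_add]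
  congr 1
  have h := (summable_logTail le_rfl G hG).sum_add_tsum_nat_add (p - 1)
  rw [logTail, ← h, logTail, Finset.sum_Ico_eq_sum_range]
  have h1 : ∀ j : ℕ, trCLM V (G ^ (1 + (j + (p - 1)))) / ((1 + (j + (p - 1)) : ℕ) : ℂ) =
      trCLM V (G ^ (p + j)) / ((p + j : ℕ) : ℂ) := fun j => by
    have : 1 + (j + (p - 1)) = p + j := by omega
    rw [this]
  rw [tsum_congr h1]
  have h2 : ∀ j ∈ Finset.range (p - 1), (((1 + j : ℕ) : ℂ))⁻¹ * trCLM V (G ^ (1 + j)) =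
      trCLM V (G ^ (1 + j)) / ((1 + j : ℕ) : ℂ) := fun j _ => by rw [div_eq_inv_mul]
  rw [Finset.sum_congr rfl h2]
  ring

theorem differentiableOn_logTail_line {p : ℕ} (hp : 1 ≤ p) (G X : V →L[ℂ] V) {U : Set ℂ}
    (hU : IsOpen U) {r : ℝ} (hr0 : 0 ≤ r) (hr : r < 1) (h : ∀ t ∈ U, ‖G + t • X‖ ≤ r) :
    DifferentiableOn ℂ (fun t : ℂ => logTail p (G + t • X)) U := by
  refine Complex.differentiableOn_tsum_of_summable_norm
    (summable_geometric_add ‖trCLM V‖ p hr0 hr) (fun j => ?_) hU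
    (fun j t ht => norm_trCLM_pow_div_le hp _ (h t ht) j)
  have : Differentiable ℂ fun t : ℂ => (G + t • X) := by fun_prop
  exact (((trCLM V).differentiable.comp (this.pow (p + j))).div_const _).differentiableOn

end LogDet

section LogDetInner

variable {V : Type*} [NormedAddCommGroup V] [InnerProductSpace ℂ V] [FiniteDimensional ℂ V]

/-- The point is that the bound does not depend on the dimension of V. The trace estimate by
singular numbers bounds the j-th term by p M 2^(-j). -/
theorem norm_logTail_le {p : ℕ} (hp : 1 ≤ p) (G : V →L[ℂ] V) (hG : ‖G‖ ≤ 1 / 2) {M : ℝ}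
    (hM0 : 0 ≤ M) (hM : schattenSum p G ≤ ENNReal.ofReal M) :
    ‖logTail p G‖ ≤ 2 * p * M := by
  have h1 : ∀ j : ℕ, ‖trCLM V (G ^ (p + j)) / ((p + j : ℕ) : ℂ)‖ ≤ p * M * (1 / 2) ^ j := by
    intro j
    rw [norm_div, Complex.norm_natCast]
    refine (div_le_self (norm_nonneg _) ?_).trans ?_
    · exact_mod_cast (by omega : 1 ≤ p + j)
    have h2 := (enorm_trace_le_tsum_singNum (G ^ (p + j))).trans
      (tsum_singNum_pow_le hp (Nat.le_add_right p j) G)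
    have h3 : ‖G‖ₑ ≤ ENNReal.ofReal (1 / 2) := by
      rw [← ofReal_norm]; exact ENNReal.ofReal_le_ofReal hG
    have h4 : ‖LinearMap.trace ℂ V ((G ^ (p + j) : V →L[ℂ] V) : V →ₗ[ℂ] V)‖ₑ
        ≤ ENNReal.ofReal (p * M * (1 / 2) ^ j) := by
      refine h2.trans ?_
      rw [Nat.add_sub_cancel_left, ENNReal.ofReal_mul (by positivity), ENNReal.ofReal_mul
        (by positivity), ENNReal.ofReal_pow (by norm_num), ENNReal.ofReal_natCast]
      exact mul_le_mul' (mul_le_mul_right hM _) (pow_le_pow_left' h3 _)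
    rw [← ofReal_norm] at h4
    exact (ENNReal.ofReal_le_ofReal_iff (by positivity)).1 h4
  have h5 := tsum_of_norm_bounded (hasSum_geometric_two.mul_left (p * M)) h1
  rw [logTail]
  refine h5.trans (le_of_eq (by ring))

/-- The Schwarz lemma turns the uniform bound into a Lipschitz bound. On the complex line t ↦ G + t
X the tail is holomorphic for |t| < 1/(4δ) and stays within 4pC of its value at 0; evaluating at t =
1 gains the factor 4δ. -/
theorem dist_logTail_le {p : ℕ} (hp : 1 ≤ p) (G G' : V →L[ℂ] V) (hG : ‖G‖ ≤ 1 / 4) {M δ : ℝ}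
    (hM0 : 0 ≤ M) (hM : schattenSum p G ≤ ENNReal.ofReal M) (hδ : 0 < δ) (hδ' : 4 * δ < 1)
    (hX : schattenSum p (G' - G) ≤ ENNReal.ofReal δ ^ p) :
    dist (logTail p G') (logTail p G) ≤ 16 * p * (2 * 2 ^ p * (M + 1)) * δ := by
  set X := G' - G with hXdef
  set C := 2 * 2 ^ p * (M + 1) with hC
  have hXn : ‖X‖ ≤ δ := by
    have := (enorm_pow_le_schattenSum p X).trans hX
    have h2 := (ENNReal.pow_le_pow_left_iff (by omega : p ≠ 0)).1 this
    rw [← ofReal_norm] at h2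
    exact (ENNReal.ofReal_le_ofReal_iff hδ.le).1 h2
  have hmem : ∀ t ∈ Metric.ball (0 : ℂ) (1 / (4 * δ)), ‖t‖ * δ ≤ 1 / 4 := by
    intro t ht
    have h1 : ‖t‖ < 1 / (4 * δ) := by simpa using ht
    have h2 : ‖t‖ * δ < 1 / (4 * δ) * δ := mul_lt_mul_of_pos_right h1 hδ
    have h3 : 1 / (4 * δ) * δ = 1 / 4 := by field_simp
    linarith
  have hline : ∀ t ∈ Metric.ball (0 : ℂ) (1 / (4 * δ)), ‖G + t • X‖ ≤ 1 / 2 := by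
    intro t ht
    have := hmem t ht
    have h1 : ‖t • X‖ ≤ ‖t‖ * δ := by
      rw [norm_smul]; exact mul_le_mul_of_nonneg_left hXn (norm_nonneg _)
    have := norm_add_le G (t • X)
    linarith
  have hbound : ∀ t ∈ Metric.ball (0 : ℂ) (1 / (4 * δ)),
      ‖logTail p (G + t • X)‖ ≤ 2 * p * C := by
    intro t ht
    refine norm_logTail_le hp _ (hline t ht) (by positivity) ?_
    refine (schattenSum_add_le p _ _).trans ?_
    have h1 : schattenSum p (t • X) ≤ ENNReal.ofReal 1 := by
      refine (schattenSum_smul_le p t X).trans ?_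
      refine (mul_le_mul_right hX _).trans ?_
      rw [← mul_pow, ← ofReal_norm, ← ENNReal.ofReal_mul (norm_nonneg _)]
      have : ENNReal.ofReal (‖t‖ * δ) ≤ 1 := by
        rw [ENNReal.ofReal_le_one]; linarith [hmem t ht]
      simpa using pow_le_one' this p
    have h2 : (2 * 2 ^ p : ℝ≥0∞) = ENNReal.ofReal (2 * 2 ^ p) := by
      rw [ENNReal.ofReal_mul (by norm_num), ENNReal.ofReal_pow (by norm_num)]; norm_num
    rw [hC, h2, ENNReal.ofReal_mul (p := 2 * 2 ^ p) (by positivity),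
      ENNReal.ofReal_add hM0 (by norm_num)]
    exact mul_le_mul_right (add_le_add hM h1) _
  have hdiff := differentiableOn_logTail_line hp G X Metric.isOpen_ball (r := 1 / 2) (by norm_num)
    (by norm_num) hline
  have h0 : (0 : ℂ) ∈ Metric.ball (0 : ℂ) (1 / (4 * δ)) := Metric.mem_ball_self (by positivity)
  have hmaps : Set.MapsTo (fun t : ℂ => logTail p (G + t • X)) (Metric.ball (0 : ℂ) (1 / (4 * δ)))
      (Metric.closedBall ((fun t : ℂ => logTail p (G + t • X)) 0) (4 * p * C)) := by
    intro t ht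
    rw [Metric.mem_closedBall, dist_eq_norm]
    refine (norm_sub_le _ _).trans ?_
    have h1 := hbound t ht
    have h2 := hbound 0 h0
    linarith
  have h1 : (1 : ℂ) ∈ Metric.ball (0 : ℂ) (1 / (4 * δ)) := by
    simp only [Metric.mem_ball, dist_zero_right, norm_one]
    rw [lt_div_iff₀ (by positivity)]
    linarith
  have h := Complex.dist_le_div_mul_dist_of_mapsTo_ball hdiff hmaps h1
  have h2 : G + (1 : ℂ) • X = G' := by rw [hXdef, one_smul]; abel
  simp only [h2, zero_smul, add_zero, dist_zero_right, norm_one, mul_one] at h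
  refine h.trans (le_of_eq ?_)
  field_simp
  ring

end LogDetInner

/-! ### Compression of finite rank operators to finite-dimensional subspaces -/

section Compression

variable {K : Type*} [NormedAddCommGroup K] [InnerProductSpace ℂ K]

/-- The compression of an operator to a finite-dimensional subspace. -/
def cmp (V : Submodule ℂ K) [FiniteDimensional ℂ V] (F : K →L[ℂ] K) : V →L[ℂ] V :=
  V.orthogonalProjectionOnto ∘L F ∘L V.subtypeL

variable (V : Submodule ℂ K) [FiniteDimensional ℂ V]

theorem cmp_sub (F G : K →L[ℂ] K) : cmp V (F - G) = cmp V F - cmp V G := by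
  ext; simp [cmp]

theorem norm_cmp_le (F : K →L[ℂ] K) : ‖cmp V F‖ ≤ ‖F‖ := by
  refine (ContinuousLinearMap.opNorm_comp_le _ _).trans ?_
  refine (mul_le_mul V.orthogonalProjectionOnto_norm_le
    (ContinuousLinearMap.opNorm_comp_le _ _) (norm_nonneg _) zero_le_one).trans ?_
  rw [one_mul]
  exact mul_le_of_le_one_right (norm_nonneg _) (Submodule.norm_subtypeL_le V)

theorem singNum_cmp_le (n : ℕ) (F : K →L[ℂ] K) : singNum n (cmp V F) ≤ singNum n F := by
  refine le_iInf ?_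
  rintro ⟨G, hG⟩
  refine (singNum_le_of_rank_le (cmp V F) (cmp V G) ?_).trans ?_
  · exact (LinearMap.rank_comp_le_right ((G : K →ₗ[ℂ] K) ∘ₗ V.subtype)
      (V.orthogonalProjectionOnto : K →ₗ[ℂ] V)).trans
      ((LinearMap.rank_comp_le_left V.subtype (G : K →ₗ[ℂ] K)).trans hG)
  · rw [← cmp_sub]
    simp only [enorm_eq_nnnorm]
    exact_mod_cast norm_cmp_le V (F - G)

theorem schattenSum_cmp_le (p : ℕ) (F : K →L[ℂ] K) : schattenSum p (cmp V F) ≤ schattenSum p F :=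
  ENNReal.tsum_le_tsum fun n => pow_le_pow_left' (singNum_cmp_le V n F) p

variable {V}

theorem coe_cmp_apply {F : K →L[ℂ] K} (hF : ∀ x, F x ∈ V) (v : V) : (cmp V F v : K) = F v :=
  V.starProjection_eq_self_iff.2 (hF v)

/-- With a the inclusion of the range into V and b the map F from V to its range, the two operators
are a b and b a, whose positive powers have equal traces. The exponent 0 must be excluded, since it
would compare dimensions. -/
theorem trCLM_cmp_pow {F : K →L[ℂ] K} (hF : ∀ x, F x ∈ V) {j : ℕ} (hj : 1 ≤ j) :
    trCLM V (cmp V F ^ j) =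
      LinearMap.trace ℂ (LinearMap.range (F : K →ₗ[ℂ] K)) (onRange F ^ j) := by
  have hle : LinearMap.range (F : K →ₗ[ℂ] K) ≤ V := by rintro _ ⟨x, rfl⟩; exact hF x
  have : FiniteDimensional ℂ (LinearMap.range (F : K →ₗ[ℂ] K)) :=
    Submodule.finiteDimensional_of_le hle
  let a := Submodule.inclusion hle
  let b : V →ₗ[ℂ] LinearMap.range (F : K →ₗ[ℂ] K) := (F : K →ₗ[ℂ] K).rangeRestrict ∘ₗ V.subtype
  have hab : ((cmp V F : V →L[ℂ] V) : V →ₗ[ℂ] V) = a ∘ₗ b := by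
    ext v; exact coe_cmp_apply hF v
  have hba : onRange F = b ∘ₗ a := by ext v; rfl
  obtain ⟨k, rfl⟩ : ∃ k, j = k + 1 := ⟨j - 1, by omega⟩
  have h1 : ((cmp V F ^ (k + 1) : V →L[ℂ] V) : V →ₗ[ℂ] V) =
      ((cmp V F : V →L[ℂ] V) : V →ₗ[ℂ] V) ^ (k + 1) := by
    simp
  have h2 : ∀ k : ℕ, (a ∘ₗ b) ^ (k + 1) = a ∘ₗ (((b ∘ₗ a) ^ k) ∘ₗ b) := by
    intro k
    induction k with
    | zero => simp; rfl
    | succ k ih => rw [pow_succ, ih, pow_succ]; rfl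
  rw [trCLM_apply, h1, hab, h2, LinearMap.trace_comp_comm', LinearMap.comp_assoc, hba]
  rfl

/-- Determinant and trace may be computed on any finite-dimensional space containing the range.
Hence several finite rank operators can be compared on one common space. -/
theorem finRankDet_eq (p : ℕ) {F : K →L[ℂ] K} (hF : ∀ x, F x ∈ V) :
    finRankDet p F = LinearMap.det ((1 - cmp V F : V →L[ℂ] V) : V →ₗ[ℂ] V) *
      Complex.exp (∑ j ∈ Finset.Ico 1 p, (j : ℂ)⁻¹ * trCLM V (cmp V F ^ j)) := by
  have hle : LinearMap.range (F : K →ₗ[ℂ] K) ≤ V := by rintro _ ⟨x, rfl⟩; exact hF x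
  have : FiniteDimensional ℂ (LinearMap.range (F : K →ₗ[ℂ] K)) :=
    Submodule.finiteDimensional_of_le hle
  rw [finRankDet]
  congr 1
  · let a := Submodule.inclusion hle
    let b : V →ₗ[ℂ] LinearMap.range (F : K →ₗ[ℂ] K) := (F : K →ₗ[ℂ] K).rangeRestrict ∘ₗ V.subtype
    have hab : ((1 - cmp V F : V →L[ℂ] V) : V →ₗ[ℂ] V) = 1 - a ∘ₗ b := by
      ext v; simp [a, b, coe_cmp_apply hF v]
    have hba : onRange F = b ∘ₗ a := by ext v; rfl
    rw [hab, hba, det_one_sub_comp_comm]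
  · rw [map_sum]
    congr 1
    refine Finset.sum_congr rfl fun j hj => ?_
    rw [map_smul, smul_eq_mul, trCLM_cmp_pow hF (Finset.mem_Ico.1 hj).1]

/-- `logTail` for operators of finite rank. -/
def finRankLogTail (p : ℕ) (F : K →L[ℂ] K) : ℂ :=
  ∑' j : ℕ, LinearMap.trace ℂ (LinearMap.range (F : K →ₗ[ℂ] K)) (onRange F ^ (p + j)) /
    ((p + j : ℕ) : ℂ)

theorem finRankLogTail_eq {p : ℕ} (hp : 1 ≤ p) {F : K →L[ℂ] K} (hF : ∀ x, F x ∈ V) :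
    finRankLogTail p F = logTail p (cmp V F) :=
  tsum_congr fun j => by rw [trCLM_cmp_pow hF (by omega)]

end Compression

/-! ### Density of finite rank operators in the Schatten class -/

section Density

variable {K : Type*} [NormedAddCommGroup K] [InnerProductSpace ℂ K]

theorem finiteDimensional_range_of_rank_le {F : K →L[ℂ] K} {n : ℕ}
    (hF : LinearMap.rank (F : K →ₗ[ℂ] K) ≤ n) :
    FiniteDimensional ℂ (LinearMap.range (F : K →ₗ[ℂ] K)) :=
  Module.rank_lt_aleph0_iff.1 (lt_of_le_of_lt hF (Cardinal.natCast_lt_aleph0))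

/-- The first 4n singular numbers are bounded by the norm. Beyond them s_{k+4n}(L - F) ≤ s_{k+2n}(L)
+ s_{2n}(F), and the last term vanishes because of the rank of F. -/
theorem schattenSum_sub_le_of_rank_le (p : ℕ) (L F : K →L[ℂ] K) (n : ℕ)
    (hF : LinearMap.rank (F : K →ₗ[ℂ] K) ≤ (2 * n : ℕ)) :
    schattenSum p (L - F) ≤ (4 * n : ℕ) * ‖L - F‖ₑ ^ p + ∑' k, singNum (k + n) L ^ p := by
  rw [schattenSum, ← ENNReal.summable.sum_add_tsum_nat_add' (k := 4 * n)]
  refine add_le_add ?_ (ENNReal.tsum_le_tsum fun k => ?_)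
  · refine (Finset.sum_le_card_nsmul _ _ (‖L - F‖ₑ ^ p) fun k _ =>
      pow_le_pow_left' (singNum_le_enorm k _) p).trans ?_
    simp
  · refine pow_le_pow_left' ?_ p
    have h0 : singNum (2 * n) (-F) = 0 := by
      refine le_antisymm ?_ bot_le
      have h1 : LinearMap.rank ((-F : K →L[ℂ] K) : K →ₗ[ℂ] K) ≤ (2 * n : ℕ) := by
        refine le_trans ?_ hF
        have : ((-F : K →L[ℂ] K) : K →ₗ[ℂ] K) = (-LinearMap.id : K →ₗ[ℂ] K) ∘ₗ (F : K →ₗ[ℂ] K) := by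
          ext; simp
        rw [this]
        exact LinearMap.rank_comp_le_right _ _
      simpa [enorm_eq_nnnorm] using singNum_le_of_rank_le (-F) (-F) h1
    have h1 := singNum_add_le (k + 2 * n) (2 * n) L (-F)
    rw [h0, add_zero, ← sub_eq_add_neg] at h1
    have h2 : k + 4 * n = k + 2 * n + 2 * n := by ring
    rw [h2]
    exact h1.trans (singNum_antitone L (by omega))

/-- Finite rank operators are dense in the Schatten class. -/
theorem exists_finiteRank_schattenSum_sub_lt {p : ℕ} (L : K →L[ℂ] K)
    (hL : schattenSum p L < ∞) {ε : ℝ≥0∞} (hε : 0 < ε) :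
    ∃ F : K →L[ℂ] K, FiniteDimensional ℂ (LinearMap.range (F : K →ₗ[ℂ] K)) ∧
      schattenSum p (L - F) < ε := by
  have htail := ENNReal.tendsto_sum_nat_add (fun n => singNum n L ^ p) hL.ne
  have h6 : Tendsto (fun n => 6 * ∑' k, singNum (k + n) L ^ p) atTop (𝓝 (6 * 0)) :=
    ENNReal.Tendsto.const_mul htail (Or.inr (by norm_num))
  rw [mul_zero] at h6
  obtain ⟨n, hn⟩ := (h6.eventually (gt_mem_nhds hε)).exists
  set t := ∑' k, singNum (k + n) L ^ p with ht
  -- Monotonicity: s_{2n} is at most each of s_n, ..., s_{2n-1}, so n s_{2n}^p is bounded by the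
  -- tail t. The factor 6 above leaves room for 4t + t.
  have hs : (4 * n : ℕ) * singNum (2 * n) L ^ p ≤ 4 * t := by
    have h1 : (n : ℝ≥0∞) * singNum (2 * n) L ^ p ≤ t := by
      refine le_trans ?_ (ENNReal.sum_le_tsum (Finset.range n))
      have := Finset.card_nsmul_le_sum (Finset.range n) (fun k => singNum (k + n) L ^ p)
        (singNum (2 * n) L ^ p) (fun k hk => pow_le_pow_left' (singNum_antitone L (by
          have := Finset.mem_range.1 hk; omega)) p)
      simpa using this
    push_cast
    rw [mul_assoc]
    exact mul_le_mul_right h1 _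
  have hcont : Tendsto (fun x : ℝ≥0∞ => (4 * n : ℕ) * x ^ p + t) (𝓝 (singNum (2 * n) L))
      (𝓝 ((4 * n : ℕ) * singNum (2 * n) L ^ p + t)) := by
    refine Tendsto.add ?_ tendsto_const_nhds
    exact ENNReal.Tendsto.const_mul (ENNReal.continuous_pow p).continuousAt
      (Or.inr (ENNReal.natCast_ne_top _))
  have htop : t ≠ ∞ := by
    refine ne_top_of_le_ne_top hL.ne ?_
    rw [schattenSum, ← ENNReal.summable.sum_add_tsum_nat_add' (k := n)]
    exact le_add_self
  have hlt : (4 * n : ℕ) * singNum (2 * n) L ^ p + t < ε := by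
    refine lt_of_le_of_lt ?_ hn
    refine (add_le_add_left hs t).trans ?_
    have : (6 : ℝ≥0∞) * t = 4 * t + t + t := by ring
    rw [this]
    exact le_self_add
  have hev := hcont.eventually (gt_mem_nhds hlt)
  -- The infimum defining s_{2n}(L) need not be attained, so continuity supplies a slightly larger
  -- admissible norm b.
  have hgt : ∃ b, singNum (2 * n) L < b ∧
      ∀ x, singNum (2 * n) L ≤ x → x < b → (4 * n : ℕ) * x ^ p + t < ε := by
    obtain ⟨b, hb1, hb2⟩ := (mem_nhdsGE_iff_exists_Ico_subset'
      (lt_top_iff_ne_top.2 (singNum_ne_top (2 * n) L))).1 (mem_nhdsWithin_of_mem_nhds hev)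
    exact ⟨b, hb1, fun x h1 h2 => hb2 ⟨h1, h2⟩⟩
  obtain ⟨b, hb, hbx⟩ := hgt
  obtain ⟨⟨F, hF⟩, hFb⟩ := iInf_lt_iff.1 (show (⨅ F : {F : K →L[ℂ] K //
    LinearMap.rank (F : K →ₗ[ℂ] K) ≤ (2 * n : ℕ)}, ‖L - F.1‖ₑ) < b from hb)
  exact ⟨F, finiteDimensional_range_of_rank_le hF,
    (schattenSum_sub_le_of_rank_le p L F n hF).trans_lt
      (hbx _ (singNum_le_of_rank_le L F hF) hFb)⟩

theorem exists_rank_le {F : K →L[ℂ] K} (hF : FiniteDimensional ℂ (LinearMap.range (F : K →ₗ[ℂ] K))) :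
    ∃ r : ℕ, LinearMap.rank (F : K →ₗ[ℂ] K) ≤ r :=
  ⟨Module.finrank ℂ (LinearMap.range (F : K →ₗ[ℂ] K)), by
    rw [LinearMap.rank, Module.finrank_eq_rank]⟩

theorem schattenSum_lt_top_of_finiteRank {p : ℕ} (hp : 1 ≤ p) {F : K →L[ℂ] K}
    (hF : FiniteDimensional ℂ (LinearMap.range (F : K →ₗ[ℂ] K))) : schattenSum p F < ∞ := by
  obtain ⟨r, hr⟩ := exists_rank_le hF
  refine (schattenSum_lt_top_of_rank_le p hp F hr).trans_lt ?_
  exact ENNReal.mul_lt_top (ENNReal.natCast_lt_top r) (ENNReal.pow_lt_top enorm_lt_top)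

theorem schattenSum_add_lt_top {p : ℕ} {S T : K →L[ℂ] K} (hS : schattenSum p S < ∞)
    (hT : schattenSum p T < ∞) : schattenSum p (S + T) < ∞ := by
  refine (schattenSum_add_le p S T).trans_lt (ENNReal.mul_lt_top ?_ (ENNReal.add_lt_top.2 ⟨hS, hT⟩))
  exact ENNReal.mul_lt_top (by norm_num) (ENNReal.pow_lt_top (by norm_num))

theorem finiteDimensional_range_add {F G : K →L[ℂ] K}
    (hF : FiniteDimensional ℂ (LinearMap.range (F : K →ₗ[ℂ] K)))
    (hG : FiniteDimensional ℂ (LinearMap.range (G : K →ₗ[ℂ] K))) :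
    FiniteDimensional ℂ (LinearMap.range ((F + G : K →L[ℂ] K) : K →ₗ[ℂ] K)) := by
  refine Submodule.finiteDimensional_of_le (S₂ := LinearMap.range (F : K →ₗ[ℂ] K) ⊔
    LinearMap.range (G : K →ₗ[ℂ] K)) ?_
  rintro _ ⟨x, rfl⟩
  exact Submodule.add_mem_sup ⟨x, rfl⟩ ⟨x, rfl⟩

theorem finiteDimensional_range_neg {F : K →L[ℂ] K}
    (hF : FiniteDimensional ℂ (LinearMap.range (F : K →ₗ[ℂ] K))) :
    FiniteDimensional ℂ (LinearMap.range ((-F : K →L[ℂ] K) : K →ₗ[ℂ] K)) := by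
  refine Submodule.finiteDimensional_of_le (S₂ := LinearMap.range (F : K →ₗ[ℂ] K)) ?_
  rintro _ ⟨x, rfl⟩
  exact ⟨-x, by simp⟩

theorem finiteDimensional_range_smul {F : K →L[ℂ] K} (c : ℂ)
    (hF : FiniteDimensional ℂ (LinearMap.range (F : K →ₗ[ℂ] K))) :
    FiniteDimensional ℂ (LinearMap.range ((c • F : K →L[ℂ] K) : K →ₗ[ℂ] K)) := by
  refine Submodule.finiteDimensional_of_le (S₂ := LinearMap.range (F : K →ₗ[ℂ] K)) ?_
  rintro _ ⟨x, rfl⟩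
  exact ⟨c • x, by simp⟩

end Density

/-! ### Continuous extension of the exponent to the Schatten class -/

section LogTailExtension

variable {K : Type*} [NormedAddCommGroup K] [InnerProductSpace ℂ K]

/-- The filter of finite rank operators tending to `L` in the Schatten norm. -/
def finRankNhds (p : ℕ) (L : K →L[ℂ] K) : Filter (K →L[ℂ] K) :=
  comap (fun F : K →L[ℂ] K => schattenNorm p (F - L)) (𝓝 0) ⊓
    𝓟 {F | FiniteDimensional ℂ (LinearMap.range (F : K →ₗ[ℂ] K))}

theorem tendsto_finRankNhds_iff {p : ℕ} (hp : 1 ≤ p) {L : K →L[ℂ] K} {α : Type*} {l : Filter α}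
    {u : α → K →L[ℂ] K} :
    Tendsto u l (finRankNhds p L) ↔ Tendsto (fun a => schattenSum p (u a - L)) l (𝓝 0) ∧
      ∀ᶠ a in l, FiniteDimensional ℂ (LinearMap.range (u a : K →ₗ[ℂ] K)) := by
  rw [finRankNhds, tendsto_inf, tendsto_comap_iff, tendsto_principal,
    ← tendsto_schattenNorm_iff hp]
  rfl

theorem finRankNhds_neBot {p : ℕ} (hp : 1 ≤ p) {L : K →L[ℂ] K} (hL : schattenSum p L < ∞) :
    (finRankNhds p L).NeBot := by
  have h : ∀ n : ℕ, ∃ F : K →L[ℂ] K, FiniteDimensional ℂ (LinearMap.range (F : K →ₗ[ℂ] K)) ∧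
      schattenSum p (L - F) < ((n : ℝ≥0∞) + 1)⁻¹ := fun n =>
    exists_finiteRank_schattenSum_sub_lt L hL (ENNReal.inv_pos.2 (by finiteness))
  choose F hF1 hF2 using h
  have ht : Tendsto F atTop (finRankNhds p L) := by
    rw [tendsto_finRankNhds_iff hp]
    refine ⟨?_, Eventually.of_forall hF1⟩
    have h0 : Tendsto (fun n : ℕ => ((n : ℝ≥0∞) + 1)⁻¹) atTop (𝓝 0) := by
      have := (tendsto_add_atTop_iff_nat 1).2 ENNReal.tendsto_inv_nat_nhds_zero
      simpa using this
    refine tendsto_of_tendsto_of_tendsto_of_le_of_le tendsto_const_nhds h0 (fun _ => bot_le)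
      fun n => ?_
    change schattenSum p (F n - L) ≤ _
    rw [← schattenSum_neg, neg_sub]
    exact (hF2 n).le
  exact ht.neBot

theorem tendsto_schattenSum_finRankNhds {p : ℕ} (hp : 1 ≤ p) (L : K →L[ℂ] K) :
    Tendsto (fun F => schattenSum p (F - L)) (finRankNhds p L) (𝓝 0) :=
  ((tendsto_finRankNhds_iff hp).1 tendsto_id).1

theorem eventually_finiteDimensional_finRankNhds {p : ℕ} (hp : 1 ≤ p) (L : K →L[ℂ] K) :
    ∀ᶠ F : K →L[ℂ] K in finRankNhds p L,
      FiniteDimensional ℂ (LinearMap.range (F : K →ₗ[ℂ] K)) :=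
  ((tendsto_finRankNhds_iff hp).1 tendsto_id).2

theorem norm_le_of_schattenSum_le {p : ℕ} (hp : 1 ≤ p) {X : K →L[ℂ] K} {δ : ℝ} (hδ : 0 ≤ δ)
    (hX : schattenSum p X ≤ ENNReal.ofReal δ ^ p) : ‖X‖ ≤ δ := by
  have := (enorm_pow_le_schattenSum p X).trans hX
  have h2 := (ENNReal.pow_le_pow_left_iff (by omega : p ≠ 0)).1 this
  rw [← ofReal_norm] at h2
  exact (ENNReal.ofReal_le_ofReal_iff hδ).1 h2

theorem eventually_schattenSum_le {p : ℕ} (hp : 1 ≤ p) (L : K →L[ℂ] K) {δ : ℝ} (hδ : 0 < δ) :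
    ∀ᶠ F in finRankNhds p L, schattenSum p (F - L) ≤ ENNReal.ofReal δ ^ p :=
  (tendsto_schattenSum_finRankNhds hp L).eventually_le_const
    (ENNReal.pow_pos (ENNReal.ofReal_pos.2 hδ) p)

theorem finRankNhds_le_nhds {p : ℕ} (hp : 1 ≤ p) (L : K →L[ℂ] K) : finRankNhds p L ≤ 𝓝 L := by
  rw [Metric.nhds_basis_closedBall.ge_iff]
  intro ε hε
  filter_upwards [eventually_schattenSum_le hp L hε] with F hF
  rw [Metric.mem_closedBall, dist_eq_norm]
  exact norm_le_of_schattenSum_le hp hε.le hF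

theorem dist_finRankLogTail_le {p : ℕ} (hp : 1 ≤ p) {A B : K →L[ℂ] K}
    (hA : FiniteDimensional ℂ (LinearMap.range (A : K →ₗ[ℂ] K)))
    (hB : FiniteDimensional ℂ (LinearMap.range (B : K →ₗ[ℂ] K)))
    (hA4 : ‖A‖ ≤ 1 / 4) {M δ : ℝ} (hM0 : 0 ≤ M) (hM : schattenSum p A ≤ ENNReal.ofReal M)
    (hδ : 0 < δ) (hδ' : 4 * δ < 1) (hX : schattenSum p (B - A) ≤ ENNReal.ofReal δ ^ p) :
    dist (finRankLogTail p B) (finRankLogTail p A) ≤ 16 * p * (2 * 2 ^ p * (M + 1)) * δ := by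
  set V := LinearMap.range (A : K →ₗ[ℂ] K) ⊔ LinearMap.range (B : K →ₗ[ℂ] K)
  have h1 : ∀ x, A x ∈ V := fun x => Submodule.mem_sup_left ⟨x, rfl⟩
  have h2 : ∀ x, B x ∈ V := fun x => Submodule.mem_sup_right ⟨x, rfl⟩
  rw [finRankLogTail_eq hp h1, finRankLogTail_eq hp h2]
  refine dist_logTail_le hp _ _ ((norm_cmp_le V A).trans hA4) hM0
    ((schattenSum_cmp_le V p A).trans hM) hδ hδ' ?_
  rw [← cmp_sub]
  exact (schattenSum_cmp_le V p _).trans hX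

/-- The constant in the quasi-triangle inequality, enlarged to cover sums of three terms. -/
def quasiConst (p : ℕ) : ℝ := 2 * 2 ^ p * (1 + 2 * (2 * 2 ^ p))

theorem one_le_quasiConst (p : ℕ) : 1 ≤ quasiConst p := by
  have h : (1 : ℝ) ≤ 2 ^ p := one_le_pow₀ (by norm_num)
  rw [quasiConst]
  nlinarith

theorem schattenSum_sub_le_three {p : ℕ} (hp : 1 ≤ p) {A B C D : K →L[ℂ] K} {δ : ℝ}
    (h1 : schattenSum p (A - B) ≤ ENNReal.ofReal δ ^ p)
    (h2 : schattenSum p (B - C) ≤ ENNReal.ofReal δ ^ p)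
    (h3 : schattenSum p (C - D) ≤ ENNReal.ofReal δ ^ p) :
    schattenSum p (A - D) ≤ ENNReal.ofReal (quasiConst p * δ) ^ p := by
  have e1 : A - D = (A - B) + ((B - C) + (C - D)) := by abel
  have hk := one_le_quasiConst p
  have hc : (2 * 2 ^ p : ℝ≥0∞) * (1 + 2 * (2 * 2 ^ p)) = ENNReal.ofReal (quasiConst p) := by
    rw [quasiConst, ENNReal.ofReal_mul (by positivity), ENNReal.ofReal_add (by positivity)
      (by positivity), ENNReal.ofReal_mul (by positivity), ENNReal.ofReal_mul (by positivity),
      ENNReal.ofReal_mul (by positivity), ENNReal.ofReal_pow (by positivity)]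
    simp
  rw [e1]
  calc schattenSum p ((A - B) + ((B - C) + (C - D)))
      ≤ 2 * 2 ^ p * (ENNReal.ofReal δ ^ p + 2 * 2 ^ p * (ENNReal.ofReal δ ^ p +
          ENNReal.ofReal δ ^ p)) := by
        refine (schattenSum_add_le p _ _).trans (mul_le_mul_right (add_le_add h1 ?_) _)
        exact (schattenSum_add_le p _ _).trans (mul_le_mul_right (add_le_add h2 h3) _)
    _ = ENNReal.ofReal (quasiConst p) * ENNReal.ofReal δ ^ p := by rw [← hc]; ring
    -- The constant is at least 1, hence at most its own p-th power, and may be moved inside.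
    -- Distances are then measured throughout by a radius δ with Schatten sum at most δ^p.
    _ ≤ ENNReal.ofReal (quasiConst p * δ) ^ p := by
        rw [ENNReal.ofReal_mul (by positivity), mul_pow]
        refine mul_le_mul_left ?_ _
        refine le_self_pow₀ ?_ (by omega)
        exact ENNReal.one_le_ofReal.2 hk

theorem schattenSum_self_sub (p : ℕ) (hp : 1 ≤ p) (A : K →L[ℂ] K) : schattenSum p (A - A) = 0 := by
  have := schattenSum_smul_le p 0 A
  rw [zero_smul, enorm_zero, zero_pow (by omega), zero_mul] at this
  rw [sub_self]
  exact le_antisymm this bot_le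

/-- Near an operator of norm less than `1 / 4` in the Schatten class, `finRankLogTail` is
Lipschitz. -/
theorem exists_lipschitz_finRankLogTail {p : ℕ} (hp : 1 ≤ p) {G : K →L[ℂ] K} (hG : ‖G‖ < 1 / 4)
    (hGp : schattenSum p G < ∞) :
    ∃ C η : ℝ, 0 < C ∧ 0 < η ∧ η < 1 / 4 ∧ ‖G‖ + η ≤ 1 / 4 ∧ ∀ A B : K →L[ℂ] K,
      FiniteDimensional ℂ (LinearMap.range (A : K →ₗ[ℂ] K)) →
      FiniteDimensional ℂ (LinearMap.range (B : K →ₗ[ℂ] K)) →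
      schattenSum p (A - G) ≤ ENNReal.ofReal η ^ p →
      ∀ δ, 0 < δ → δ < 1 / 4 → schattenSum p (B - A) ≤ ENNReal.ofReal δ ^ p →
      dist (finRankLogTail p B) (finRankLogTail p A) ≤ C * δ := by
  -- A bound for the Schatten sums on the whole η-ball about G: the 1 absorbs η^p. Taking η as half
  -- of 1/4 - ‖G‖ keeps that ball within norm 1/4.
  set M := 2 * 2 ^ p * ((schattenSum p G).toReal + 1)
  have hη0 : 0 < (1 / 4 - ‖G‖) / 2 := by linarith
  refine ⟨16 * p * (2 * 2 ^ p * (M + 1)), (1 / 4 - ‖G‖) / 2, by positivity, hη0, ?_, ?_, ?_⟩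
  · have := norm_nonneg G; linarith
  · linarith
  intro A B hA hB hAG δ hδ hδ4 hBA
  refine dist_finRankLogTail_le hp hA hB ?_ (by positivity) ?_ hδ (by linarith) hBA
  · have h1 := norm_le_of_schattenSum_le hp hη0.le hAG
    have h2 := norm_add_le (A - G) G
    rw [sub_add_cancel] at h2
    linarith
  · have h1 := schattenSum_add_le p (A - G) G
    rw [sub_add_cancel] at h1
    refine h1.trans ?_
    rw [ENNReal.ofReal_mul (by positivity), ENNReal.ofReal_add (by positivity) (by positivity),
      ENNReal.ofReal_toReal hGp.ne, ENNReal.ofReal_mul (by positivity),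
      ENNReal.ofReal_pow (by positivity), add_comm]
    have h3 : ENNReal.ofReal ((1 / 4 - ‖G‖) / 2) ^ p ≤ ENNReal.ofReal 1 := by
      rw [ENNReal.ofReal_one]
      refine pow_le_one' (ENNReal.ofReal_le_one.2 ?_) p
      have := norm_nonneg G; linarith
    have h4 : ENNReal.ofReal 2 = 2 := by norm_num
    rw [h4]
    exact mul_le_mul_right (add_le_add_right (hAG.trans h3) _) _

/-- The extension of `finRankLogTail` to operators of the Schatten class. -/
def logTailExt (p : ℕ) (G : K →L[ℂ] K) : ℂ := limUnder (finRankNhds p G) (finRankLogTail p)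

theorem tendsto_finRankLogTail {p : ℕ} (hp : 1 ≤ p) {G : K →L[ℂ] K} (hG : ‖G‖ < 1 / 4)
    (hGp : schattenSum p G < ∞) :
    Tendsto (finRankLogTail p) (finRankNhds p G) (𝓝 (logTailExt p G)) := by
  have := finRankNhds_neBot hp hGp
  have hc : Cauchy (map (finRankLogTail p) (finRankNhds p G)) := by
    rw [Metric.cauchy_iff]
    refine ⟨inferInstance, fun ε hε => ?_⟩
    obtain ⟨C, η, hC, hη, hη4, hGη, hlip⟩ := exists_lipschitz_finRankLogTail hp hG hGp
    have hk := one_le_quasiConst p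
    have hk0 : 0 < quasiConst p := by linarith
    -- Division by the constant compensates the quasi-triangle inequality: two operators δ-close to
    -- G are only known to be `quasiConst p * δ`-close to each other.
    set δ := min η (min (1 / 8) (ε / (2 * C))) / quasiConst p with hδ
    have hm : 0 < min η (min (1 / 8) (ε / (2 * C))) := by positivity
    have hδ0 : 0 < δ := by positivity
    have hkδ : quasiConst p * δ = min η (min (1 / 8) (ε / (2 * C))) := by
      rw [hδ]; field_simp
    refine ⟨_, image_mem_map (inter_mem (eventually_schattenSum_le hp G hδ0)
      (eventually_finiteDimensional_finRankNhds hp G)), ?_⟩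
    rintro _ ⟨B, ⟨hB1, hB2⟩, rfl⟩ _ ⟨A, ⟨hA1, hA2⟩, rfl⟩
    have hA3 : schattenSum p (A - G) ≤ ENNReal.ofReal η ^ p := by
      refine hA1.trans (pow_le_pow_left' (ENNReal.ofReal_le_ofReal ?_) p)
      have : δ ≤ quasiConst p * δ := le_mul_of_one_le_left hδ0.le hk
      exact this.trans (hkδ.le.trans (min_le_left _ _))
    have hBA : schattenSum p (B - A) ≤ ENNReal.ofReal (quasiConst p * δ) ^ p := by
      refine schattenSum_sub_le_three hp hB1 (C := A) ?_ ?_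
      · rw [← schattenSum_neg, neg_sub]; exact hA1
      · rw [schattenSum_self_sub p hp]; exact bot_le
    have h8 : quasiConst p * δ ≤ 1 / 8 := hkδ.le.trans ((min_le_right _ _).trans (min_le_left _ _))
    refine (hlip A B hA2 hB2 hA3 _ (by positivity) (by linarith) hBA).trans_lt ?_
    have h9 : quasiConst p * δ ≤ ε / (2 * C) :=
      hkδ.le.trans ((min_le_right _ _).trans (min_le_right _ _))
    refine (mul_le_mul_of_nonneg_left h9 hC.le).trans_lt ?_
    have : C * (ε / (2 * C)) = ε / 2 := by field_simp
    linarith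
  obtain ⟨c, hc⟩ := CompleteSpace.complete hc
  exact tendsto_nhds_limUnder ⟨c, hc⟩

theorem pure_le_finRankNhds {p : ℕ} (hp : 1 ≤ p) {F : K →L[ℂ] K}
    (hF : FiniteDimensional ℂ (LinearMap.range (F : K →ₗ[ℂ] K))) : pure F ≤ finRankNhds p F := by
  have : Tendsto id (pure F) (finRankNhds p F) := by
    rw [tendsto_finRankNhds_iff hp]
    refine ⟨?_, by simpa using hF⟩
    rw [tendsto_pure_left]
    intro s hs
    simpa only [id, schattenSum_self_sub p hp] using mem_of_mem_nhds hs
  exact this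

theorem logTailExt_eq_of_finiteRank {p : ℕ} (hp : 1 ≤ p) {F : K →L[ℂ] K} (hF4 : ‖F‖ < 1 / 4)
    (hF : FiniteDimensional ℂ (LinearMap.range (F : K →ₗ[ℂ] K))) :
    logTailExt p F = finRankLogTail p F := by
  have h := (tendsto_finRankLogTail hp hF4 (schattenSum_lt_top_of_finiteRank hp hF)).mono_left
    (pure_le_finRankNhds hp hF)
  exact tendsto_nhds_unique h (tendsto_pure_nhds _ _)

/-- The Lipschitz bound for finite rank operators passes to the limit over pairs of approximants of
B and A. -/
theorem exists_lipschitz_logTailExt {p : ℕ} (hp : 1 ≤ p) {G : K →L[ℂ] K} (hG : ‖G‖ < 1 / 4)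
    (hGp : schattenSum p G < ∞) :
    ∃ C η : ℝ, 0 < C ∧ 0 < η ∧ ‖G‖ + η < 1 / 4 ∧ ∀ A B : K →L[ℂ] K,
      schattenSum p (A - G) ≤ ENNReal.ofReal η ^ p →
      schattenSum p (B - G) ≤ ENNReal.ofReal η ^ p →
      ∀ δ, 0 < δ → δ ≤ η → schattenSum p (B - A) ≤ ENNReal.ofReal δ ^ p →
      dist (logTailExt p B) (logTailExt p A) ≤ C * δ := by
  obtain ⟨C, η, hC, hη, hη4, hGη, hlip⟩ := exists_lipschitz_finRankLogTail hp hG hGp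
  have hk := one_le_quasiConst p
  have hk0 : 0 < quasiConst p := by linarith
  set κ := quasiConst p
  -- With this smaller radius the approximants of A stay within η/2 of G, and the distance κδ
  -- between approximants of B and A is at most η/2.
  refine ⟨C * κ, η / (2 * κ), by positivity, by positivity, ?_, ?_⟩
  · have : η / (2 * κ) < η := by
      rw [div_lt_iff₀ (by positivity)]; nlinarith
    linarith
  intro A B hA hB δ hδ hδη hBA
  have hηκ : η / (2 * κ) < η := by
    rw [div_lt_iff₀ (by positivity)]; nlinarith
  have hκδ : κ * δ ≤ η / 2 := by
    have : κ * δ ≤ κ * (η / (2 * κ)) := mul_le_mul_of_nonneg_left hδη hk0.le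
    have h2 : κ * (η / (2 * κ)) = η / 2 := by field_simp
    linarith
  have hfin : ∀ X : K →L[ℂ] K, schattenSum p (X - G) ≤ ENNReal.ofReal (η / (2 * κ)) ^ p →
      ‖X‖ < 1 / 4 ∧ schattenSum p X < ∞ := by
    intro X hX
    constructor
    · have h1 := norm_le_of_schattenSum_le hp (by positivity) hX
      have h2 := norm_add_le (X - G) G
      rw [sub_add_cancel] at h2
      linarith
    · have h1 : schattenSum p (X - G + G) < ∞ := schattenSum_add_lt_top
        (hX.trans_lt (ENNReal.pow_lt_top ENNReal.ofReal_lt_top)) hGp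
      rwa [sub_add_cancel] at h1
  have hA' := hfin A hA
  have hB' := hfin B hB
  have tA := tendsto_finRankLogTail hp hA'.1 hA'.2
  have tB := tendsto_finRankLogTail hp hB'.1 hB'.2
  have := finRankNhds_neBot hp hA'.2
  have := finRankNhds_neBot hp hB'.2
  have tAB : Tendsto (fun x : (K →L[ℂ] K) × (K →L[ℂ] K) =>
      dist (finRankLogTail p x.1) (finRankLogTail p x.2))
      (finRankNhds p B ×ˢ finRankNhds p A) (𝓝 (dist (logTailExt p B) (logTailExt p A))) :=
    (tB.comp tendsto_fst).dist (tA.comp tendsto_snd)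
  refine le_of_tendsto tAB ?_
  filter_upwards [((eventually_schattenSum_le hp B hδ).and
    (eventually_finiteDimensional_finRankNhds hp B)).prod_mk
    ((eventually_schattenSum_le hp A hδ).and (eventually_finiteDimensional_finRankNhds hp A))]
    with x hx
  obtain ⟨⟨h1, h2⟩, h3, h4⟩ := hx
  rw [mul_assoc]
  refine hlip x.2 x.1 h4 h2 ?_ _ (by positivity) (by linarith) ?_
  · have : schattenSum p (x.2 - G) ≤ ENNReal.ofReal (κ * (η / (2 * κ))) ^ p := by
      refine schattenSum_sub_le_three hp (h3.trans ?_) hA ?_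
      · exact pow_le_pow_left' (ENNReal.ofReal_le_ofReal hδη) p
      · rw [schattenSum_self_sub p hp]; exact bot_le
    refine this.trans (pow_le_pow_left' (ENNReal.ofReal_le_ofReal ?_) p)
    have h2 : κ * (η / (2 * κ)) = η / 2 := by field_simp
    linarith
  · refine schattenSum_sub_le_three hp h1 hBA ?_
    rw [← schattenSum_neg, neg_sub]; exact h3

end LogTailExtension

/-! ### Differentiability of the extended exponent -/

section LogTailAnalytic

variable {K : Type*} [NormedAddCommGroup K] [InnerProductSpace ℂ K]

theorem schattenSum_smul_le_pow {p : ℕ} {X : K →L[ℂ] K} {d : ℝ}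
    (hX : schattenSum p X ≤ ENNReal.ofReal d ^ p) (t : ℂ) :
    schattenSum p (t • X) ≤ ENNReal.ofReal (‖t‖ * d) ^ p := by
  refine (schattenSum_smul_le p t X).trans ((mul_le_mul_right hX _).trans ?_)
  rw [← mul_pow, ← ofReal_norm, ← ENNReal.ofReal_mul (norm_nonneg _)]

theorem exists_schattenSum_le_pow {p : ℕ} (hp : 1 ≤ p) {X : K →L[ℂ] K} (hX : schattenSum p X < ∞) :
    ∃ d : ℝ, 1 ≤ d ∧ schattenSum p X ≤ ENNReal.ofReal d ^ p := by
  refine ⟨max 1 (schattenSum p X).toReal, le_max_left _ _, ?_⟩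
  calc schattenSum p X = ENNReal.ofReal (schattenSum p X).toReal := (ENNReal.ofReal_toReal hX.ne).symm
    _ ≤ ENNReal.ofReal (max 1 (schattenSum p X).toReal) := ENNReal.ofReal_le_ofReal (le_max_right _ _)
    _ ≤ _ := le_self_pow₀ (ENNReal.one_le_ofReal.2 (le_max_left _ _)) (by omega)

theorem schattenSum_le_pow_mono {p : ℕ} {X : K →L[ℂ] K} {d e : ℝ} (h : d ≤ e)
    (hX : schattenSum p X ≤ ENNReal.ofReal d ^ p) : schattenSum p X ≤ ENNReal.ofReal e ^ p :=
  hX.trans (pow_le_pow_left' (ENNReal.ofReal_le_ofReal h) p)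

/-- Approximate both G and D by finite rank operators. Along the approximating lines the function is
holomorphic, being computed on a fixed finite-dimensional space, and the Lipschitz bound makes the
convergence uniform on a disc. -/
theorem differentiableAt_logTailExt_line {p : ℕ} (hp : 1 ≤ p) {G D : K →L[ℂ] K} (hG : ‖G‖ < 1 / 4)
    (hGp : schattenSum p G < ∞) (hDp : schattenSum p D < ∞) :
    DifferentiableAt ℂ (fun t : ℂ => logTailExt p (G + t • D)) 0 := by
  obtain ⟨C, η, hC, hη, hGη, hlip⟩ := exists_lipschitz_logTailExt hp hG hGp
  have hk := one_le_quasiConst p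
  set κ := quasiConst p
  have hk0 : 0 < κ := by linarith
  obtain ⟨d, hd1, hd⟩ := exists_schattenSum_le_pow hp hDp
  -- On this disc t D has size at most η/κ; and |t| ≤ 1, so an approximation of D is at least as
  -- good an approximation of t D.
  set ρ := min 1 (η / (κ * d)) with hρ
  have hρ0 : 0 < ρ := by positivity
  have hηκ : η / κ ≤ η := div_le_self hη.le hk
  have hκη : κ * (η / κ) = η := by field_simp
  have htD : ∀ t ∈ Metric.ball (0 : ℂ) ρ, schattenSum p (t • D) ≤ ENNReal.ofReal (η / κ) ^ p := by
    intro t ht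
    refine schattenSum_le_pow_mono ?_ (schattenSum_smul_le_pow hd t)
    have h1 : ‖t‖ ≤ η / (κ * d) := by
      have := (mem_ball_zero_iff.1 ht).le
      exact this.trans (min_le_right _ _)
    refine (mul_le_mul_of_nonneg_right h1 (by linarith)).trans (le_of_eq ?_)
    field_simp
  have ht1 : ∀ t ∈ Metric.ball (0 : ℂ) ρ, ‖t‖ ≤ 1 := fun t ht =>
    (mem_ball_zero_iff.1 ht).le.trans (min_le_left _ _)
  set φ := finRankNhds p G ×ˢ finRankNhds p D
  have := finRankNhds_neBot hp hGp
  have := finRankNhds_neBot hp hDp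
  have hclose : ∀ δ, 0 < δ → ∀ᶠ x in φ, schattenSum p (x.1 - G) ≤ ENNReal.ofReal δ ^ p ∧
      ∀ t ∈ Metric.ball (0 : ℂ) ρ, schattenSum p (t • (x.2 - D)) ≤ ENNReal.ofReal δ ^ p := by
    intro δ hδ
    filter_upwards [(eventually_schattenSum_le hp G hδ).prod_mk
      (eventually_schattenSum_le hp D hδ)] with x hx
    refine ⟨hx.1, fun t ht => schattenSum_le_pow_mono ?_ (schattenSum_smul_le_pow hx.2 t)⟩
    exact mul_le_of_le_one_left hδ.le (ht1 t ht)
  have hB : ∀ x : (K →L[ℂ] K) × (K →L[ℂ] K), schattenSum p (x.1 - G) ≤ ENNReal.ofReal (η / κ) ^ p →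
      (∀ t ∈ Metric.ball (0 : ℂ) ρ, schattenSum p (t • (x.2 - D)) ≤ ENNReal.ofReal (η / κ) ^ p) →
      ∀ t ∈ Metric.ball (0 : ℂ) ρ,
        schattenSum p (x.1 + t • x.2 - G) ≤ ENNReal.ofReal η ^ p := by
    intro x h1 h2 t ht
    rw [← hκη]
    refine schattenSum_sub_le_three hp (B := G + t • x.2) (C := G + t • D) ?_ ?_ ?_
    · convert! h1 using 2; abel
    · convert! h2 t ht using 2; rw [smul_sub]; abel
    · convert! htD t ht using 2; abel
  have hunif : TendstoUniformlyOn (fun (x : (K →L[ℂ] K) × (K →L[ℂ] K)) (t : ℂ) =>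
      logTailExt p (x.1 + t • x.2)) (fun t => logTailExt p (G + t • D)) φ
      (Metric.ball (0 : ℂ) ρ) := by
    rw [Metric.tendstoUniformlyOn_iff]
    intro ε hε
    set δ := min (η / κ) (ε / (2 * C * κ)) with hδ
    have hδ0 : 0 < δ := by positivity
    filter_upwards [hclose δ hδ0] with x hx t ht
    have hx1 := schattenSum_le_pow_mono (min_le_left _ _) hx.1
    have hx2 := fun t ht => schattenSum_le_pow_mono (min_le_left _ _) (hx.2 t ht)
    have hBt := hB x hx1 hx2 t ht
    have hAt : schattenSum p (G + t • D - G) ≤ ENNReal.ofReal η ^ p := by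
      rw [add_sub_cancel_left]
      exact schattenSum_le_pow_mono hηκ (htD t ht)
    have hBA : schattenSum p (x.1 + t • x.2 - (G + t • D)) ≤ ENNReal.ofReal (κ * δ) ^ p := by
      refine schattenSum_sub_le_three hp (B := G + t • x.2) (C := G + t • D) ?_ ?_ ?_
      · convert! hx.1 using 2; abel
      · convert! hx.2 t ht using 2; rw [smul_sub]; abel
      · rw [schattenSum_self_sub p hp]; exact bot_le
    have hκδ : κ * δ ≤ η := by
      rw [← hκη]; exact mul_le_mul_of_nonneg_left (min_le_left _ _) hk0.le
    rw [dist_comm]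
    refine (hlip _ _ hAt hBt _ (by positivity) hκδ hBA).trans_lt ?_
    have : κ * δ ≤ κ * (ε / (2 * C * κ)) := mul_le_mul_of_nonneg_left (min_le_right _ _) hk0.le
    have h2 : C * (κ * (ε / (2 * C * κ))) = ε / 2 := by field_simp
    have h3 := mul_le_mul_of_nonneg_left this hC.le
    linarith
  have hdiff : ∀ᶠ x in φ, DifferentiableOn ℂ (fun t : ℂ => logTailExt p (x.1 + t • x.2))
      (Metric.ball (0 : ℂ) ρ) := by
    filter_upwards [hclose (η / κ) (by positivity),
      (eventually_finiteDimensional_finRankNhds hp G).prod_mk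
      (eventually_finiteDimensional_finRankNhds hp D)] with x hx hfin
    obtain ⟨h1, h2⟩ := hfin
    set V := LinearMap.range (x.1 : K →ₗ[ℂ] K) ⊔ LinearMap.range (x.2 : K →ₗ[ℂ] K)
    have hnorm : ∀ t ∈ Metric.ball (0 : ℂ) ρ, ‖x.1 + t • x.2‖ < 1 / 4 := by
      intro t ht
      have h3 := norm_le_of_schattenSum_le hp hη.le (hB x hx.1 hx.2 t ht)
      have h4 := norm_add_le (x.1 + t • x.2 - G) G
      rw [sub_add_cancel] at h4
      linarith
    have hcmp : ∀ t : ℂ, cmp V (x.1 + t • x.2) = cmp V x.1 + t • cmp V x.2 := by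
      intro t; ext; simp [cmp]
    have hl := differentiableOn_logTail_line hp (cmp V x.1) (cmp V x.2) Metric.isOpen_ball
      (U := Metric.ball (0 : ℂ) ρ) (r := 1 / 4) (by norm_num) (by norm_num) (fun t ht => by
        rw [← hcmp]; exact (norm_cmp_le V _).trans (hnorm t ht).le)
    refine hl.congr fun t ht => ?_
    rw [logTailExt_eq_of_finiteRank hp (hnorm t ht)
      (finiteDimensional_range_add h1 (finiteDimensional_range_smul t h2)), ← hcmp]
    refine finRankLogTail_eq hp fun y => ?_
    exact V.add_mem (Submodule.mem_sup_left ⟨y, rfl⟩)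
      (V.smul_mem t (Submodule.mem_sup_right ⟨y, rfl⟩))
  exact (hunif.tendstoLocallyUniformlyOn.differentiableOn hdiff Metric.isOpen_ball).differentiableAt
    (Metric.ball_mem_nhds _ hρ0)

/-- Replacing the curve by its tangent line G(z) + (ζ - z) D changes the exponent by o(|ζ - z|), by
the Lipschitz bound. This reduces the chain rule to differentiability along a line and avoids a
Fréchet derivative on 𝓑_p. -/
theorem differentiableAt_logTailExt_comp {p : ℕ} (hp : 1 ≤ p) {G : ℂ → K →L[ℂ] K} {z : ℂ}
    {D : K →L[ℂ] K} (hG : ‖G z‖ < 1 / 4) (hGp : schattenSum p (G z) < ∞)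
    (hDp : schattenSum p D < ∞)
    (hD : Tendsto (fun ζ => schattenSum p ((ζ - z)⁻¹ • (G ζ - G z) - D)) (𝓝[≠] z) (𝓝 0)) :
    DifferentiableAt ℂ (fun ζ => logTailExt p (G ζ)) z := by
  obtain ⟨C, η, hC, hη, hGη, hlip⟩ := exists_lipschitz_logTailExt hp hG hGp
  have hk := one_le_quasiConst p
  set κ := quasiConst p
  have hk0 : 0 < κ := by linarith
  have hκη : κ * (η / κ) = η := by field_simp
  have hηκ : η / κ ≤ η := div_le_self hη.le hk
  obtain ⟨d, hd1, hd⟩ := exists_schattenSum_le_pow hp hDp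
  have hline : DifferentiableAt ℂ (fun ζ : ℂ => logTailExt p (G z + (ζ - z) • D)) z := by
    have h := differentiableAt_logTailExt_line hp hG hGp hDp
    have h2 : DifferentiableAt ℂ (fun ζ : ℂ => ζ - z) z := by fun_prop
    have h3 := DifferentiableAt.comp z (g := fun t : ℂ => logTailExt p (G z + t • D))
      (f := fun ζ : ℂ => ζ - z) (by simpa using h) h2
    exact h3
  have hrem : HasDerivAt (fun ζ : ℂ => logTailExt p (G ζ) - logTailExt p (G z + (ζ - z) • D)) 0
      z := by
    rw [hasDerivAt_iff_isLittleO, Asymptotics.isLittleO_iff]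
    intro c hc
    have hmain : ∀ᶠ ζ in 𝓝[≠] z,
        ‖logTailExt p (G ζ) - logTailExt p (G z + (ζ - z) • D)‖ ≤ c * ‖ζ - z‖ := by
      set ε := min (c / C) 1 with hε
      have hε0 : 0 < ε := by positivity
      have e1 : ∀ᶠ ζ in 𝓝[≠] z,
          schattenSum p ((ζ - z)⁻¹ • (G ζ - G z) - D) ≤ ENNReal.ofReal ε ^ p :=
        hD.eventually_le_const (ENNReal.pow_pos (ENNReal.ofReal_pos.2 hε0) p)
      have e2 : ∀ᶠ ζ in 𝓝[≠] z, ‖ζ - z‖ < η / (κ * d) := by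
        refine nhdsWithin_le_nhds ?_
        have := Metric.ball_mem_nhds z (ε := η / (κ * d)) (by positivity)
        filter_upwards [this] with ζ hζ
        rwa [Metric.mem_ball, dist_eq_norm] at hζ
      filter_upwards [e1, e2, self_mem_nhdsWithin] with ζ h1 h2 h3
      have hne : ζ - z ≠ 0 := sub_ne_zero.2 h3
      have hpos : 0 < ‖ζ - z‖ := norm_pos_iff.2 hne
      have hsmall : ‖ζ - z‖ * ε ≤ η / κ := by
        have h4 : ‖ζ - z‖ * ε ≤ ‖ζ - z‖ := mul_le_of_le_one_right hpos.le (min_le_right _ _)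
        have h5 : η / (κ * d) ≤ η / κ := by
          rw [div_le_div_iff_of_pos_left hη (by positivity) hk0]
          exact le_mul_of_one_le_right hk0.le hd1
        linarith
      have hX : schattenSum p (G ζ - (G z + (ζ - z) • D)) ≤ ENNReal.ofReal (‖ζ - z‖ * ε) ^ p := by
        convert! schattenSum_smul_le_pow h1 (ζ - z) using 2
        rw [smul_sub, smul_smul, mul_inv_cancel₀ hne, one_smul]
        abel
      have hA0 : schattenSum p (G z + (ζ - z) • D - G z) ≤ ENNReal.ofReal (η / κ) ^ p := by
        rw [add_sub_cancel_left]
        refine schattenSum_le_pow_mono ?_ (schattenSum_smul_le_pow hd (ζ - z))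
        refine (mul_le_mul_of_nonneg_right h2.le (by linarith)).trans (le_of_eq ?_)
        field_simp
      have hB : schattenSum p (G ζ - G z) ≤ ENNReal.ofReal η ^ p := by
        rw [← hκη]
        refine schattenSum_sub_le_three hp (schattenSum_le_pow_mono hsmall hX) hA0 ?_
        rw [schattenSum_self_sub p hp]; exact bot_le
      have := hlip _ _ (schattenSum_le_pow_mono hηκ hA0) hB _ (by positivity)
        (hsmall.trans hηκ) hX
      rw [← dist_eq_norm]
      refine this.trans ?_
      have h6 : C * ε ≤ c := by
        have : C * ε ≤ C * (c / C) := mul_le_mul_of_nonneg_left (min_le_left _ _) hC.le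
        have h7 : C * (c / C) = c := by field_simp
        linarith
      calc C * (‖ζ - z‖ * ε) = (C * ε) * ‖ζ - z‖ := by ring
        _ ≤ c * ‖ζ - z‖ := mul_le_mul_of_nonneg_right h6 hpos.le
    rw [eventually_nhdsWithin_iff] at hmain
    filter_upwards [hmain] with ζ hζ
    by_cases h : ζ = z
    · subst h; simp
    · simpa using hζ h
  have := hrem.differentiableAt.add hline
  refine this.congr_of_eventuallyEq (Eventually.of_forall fun ζ => ?_)
  simp

end LogTailAnalytic

/-! ### Factoring out a finite rank part of the determinant -/

section DetFactorization

variable {K : Type*} [NormedAddCommGroup K] [InnerProductSpace ℂ K]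
variable {W : Type*} [NormedAddCommGroup W] [NormedSpace ℂ W] [FiniteDimensional ℂ W]

/-- The trace of `∑ ((G + Y S) ^ j - G ^ j) / j`, `1 ≤ j < p`, computed on `W`. -/
def traceCorrection (p : ℕ) (Y : W →L[ℂ] K) (S : K →L[ℂ] W) (G : K →L[ℂ] K) : ℂ :=
  ∑ j ∈ Finset.Ico 1 p, (j : ℂ)⁻¹ * ∑ i ∈ Finset.range j,
    trCLM W (S ∘L (G ^ (j - 1 - i) * (G + Y ∘L S) ^ i) ∘L Y)

/-- The determinant of `1 - S (1 - G)⁻¹ Y` on `W`. -/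
def schurDet (Y : W →L[ℂ] K) (S : K →L[ℂ] W) (G : K →L[ℂ] K) : ℂ :=
  LinearMap.det ((1 - S ∘L Ring.inverse (1 - G) ∘L Y : W →L[ℂ] W) : W →ₗ[ℂ] W)

theorem pow_sub_pow_eq_sum {R : Type*} [Ring R] (a b : R) (j : ℕ) :
    a ^ j - b ^ j = ∑ i ∈ Finset.range j, a ^ i * (a - b) * b ^ (j - 1 - i) := by
  induction j with
  | zero => simp
  | succ n ih =>
    rw [Finset.sum_range_succ]
    have h : ∀ i ∈ Finset.range n, a ^ i * (a - b) * b ^ (n + 1 - 1 - i) =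
        (a ^ i * (a - b) * b ^ (n - 1 - i)) * b := by
      intro i hi
      have := Finset.mem_range.1 hi
      have h1 : n + 1 - 1 - i = (n - 1 - i) + 1 := by omega
      rw [h1, pow_succ]; simp only [mul_assoc]
    rw [Finset.sum_congr rfl h, ← Finset.sum_mul, ← ih]
    simp only [Nat.add_sub_cancel, Nat.sub_self, pow_zero, mul_one, pow_succ]
    noncomm_ring

/-- On a space V containing the ranges of G and Y one has 1 - f = (1 - g)(1 - (1 - g)⁻¹ y s), and
Sylvester's identity moves the second determinant to W. In the resulting form V no longer appears
and each factor can be passed to the limit in G. -/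
theorem finRankDet_eq_schurDet [CompleteSpace K] {p : ℕ} (hp : 1 ≤ p) (Y : W →L[ℂ] K)
    (S : K →L[ℂ] W) {G : K →L[ℂ] K}
    (hGf : FiniteDimensional ℂ (LinearMap.range (G : K →ₗ[ℂ] K))) (hG : ‖G‖ < 1) :
    finRankDet p (G + Y ∘L S) = schurDet Y S G * Complex.exp (traceCorrection p Y S G) *
      Complex.exp (-finRankLogTail p G) := by
  set V := LinearMap.range (G : K →ₗ[ℂ] K) ⊔ LinearMap.range (Y : W →ₗ[ℂ] K)
  have hGV : ∀ x, G x ∈ V := fun x => Submodule.mem_sup_left ⟨x, rfl⟩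
  have hYV : ∀ w, Y w ∈ V := fun w => Submodule.mem_sup_right ⟨w, rfl⟩
  have hFV : ∀ x, (G + Y ∘L S) x ∈ V := fun x => V.add_mem (hGV x) (hYV _)
  set g := cmp V G with hg
  set f := cmp V (G + Y ∘L S) with hf
  set y : W →L[ℂ] V := Y.codRestrict V hYV with hy
  set s : V →L[ℂ] W := S ∘L V.subtypeL with hs
  have hgn : ‖g‖ < 1 := (norm_cmp_le V G).trans_lt hG
  have hfg : f = g + y ∘L s := by
    ext v
    rw [hf, coe_cmp_apply hFV]
    simp [hg, coe_cmp_apply hGV, hy, hs]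
  have : CompleteSpace V := FiniteDimensional.complete ℂ V
  have hug : IsUnit (1 - g) := isUnit_one_sub_of_norm_lt_one (R := V →L[ℂ] V) hgn
  have huG : IsUnit (1 - G) := isUnit_one_sub_of_norm_lt_one hG
  have hpow : ∀ (k : ℕ) (v : V), ((g ^ k) v : K) = (G ^ k) v := by
    intro k
    induction k with
    | zero => intro v; simp
    | succ k ih =>
      intro v
      rw [pow_succ, pow_succ, mul_apply_eq_comp, mul_apply_eq_comp, ih,
        hg, coe_cmp_apply hGV]
  have hpowf : ∀ (k : ℕ) (v : V), ((f ^ k) v : K) = ((G + Y ∘L S) ^ k) v := by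
    intro k
    induction k with
    | zero => intro v; simp
    | succ k ih =>
      intro v
      rw [pow_succ, pow_succ, mul_apply_eq_comp, mul_apply_eq_comp, ih,
        hf, coe_cmp_apply hFV]
  -- Since G maps into V, the inverse computed in V is the restriction of the inverse on K.
  have hinv : ∀ v : V, (Ring.inverse (1 - g) v : K) = Ring.inverse (1 - G) (v : K) := by
    intro v
    have h1 : (1 - G) ((Ring.inverse (1 - g) v : V) : K) = v := by
      have h2 : ((1 - g) * Ring.inverse (1 - g)) v = v := by
        rw [Ring.mul_inverse_cancel _ hug]; rfl
      have h3 := congrArg (fun u : V => (u : K)) h2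
      simp only [mul_apply_eq_comp, sub_apply,
        one_apply_eq_self, Submodule.coe_sub] at h3 ⊢
      rw [hg, coe_cmp_apply hGV] at h3
      exact h3
    have h4 : (Ring.inverse (1 - G) * (1 - G)) ((Ring.inverse (1 - g) v : V) : K) =
        ((Ring.inverse (1 - g) v : V) : K) := by
      rw [Ring.inverse_mul_cancel _ huG]; rfl
    rw [mul_apply_eq_comp, h1] at h4
    exact h4.symm
  have hdet : LinearMap.det ((1 - f : V →L[ℂ] V) : V →ₗ[ℂ] V) =
      LinearMap.det ((1 - g : V →L[ℂ] V) : V →ₗ[ℂ] V) * schurDet Y S G := by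
    have h1 : (1 - f : V →L[ℂ] V) = (1 - g) * (1 - (Ring.inverse (1 - g) ∘L y) ∘L s) := by
      have h2 : (1 - g) * ((Ring.inverse (1 - g) ∘L y) ∘L s) = y ∘L s := by
        have := Ring.mul_inverse_cancel _ hug
        ext w
        have h3 := congrArg (fun T : V →L[ℂ] V => T (y (s w))) this
        exact congrArg (fun u : V => (u : K)) h3
      rw [mul_sub, h2, mul_one, hfg]
      abel
    have h2 : ((1 - f : V →L[ℂ] V) : V →ₗ[ℂ] V) = ((1 - g : V →L[ℂ] V) : V →ₗ[ℂ] V) ∘ₗ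
        (1 - ((Ring.inverse (1 - g) ∘L y : W →L[ℂ] V) : W →ₗ[ℂ] V) ∘ₗ (s : V →ₗ[ℂ] W)) := by
      rw [h1]; rfl
    rw [h2, LinearMap.det_comp, det_one_sub_comp_comm, schurDet]
    congr 2
    ext w
    simp [hs, hinv, hy]
  have htr : ∀ j ∈ Finset.Ico 1 p, (j : ℂ)⁻¹ * trCLM V (f ^ j) = (j : ℂ)⁻¹ * trCLM V (g ^ j) +
      (j : ℂ)⁻¹ * ∑ i ∈ Finset.range j,
        trCLM W (S ∘L (G ^ (j - 1 - i) * (G + Y ∘L S) ^ i) ∘L Y) := by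
    intro j _
    rw [← mul_add]
    congr 1
    -- Each summand of the telescoped f^j - g^j contains the factor y s, so cyclicity moves its
    -- trace from V to W.
    rw [← sub_eq_iff_eq_add', ← map_sub, pow_sub_pow_eq_sum, map_sum]
    refine Finset.sum_congr rfl fun i _ => ?_
    have h1 : f - g = y ∘L s := by rw [hfg]; abel
    rw [h1, trCLM_apply, trCLM_apply]
    have h2 : ((f ^ i * (y ∘L s) * g ^ (j - 1 - i) : V →L[ℂ] V) : V →ₗ[ℂ] V) =
        (((f ^ i) ∘L y : W →L[ℂ] V) : W →ₗ[ℂ] V) ∘ₗ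
          ((s ∘L (g ^ (j - 1 - i)) : V →L[ℂ] W) : V →ₗ[ℂ] W) := rfl
    rw [h2, LinearMap.trace_comp_comm']
    congr 1
    ext w
    change S (((g ^ (j - 1 - i)) ((f ^ i) (y w)) : V) : K) =
      S ((G ^ (j - 1 - i)) (((G + Y ∘L S) ^ i) (Y w)))
    rw [hpow, hpowf]
    rfl
  rw [finRankDet_eq p hFV, hdet, Finset.sum_congr rfl htr, Finset.sum_add_distrib, Complex.exp_add,
    finRankLogTail_eq hp hGV, ← det_mul_exp_eq_exp_logTail hp g hgn, traceCorrection]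
  ring

variable [CompleteSpace K]

theorem continuousAt_inverse_one_sub {G : K →L[ℂ] K} (hG : ‖G‖ < 1) :
    ContinuousAt (fun G : K →L[ℂ] K => Ring.inverse (1 - G)) G := by
  obtain ⟨u, hu⟩ := isUnit_one_sub_of_norm_lt_one hG
  have h := NormedRing.inverse_continuousAt u
  rw [hu] at h
  exact h.comp (f := fun G : K →L[ℂ] K => 1 - G) (by fun_prop)

theorem continuousAt_schurDet (Y : W →L[ℂ] K) (S : K →L[ℂ] W) {G : K →L[ℂ] K} (hG : ‖G‖ < 1) :
    ContinuousAt (schurDet Y S) G := by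
  have h1 := continuousAt_inverse_one_sub hG
  have h2 : ContinuousAt (fun G : K →L[ℂ] K => (1 - S ∘L Ring.inverse (1 - G) ∘L Y : W →L[ℂ] W)) G :=
    continuousAt_const.sub (continuousAt_const.clm_comp (h1.clm_comp continuousAt_const))
  exact ContinuousAt.comp (g := fun T : W →L[ℂ] W => LinearMap.det (T : W →ₗ[ℂ] W))
    differentiable_det.continuous.continuousAt h2

theorem continuous_traceCorrection (p : ℕ) (Y : W →L[ℂ] K) (S : K →L[ℂ] W) :
    Continuous (traceCorrection p Y S) := by
  unfold traceCorrection
  fun_prop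

/-- The finite rank part Y S is kept fixed: subtracting it carries finite rank approximants of G + Y
S to approximants of G, where the factorization is continuous. -/
theorem tendsto_finRankDet {p : ℕ} (hp : 1 ≤ p) (Y : W →L[ℂ] K) (S : K →L[ℂ] W) {G : K →L[ℂ] K}
    (hG : ‖G‖ < 1 / 4) (hGp : schattenSum p G < ∞) :
    Tendsto (finRankDet p) (finRankNhds p (G + Y ∘L S)) (𝓝 (schurDet Y S G *
      Complex.exp (traceCorrection p Y S G) * Complex.exp (-logTailExt p G))) := by
  have hYS : FiniteDimensional ℂ (LinearMap.range ((Y ∘L S : K →L[ℂ] K) : K →ₗ[ℂ] K)) :=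
    Submodule.finiteDimensional_of_le (S₂ := LinearMap.range (Y : W →ₗ[ℂ] K)) (by
      rintro _ ⟨x, rfl⟩; exact ⟨S x, rfl⟩)
  have hshift : Tendsto (fun F : K →L[ℂ] K => F - Y ∘L S) (finRankNhds p (G + Y ∘L S))
      (finRankNhds p G) := by
    rw [tendsto_finRankNhds_iff hp]
    constructor
    · refine (tendsto_schattenSum_finRankNhds hp (G + Y ∘L S)).congr fun F => ?_
      congr 1; abel
    · filter_upwards [eventually_finiteDimensional_finRankNhds hp (G + Y ∘L S)] with F hF
      rw [sub_eq_add_neg]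
      exact finiteDimensional_range_add hF (finiteDimensional_range_neg hYS)
  have hnhds : finRankNhds p G ≤ 𝓝 G := finRankNhds_le_nhds hp G
  have hG1 : ‖G‖ < 1 := by linarith
  have hlim : Tendsto (fun G : K →L[ℂ] K => schurDet Y S G *
      Complex.exp (traceCorrection p Y S G) * Complex.exp (-finRankLogTail p G))
      (finRankNhds p G) (𝓝 (schurDet Y S G *
      Complex.exp (traceCorrection p Y S G) * Complex.exp (-logTailExt p G))) := by
    refine Tendsto.mul (Tendsto.mul ((continuousAt_schurDet Y S hG1).tendsto.mono_left hnhds) ?_) ?_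
    · exact (Complex.continuous_exp.comp (continuous_traceCorrection p Y S)).continuousAt.tendsto.mono_left
        hnhds
    · exact (Complex.continuous_exp.tendsto _).comp (tendsto_finRankLogTail hp hG hGp).neg
  refine (hlim.comp hshift).congr' ?_
  have hev : ∀ᶠ F in finRankNhds p (G + Y ∘L S), ‖F - Y ∘L S‖ < 1 :=
    hshift.eventually
      ((continuous_norm.continuousAt.eventually (gt_mem_nhds hG1)).filter_mono hnhds)
  filter_upwards [hev, hshift.eventually (eventually_finiteDimensional_finRankNhds hp G)] with F h1 h2
  have := finRankDet_eq_schurDet hp Y S h2 h1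
  rw [sub_add_cancel] at this
  exact this.symm

theorem detP_eq {p : ℕ} (hp : 1 ≤ p) (Y : W →L[ℂ] K) (S : K →L[ℂ] W) {G : K →L[ℂ] K}
    (hG : ‖G‖ < 1 / 4) (hGp : schattenSum p G < ∞) :
    detP p (G + Y ∘L S) = schurDet Y S G *
      Complex.exp (traceCorrection p Y S G) * Complex.exp (-logTailExt p G) := by
  have hYS : FiniteDimensional ℂ (LinearMap.range ((Y ∘L S : K →L[ℂ] K) : K →ₗ[ℂ] K)) :=
    Submodule.finiteDimensional_of_le (S₂ := LinearMap.range (Y : W →ₗ[ℂ] K)) (by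
      rintro _ ⟨x, rfl⟩; exact ⟨S x, rfl⟩)
  have := finRankNhds_neBot hp
    (schattenSum_add_lt_top hGp (schattenSum_lt_top_of_finiteRank hp hYS))
  exact (tendsto_finRankDet hp Y S hG hGp).limUnder_eq

end DetFactorization

/-! ### Punctured neighbourhoods and small circles -/

section PuncturedNhds

theorem eventually_closedBall_of_punctured {z : ℂ} {P : ℂ → Prop} (h : ∀ᶠ ζ in 𝓝[≠] z, P ζ) :
    ∀ᶠ ε in 𝓝[>] (0 : ℝ), ∀ ζ ∈ Metric.closedBall z ε, ζ ≠ z → P ζ := by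
  rw [eventually_nhdsWithin_iff, Metric.eventually_nhds_iff_ball] at h
  obtain ⟨r, hr, hP⟩ := h
  filter_upwards [Ioo_mem_nhdsGT hr] with ε hε ζ hζ hne
  exact hP ζ (Metric.closedBall_subset_ball hε.2 hζ) hne

theorem eventually_sphere_of_punctured {z : ℂ} {P : ℂ → Prop} (h : ∀ᶠ ζ in 𝓝[≠] z, P ζ) :
    ∀ᶠ ε in 𝓝[>] (0 : ℝ), ∀ ζ ∈ Metric.sphere z ε, P ζ := by
  filter_upwards [eventually_closedBall_of_punctured h, self_mem_nhdsWithin] with ε hε hε0 ζ hζ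
  refine hε ζ (Metric.sphere_subset_closedBall hζ) ?_
  rintro rfl
  rw [Metric.mem_sphere, dist_self] at hζ
  exact (ne_of_lt hε0) hζ

theorem eventually_eventually_punctured {z : ℂ} {P : ℂ → Prop} (h : ∀ᶠ ζ in 𝓝[≠] z, P ζ) :
    ∀ᶠ ζ in 𝓝[≠] z, ∀ᶠ w in 𝓝 ζ, P w := by
  filter_upwards [eventually_eventually_nhdsWithin.2 h, self_mem_nhdsWithin] with ζ h1 h2
  rwa [IsOpen.nhdsWithin_eq isOpen_compl_singleton h2] at h1

theorem CircleIntegrable.of_continuousAt {E : Type*} [NormedAddCommGroup E] {f : ℂ → E} {z : ℂ}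
    {ε : ℝ} (hε : 0 ≤ ε) (h : ∀ ζ ∈ Metric.sphere z ε, ContinuousAt f ζ) :
    CircleIntegrable f z ε :=
  ContinuousOn.circleIntegrable hε fun ζ hζ => (h ζ hζ).continuousWithinAt

theorem map_circleIntegral {E F : Type*} [NormedAddCommGroup E] [NormedSpace ℂ E]
    [NormedAddCommGroup F] [NormedSpace ℂ F] [CompleteSpace E] [CompleteSpace F]
    (L : E →L[ℂ] F) {f : ℂ → E} {z : ℂ} {ε : ℝ} (hf : CircleIntegrable f z ε) :
    L (∮ ζ in C(z, ε), f ζ) = ∮ ζ in C(z, ε), L (f ζ) := by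
  rw [circleIntegral, circleIntegral, ← ContinuousLinearMap.intervalIntegral_comp_comm _ hf.out]
  simp

end PuncturedNhds

/-! ### Argument principle, with essential singularities in the exponential factor -/

section ArgumentPrinciple

theorem eventually_logIntegral_eq_of_order {f : ℂ → ℂ} {z : ℂ} {k : ℤ} (hf : MeromorphicAt f z)
    (hk : meromorphicOrderAt f z = k) : ∀ᶠ ε in 𝓝[>] (0 : ℝ), logIntegral f z ε = k := by
  obtain ⟨g, hg, hgz, hfg⟩ := (meromorphicOrderAt_eq_int_iff hf).1 hk
  have hg0 : ∀ᶠ ζ in 𝓝 z, g ζ ≠ 0 ∧ AnalyticAt ℂ g ζ :=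
    (hg.continuousAt.eventually_ne hgz).and hg.eventually_analyticAt
  obtain ⟨r, hr, hball⟩ := Metric.eventually_nhds_iff_ball.1 hg0
  have hder : ∀ᶠ ζ in 𝓝[≠] z, deriv f ζ / f ζ = k * (ζ - z)⁻¹ + deriv g ζ / g ζ := by
    filter_upwards [eventually_eventually_punctured hfg, hg0.filter_mono nhdsWithin_le_nhds,
      self_mem_nhdsWithin] with ζ h1 h2 h3
    have hne : ζ - z ≠ 0 := sub_ne_zero.2 h3
    have hd1 : HasDerivAt (fun w : ℂ => (w - z) ^ k) ((k : ℂ) * (ζ - z) ^ (k - 1)) ζ := by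
      exact ((hasDerivAt_zpow k (ζ - z) (Or.inl hne)).comp ζ
        ((hasDerivAt_id ζ).sub_const z)).congr_deriv (mul_one _)
    have hd := (hd1.mul h2.2.differentiableAt.hasDerivAt).congr_of_eventuallyEq
      (f₁ := f) (by filter_upwards [h1] with w hw; simpa using hw)
    rw [hd.deriv, h1.self_of_nhds, zpow_sub_one₀ hne, smul_eq_mul]
    have : (ζ - z) ^ k ≠ 0 := zpow_ne_zero _ hne
    have := h2.1
    field_simp
  filter_upwards [eventually_sphere_of_punctured hder, Ioo_mem_nhdsGT hr] with ε h1 hε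
  have hsub : Metric.closedBall z ε ⊆ Metric.ball z r := Metric.closedBall_subset_ball hε.2
  have hd : ∀ ζ ∈ Metric.ball z r, DifferentiableAt ℂ (fun ζ => deriv g ζ / g ζ) ζ := fun ζ hζ =>
    (hball ζ hζ).2.deriv.differentiableAt.div (hball ζ hζ).2.differentiableAt (hball ζ hζ).1
  have hne : ∀ ζ ∈ Metric.sphere z ε, ζ - z ≠ 0 := fun ζ hζ h => by
    rw [Metric.mem_sphere, dist_eq_norm, h, norm_zero] at hζ
    exact hε.1.ne hζ
  rw [logIntegral, circleIntegral.integral_congr hε.1.le (fun ζ hζ => h1 ζ hζ),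
    circleIntegral.integral_add, circleIntegral.integral_const_mul,
    circleIntegral.integral_sub_center_inv z hε.1.ne',
    Complex.circleIntegral_eq_zero_of_differentiable_on_off_countable hε.1.le Set.countable_empty
      (fun ζ hζ => (hd ζ (hsub hζ)).continuousAt.continuousWithinAt)
      (fun ζ hζ => hd ζ (hsub (Metric.ball_subset_closedBall hζ.1))), add_zero]
  · have := Complex.two_pi_I_ne_zero
    field_simp
  · refine CircleIntegrable.of_continuousAt hε.1.le fun ζ hζ => ?_
    exact continuousAt_const.mul ((continuousAt_id.sub continuousAt_const).inv₀ (hne ζ hζ))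
  · exact CircleIntegrable.of_continuousAt hε.1.le fun ζ hζ =>
      (hd ζ (hsub (Metric.sphere_subset_closedBall hζ))).continuousAt

/-- The logarithmic derivative of exp h is h', which has the primitive h on the circle and so
integrates to zero, whatever the singularity of h at z. -/
theorem eventually_logIntegral_mul_exp {f d h : ℂ → ℂ} {z : ℂ}
    (hf : ∀ᶠ ζ in 𝓝[≠] z, f ζ = d ζ * Complex.exp (h ζ)) (hd : MeromorphicAt d z)
    (hd0 : ∀ᶠ ζ in 𝓝[≠] z, d ζ ≠ 0) (hh : ∀ᶠ ζ in 𝓝[≠] z, DifferentiableAt ℂ h ζ) :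
    ∀ᶠ ε in 𝓝[>] (0 : ℝ), logIntegral f z ε = logIntegral d z ε := by
  have hder : ∀ᶠ ζ in 𝓝[≠] z, deriv f ζ / f ζ = deriv d ζ / d ζ + deriv h ζ := by
    filter_upwards [eventually_eventually_punctured hf, hd.eventually_analyticAt, hd0, hh]
      with ζ h1 h2 h3 h4
    have := (h2.differentiableAt.hasDerivAt.mul h4.hasDerivAt.cexp).congr_of_eventuallyEq
      (f₁ := f) h1
    rw [this.deriv, h1.self_of_nhds]
    have := Complex.exp_ne_zero (h ζ)
    field_simp
  have hhan : ∀ᶠ ζ in 𝓝[≠] z, AnalyticAt ℂ h ζ := by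
    filter_upwards [eventually_eventually_punctured hh] with ζ h1
    exact Complex.analyticAt_iff_eventually_differentiableAt.2 h1
  filter_upwards [eventually_sphere_of_punctured hder, eventually_sphere_of_punctured hhan,
    eventually_sphere_of_punctured hd.eventually_analyticAt,
    eventually_sphere_of_punctured hd0, self_mem_nhdsWithin] with ε h1 h2 h3 h4 hε
  have hε' : (0 : ℝ) ≤ ε := le_of_lt hε
  rw [logIntegral, logIntegral, circleIntegral.integral_congr hε' (fun ζ hζ => h1 ζ hζ),
    circleIntegral.integral_add,
    circleIntegral.integral_eq_zero_of_hasDerivWithinAt' (f := h) (f' := deriv h), add_zero]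
  · intro ζ hζ
    rw [abs_of_nonneg hε'] at hζ
    exact (h2 ζ hζ).differentiableAt.hasDerivAt.hasDerivWithinAt
  · exact CircleIntegrable.of_continuousAt hε' fun ζ hζ =>
      (h3 ζ hζ).deriv.continuousAt.div (h3 ζ hζ).continuousAt (h4 ζ hζ)
  · exact CircleIntegrable.of_continuousAt hε' fun ζ hζ => (h2 ζ hζ).deriv.continuousAt

/-- It is not decided whether f is meromorphic at z. If it is, its order is finite and the argument
principle identifies it with k; if not, k witnesses the second branch of `funMult`. The value of the
integral determines the integer in both cases. -/
theorem funMult_eq_of_eq_mul_exp {f d h : ℂ → ℂ} {z : ℂ}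
    (hf : ∀ᶠ ζ in 𝓝[≠] z, f ζ = d ζ * Complex.exp (h ζ)) (hd : MeromorphicAt d z)
    (hd0 : ∀ᶠ ζ in 𝓝[≠] z, d ζ ≠ 0) (hh : ∀ᶠ ζ in 𝓝[≠] z, DifferentiableAt ℂ h ζ) {k : ℤ}
    (hk : ∀ᶠ ε in 𝓝[>] (0 : ℝ), logIntegral d z ε = k) : funMult z f = k := by
  have hfk : ∀ᶠ ε in 𝓝[>] (0 : ℝ), logIntegral f z ε = k := by
    filter_upwards [eventually_logIntegral_mul_exp hf hd hd0 hh, hk] with ε h1 h2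
    rw [h1, h2]
  have huniq : ∀ m : ℤ, (∀ᶠ ε in 𝓝[>] (0 : ℝ), logIntegral f z ε = m) → m = k := by
    intro m hm
    obtain ⟨ε, h1, h2⟩ := (hm.and hfk).exists
    exact_mod_cast h1.symm.trans h2
  rw [funMult]
  split_ifs with h1 h2
  · have hne : meromorphicOrderAt f z ≠ ⊤ := by
      rw [Ne, meromorphicOrderAt_eq_top_iff]
      intro h0
      obtain ⟨ζ, h2, h3, h4⟩ := (h0.and (hf.and hd0)).exists
      rw [h2] at h3
      exact mul_ne_zero h4 (Complex.exp_ne_zero _) h3.symm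
    obtain ⟨m, hm⟩ := WithTop.ne_top_iff_exists.1 hne
    rw [← hm, huniq m (eventually_logIntegral_eq_of_order h1 hm.symm)]
  · rw [huniq _ h2.choose_spec]
  · exact absurd ⟨k, hfk⟩ h2

end ArgumentPrinciple

/-! ### Meromorphic operator functions -/

section MeromorphicOperators

variable {E F G : Type*} [NormedAddCommGroup E] [NormedSpace ℂ E] [NormedAddCommGroup F]
  [NormedSpace ℂ F] [NormedAddCommGroup G] [NormedSpace ℂ G]

theorem MeromorphicAt.clm_comp {f : ℂ → F →L[ℂ] G} {g : ℂ → E →L[ℂ] F} {z : ℂ}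
    (hf : MeromorphicAt f z) (hg : MeromorphicAt g z) :
    MeromorphicAt (fun ζ => f ζ ∘L g ζ) z := by
  obtain ⟨m, hm⟩ := hf
  obtain ⟨n, hn⟩ := hg
  refine ⟨m + n, ?_⟩
  have h := ((ContinuousLinearMap.compL ℂ E F G).analyticAt_bilinear
    (((z - z) ^ m • f z), ((z - z) ^ n • g z))).comp₂ hm hn
  refine h.congr (Eventually.of_forall fun ζ => ?_)
  ext x
  simp only [ContinuousLinearMap.compL_apply, ContinuousLinearMap.comp_smul,
    ContinuousLinearMap.smul_comp, smul_smul, pow_add]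
  rw [mul_comm]

theorem MeromorphicAt.clm_map {f : ℂ → E} {z : ℂ} (L : E →L[ℂ] F) (hf : MeromorphicAt f z) :
    MeromorphicAt (fun ζ => L (f ζ)) z := by
  obtain ⟨m, hm⟩ := hf
  refine ⟨m, ?_⟩
  refine ((L.analyticAt _).comp hm).congr (Eventually.of_forall fun ζ => ?_)
  simp

theorem MeromorphicAt.matrix_det {n : Type*} [Fintype n] [DecidableEq n] {A : ℂ → Matrix n n ℂ}
    {z : ℂ} (hA : ∀ i j, MeromorphicAt (fun ζ => A ζ i j) z) :
    MeromorphicAt (fun ζ => (A ζ).det) z := by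
  simp only [Matrix.det_apply']
  exact MeromorphicAt.fun_sum fun σ _ => (MeromorphicAt.const _ _).fun_mul
    (MeromorphicAt.fun_prod fun i _ => hA _ _)

variable {V : Type*} [NormedAddCommGroup V] [NormedSpace ℂ V] [FiniteDimensional ℂ V]

theorem MeromorphicAt.toMatrix_apply {ι : Type*} [Fintype ι] [DecidableEq ι]
    (b : Module.Basis ι ℂ V) {D : ℂ → V →L[ℂ] V} {z : ℂ}
    (hD : MeromorphicAt D z) (i j : ι) :
    MeromorphicAt (fun ζ => LinearMap.toMatrix b b (D ζ : V →ₗ[ℂ] V) i j) z := by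
  let φ : (V →L[ℂ] V) →ₗ[ℂ] ℂ := (Matrix.entryLinearMap ℂ ℂ i j) ∘ₗ
      (LinearMap.toMatrix b b).toLinearMap ∘ₗ
      (ContinuousLinearMap.coeLM ℂ : (V →L[ℂ] V) →ₗ[ℂ] (V →ₗ[ℂ] V))
  exact MeromorphicAt.clm_map (LinearMap.toContinuousLinearMap φ) hD

theorem MeromorphicAt.linearMap_det {D : ℂ → V →L[ℂ] V} {z : ℂ} (hD : MeromorphicAt D z) :
    MeromorphicAt (fun ζ => LinearMap.det (D ζ : V →ₗ[ℂ] V)) z := by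
  have h := MeromorphicAt.matrix_det fun i j => MeromorphicAt.toMatrix_apply (Module.finBasis ℂ V) hD i j
  simpa only [LinearMap.det_toMatrix] using h

theorem isUnit_iff_det_ne_zero (T : V →L[ℂ] V) :
    IsUnit T ↔ LinearMap.det (T : V →ₗ[ℂ] V) ≠ 0 := by
  rw [← isUnit_iff_ne_zero, ← LinearMap.isUnit_iff_isUnit_det]
  constructor
  · intro h
    obtain ⟨S, h1, h2⟩ := isUnit_iff_exists.1 h
    exact isUnit_iff_exists.2 ⟨(S : V →ₗ[ℂ] V), congrArg (fun T : V →L[ℂ] V => (T : V →ₗ[ℂ] V)) h1,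
      congrArg (fun T : V →L[ℂ] V => (T : V →ₗ[ℂ] V)) h2⟩
  · intro h
    obtain ⟨S, h1, h2⟩ := isUnit_iff_exists.1 h
    refine isUnit_iff_exists.2 ⟨LinearMap.toContinuousLinearMap S, ?_, ?_⟩
    · ext x; exact congrArg (fun T : V →ₗ[ℂ] V => T x) h1
    · ext x; exact congrArg (fun T : V →ₗ[ℂ] V => T x) h2

/-- The inverse of a meromorphic operator function on a finite-dimensional space is
meromorphic. -/
theorem MeromorphicAt.ringInverse {D : ℂ → V →L[ℂ] V} {z : ℂ} (hD : MeromorphicAt D z)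
    (hu : ∀ᶠ ζ in 𝓝[≠] z, IsUnit (D ζ)) : MeromorphicAt (fun ζ => Ring.inverse (D ζ)) z := by
  set b := Module.finBasis ℂ V
  set A : ℂ → Matrix _ _ ℂ := fun ζ => LinearMap.toMatrix b b (D ζ : V →ₗ[ℂ] V) with hA
  have hAm : ∀ i j, MeromorphicAt (fun ζ => A ζ i j) z := fun i j => MeromorphicAt.toMatrix_apply b hD i j
  have hadj : ∀ i j, MeromorphicAt (fun ζ => (A ζ).adjugate i j) z := by
    intro i j
    simp only [Matrix.adjugate_apply]
    refine MeromorphicAt.matrix_det fun k l => ?_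
    simp only [Matrix.updateRow_apply]
    split_ifs
    · exact MeromorphicAt.const _ _
    · exact hAm _ _
  -- Cramer's rule expanded in matrix units: meromorphy of the operator function is thereby reduced
  -- to that of the scalar entries of the adjugate and of det⁻¹.
  let e : Fin (Module.finrank ℂ V) → Fin (Module.finrank ℂ V) → V →L[ℂ] V := fun i j =>
    LinearMap.toContinuousLinearMap (Matrix.toLin b b (Matrix.single i j 1))
  have hmer : MeromorphicAt (fun ζ => ∑ i, ∑ j, ((A ζ).det⁻¹ * (A ζ).adjugate i j) • e i j) z := by
    refine MeromorphicAt.fun_sum fun i _ => MeromorphicAt.fun_sum fun j _ => ?_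
    exact (((MeromorphicAt.matrix_det hAm).fun_inv.fun_mul (hadj i j))).fun_smul (MeromorphicAt.const _ _)
  refine hmer.congr ?_
  filter_upwards [hu] with ζ hζ
  have hdet : (A ζ).det ≠ 0 := by
    rw [hA]; simp only [LinearMap.det_toMatrix]
    exact (isUnit_iff_det_ne_zero _).1 hζ
  have h1 : ∑ i, ∑ j, ((A ζ).det⁻¹ * (A ζ).adjugate i j) • e i j =
      LinearMap.toContinuousLinearMap (Matrix.toLin b b ((A ζ).det⁻¹ • (A ζ).adjugate)) := by
    conv_rhs => rw [Matrix.matrix_eq_sum_single ((A ζ).det⁻¹ • (A ζ).adjugate)]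
    simp only [map_sum, e]
    refine Finset.sum_congr rfl fun i _ => Finset.sum_congr rfl fun j _ => ?_
    rw [← map_smul, ← map_smul, Matrix.smul_single]
    simp
  have h2 : D ζ * LinearMap.toContinuousLinearMap
      (Matrix.toLin b b ((A ζ).det⁻¹ • (A ζ).adjugate)) = 1 := by
    have h3 : (D ζ : V →ₗ[ℂ] V) ∘ₗ Matrix.toLin b b ((A ζ).det⁻¹ • (A ζ).adjugate) =
        LinearMap.id := by
      have h4 : (D ζ : V →ₗ[ℂ] V) = Matrix.toLin b b (A ζ) := by rw [hA, Matrix.toLin_toMatrix]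
      rw [h4, ← Matrix.toLin_mul, Matrix.mul_smul, Matrix.mul_adjugate, smul_smul,
        inv_mul_cancel₀ hdet, one_smul, Matrix.toLin_one]
    ext x
    exact congrArg (fun T : V →ₗ[ℂ] V => T x) h3
  rw [h1]
  have h5 := congrArg (fun T => Ring.inverse (D ζ) * T) h2
  simp only [← mul_assoc, Ring.inverse_mul_cancel _ hζ, one_mul, mul_one] at h5
  exact h5

end MeromorphicOperators

/-! ### Traces of finite rank operators and of contour integrals -/

section FiniteRankTrace

variable {H : Type*} [NormedAddCommGroup H] [InnerProductSpace ℂ H]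

/-- `T` has finite rank and trace `c`. -/
def HasTrace (T : H →L[ℂ] H) (c : ℂ) : Prop :=
  ∃ V : Submodule ℂ H, ∃ _ : FiniteDimensional ℂ V, (∀ x, T x ∈ V) ∧ trCLM V (cmp V T) = c

theorem trCLM_cmp_eq_of_hasTrace {T : H →L[ℂ] H} {c : ℂ} (h : HasTrace T c) (V : Submodule ℂ H)
    [FiniteDimensional ℂ V] (hV : ∀ x, T x ∈ V) : trCLM V (cmp V T) = c := by
  obtain ⟨V', _, hV', rfl⟩ := h
  have h1 := trCLM_cmp_pow hV (j := 1) le_rfl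
  have h2 := trCLM_cmp_pow hV' (j := 1) le_rfl
  rw [pow_one] at h1 h2
  rw [h1, h2]

theorem HasTrace.finiteDimensional {T : H →L[ℂ] H} {c : ℂ} (h : HasTrace T c) :
    FiniteDimensional ℂ (LinearMap.range (T : H →ₗ[ℂ] H)) := by
  obtain ⟨V, _, hV, -⟩ := h
  refine Submodule.finiteDimensional_of_le (S₂ := V) ?_
  rintro _ ⟨x, rfl⟩
  exact hV x

theorem HasTrace.unique {T : H →L[ℂ] H} {c c' : ℂ} (h : HasTrace T c) (h' : HasTrace T c') :
    c = c' := by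
  obtain ⟨V, _, hV, rfl⟩ := h
  exact trCLM_cmp_eq_of_hasTrace h' V hV

theorem HasTrace.add {S T : H →L[ℂ] H} {c d : ℂ} (hS : HasTrace S c) (hT : HasTrace T d) :
    HasTrace (S + T) (c + d) := by
  obtain ⟨V, _, hV, -⟩ := id hS
  obtain ⟨V', _, hV', -⟩ := id hT
  refine ⟨V ⊔ V', inferInstance, fun x => (V ⊔ V').add_mem (Submodule.mem_sup_left (hV x))
    (Submodule.mem_sup_right (hV' x)), ?_⟩
  have h : cmp (V ⊔ V') (S + T) = cmp (V ⊔ V') S + cmp (V ⊔ V') T := by ext; simp [cmp]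
  rw [h, map_add, trCLM_cmp_eq_of_hasTrace hS _ fun x => Submodule.mem_sup_left (hV x),
    trCLM_cmp_eq_of_hasTrace hT _ fun x => Submodule.mem_sup_right (hV' x)]

theorem HasTrace.smul {T : H →L[ℂ] H} {c : ℂ} (hT : HasTrace T c) (a : ℂ) :
    HasTrace (a • T) (a * c) := by
  obtain ⟨V, _, hV, rfl⟩ := hT
  refine ⟨V, inferInstance, fun x => V.smul_mem a (hV x), ?_⟩
  have h : cmp V (a • T) = a • cmp V T := by ext; simp [cmp]
  rw [h, map_smul, smul_eq_mul]

theorem hasTrace_zero : HasTrace (0 : H →L[ℂ] H) 0 := by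
  refine ⟨⊥, inferInstance, fun x => by simp, ?_⟩
  have h : cmp (⊥ : Submodule ℂ H) (0 : H →L[ℂ] H) = 0 := Subsingleton.elim _ _
  rw [h, map_zero]

theorem hasTrace_comp {W : Type*} [NormedAddCommGroup W] [NormedSpace ℂ W] [FiniteDimensional ℂ W]
    (Y : W →L[ℂ] H) (Z : H →L[ℂ] W) : HasTrace (Y ∘L Z) (trCLM W (Z ∘L Y)) := by
  set V := LinearMap.range (Y : W →ₗ[ℂ] H)
  have hV : ∀ w, Y w ∈ V := fun w => ⟨w, rfl⟩
  have hYZ : ∀ x, (Y ∘L Z) x ∈ V := fun x => hV _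
  refine ⟨V, inferInstance, hYZ, ?_⟩
  have h : ((cmp V (Y ∘L Z) : V →L[ℂ] V) : V →ₗ[ℂ] V) =
      (Y : W →ₗ[ℂ] H).rangeRestrict ∘ₗ ((Z : H →ₗ[ℂ] W) ∘ₗ V.subtype) := by
    ext v
    exact coe_cmp_apply hYZ v
  rw [trCLM_apply, h, LinearMap.trace_comp_comm', trCLM_apply]
  congr 1

theorem hasTrace_of_idempotent {P : H →L[ℂ] H} (hP : P * P = P)
    (hf : FiniteDimensional ℂ (LinearMap.range (P : H →ₗ[ℂ] H))) :
    HasTrace P (Module.finrank ℂ (LinearMap.range (P : H →ₗ[ℂ] H)) : ℂ) := by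
  have hV : ∀ x, P x ∈ LinearMap.range (P : H →ₗ[ℂ] H) := fun x => ⟨x, rfl⟩
  refine ⟨_, hf, hV, ?_⟩
  have h : cmp (LinearMap.range (P : H →ₗ[ℂ] H)) P = 1 := by
    ext v
    rw [coe_cmp_apply hV]
    obtain ⟨_, x, rfl⟩ := v
    exact congrArg (fun T : H →L[ℂ] H => T x) hP
  rw [h, trCLM_apply]
  exact LinearMap.trace_one ℂ _

variable [CompleteSpace H]
variable {W : Type*} [NormedAddCommGroup W] [NormedSpace ℂ W] [FiniteDimensional ℂ W]

/-- The ranges of y ζ vary, so finite rank of the integral is itself a claim. Induction on the pole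
order: with y = y(z) + (ζ - z) `dslope y z`, the constant y(z) comes out of the integral and gives a
finite rank term, while the remainder has a lower pole order. At order 0 Cauchy's theorem gives
zero. The induction changes y, hence its position after the colon. -/
theorem hasTrace_circleIntegral_of_differentiableOn {z : ℂ} {r ε : ℝ} (hε : 0 < ε) (hr : ε < r)
    (N : ℕ) {w : ℂ → H →L[ℂ] W} (hw : DifferentiableOn ℂ w (Metric.ball z r)) :
    ∀ {y : ℂ → W →L[ℂ] H}, DifferentiableOn ℂ y (Metric.ball z r) →
      HasTrace (∮ ζ in C(z, ε), ((ζ - z) ^ N)⁻¹ • (y ζ ∘L w ζ))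
        (∮ ζ in C(z, ε), ((ζ - z) ^ N)⁻¹ • trCLM W (w ζ ∘L y ζ)) := by
  have : CompleteSpace W := FiniteDimensional.complete ℂ W
  have hsub : Metric.closedBall z ε ⊆ Metric.ball z r := Metric.closedBall_subset_ball hr
  have hnhds : ∀ ζ ∈ Metric.ball z r, Metric.ball z r ∈ 𝓝 ζ := fun ζ hζ =>
    Metric.isOpen_ball.mem_nhds hζ
  have hwd : ∀ ζ ∈ Metric.ball z r, DifferentiableAt ℂ w ζ := fun ζ hζ =>
    hw.differentiableAt (hnhds ζ hζ)
  have hne : ∀ ζ ∈ Metric.sphere z ε, ζ - z ≠ 0 := fun ζ hζ h => by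
    rw [Metric.mem_sphere, dist_eq_norm, h, norm_zero] at hζ
    exact hε.ne hζ
  have hinv : ∀ n : ℕ, ∀ ζ ∈ Metric.sphere z ε, ContinuousAt (fun ζ : ℂ => ((ζ - z) ^ n)⁻¹) ζ :=
    fun n ζ hζ => ContinuousAt.inv₀ (by fun_prop) (pow_ne_zero _ (hne ζ hζ))
  induction N with
  | zero =>
    intro y hy
    have hyd : ∀ ζ ∈ Metric.ball z r, DifferentiableAt ℂ y ζ := fun ζ hζ =>
      hy.differentiableAt (hnhds ζ hζ)
    have h1 : ∀ ζ ∈ Metric.ball z r, DifferentiableAt ℂ (fun ζ => y ζ ∘L w ζ) ζ := fun ζ hζ =>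
      (hyd ζ hζ).clm_comp (hwd ζ hζ)
    have h2 : ∀ ζ ∈ Metric.ball z r, DifferentiableAt ℂ (fun ζ => trCLM W (w ζ ∘L y ζ)) ζ :=
      fun ζ hζ => (trCLM W).differentiableAt.comp ζ ((hwd ζ hζ).clm_comp (hyd ζ hζ))
    simp only [pow_zero, inv_one, one_smul]
    rw [Complex.circleIntegral_eq_zero_of_differentiable_on_off_countable hε.le
        Set.countable_empty (fun ζ hζ => (h1 ζ (hsub hζ)).continuousAt.continuousWithinAt)
        (fun ζ hζ => h1 ζ (hsub (Metric.ball_subset_closedBall hζ.1))),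
      Complex.circleIntegral_eq_zero_of_differentiable_on_off_countable hε.le
        Set.countable_empty (fun ζ hζ => (h2 ζ (hsub hζ)).continuousAt.continuousWithinAt)
        (fun ζ hζ => h2 ζ (hsub (Metric.ball_subset_closedBall hζ.1)))]
    exact hasTrace_zero
  | succ N ih =>
    intro y hy
    have hd : DifferentiableOn ℂ (dslope y z) (Metric.ball z r) :=
      (Complex.differentiableOn_dslope (hnhds z (Metric.mem_ball_self (hε.trans hr)))).2 hy
    have hdd : ∀ ζ ∈ Metric.ball z r, DifferentiableAt ℂ (dslope y z) ζ := fun ζ hζ =>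
      hd.differentiableAt (hnhds ζ hζ)
    have hs : ∀ ζ ∈ Metric.sphere z ε, ζ ∈ Metric.ball z r := fun ζ hζ =>
      hsub (Metric.sphere_subset_closedBall hζ)
    have hy' : ∀ ζ, y ζ = y z + (ζ - z) • dslope y z ζ := fun ζ => by
      rw [sub_smul_dslope]; abel
    have hcancel : ∀ ζ ∈ Metric.sphere z ε, ((ζ - z) ^ (N + 1))⁻¹ * (ζ - z) = ((ζ - z) ^ N)⁻¹ := by
      intro ζ hζ
      have := hne ζ hζ
      rw [pow_succ]
      field_simp
    have hint0 : CircleIntegrable (fun ζ => ((ζ - z) ^ (N + 1))⁻¹ • w ζ) z ε :=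
      CircleIntegrable.of_continuousAt hε.le fun ζ hζ =>
        (hinv _ ζ hζ).smul (hwd ζ (hs ζ hζ)).continuousAt
    have e1 : ∮ ζ in C(z, ε), ((ζ - z) ^ (N + 1))⁻¹ • (y ζ ∘L w ζ) =
        y z ∘L (∮ ζ in C(z, ε), ((ζ - z) ^ (N + 1))⁻¹ • w ζ) +
          ∮ ζ in C(z, ε), ((ζ - z) ^ N)⁻¹ • (dslope y z ζ ∘L w ζ) := by
      have h1 := map_circleIntegral (ContinuousLinearMap.compL ℂ H W H (y z)) hint0
      rw [ContinuousLinearMap.compL_apply] at h1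
      rw [h1, ← circleIntegral.integral_add]
      · refine circleIntegral.integral_congr hε.le fun ζ hζ => ?_
        simp only [ContinuousLinearMap.compL_apply]
        conv_lhs => rw [hy' ζ]
        rw [← hcancel ζ hζ, ContinuousLinearMap.add_comp, smul_add, ContinuousLinearMap.comp_smul,
          ContinuousLinearMap.smul_comp, smul_smul]
      · refine CircleIntegrable.of_continuousAt hε.le fun ζ hζ => ?_
        exact (ContinuousLinearMap.continuous _).continuousAt.comp
          ((hinv _ ζ hζ).smul (hwd ζ (hs ζ hζ)).continuousAt)
      · exact CircleIntegrable.of_continuousAt hε.le fun ζ hζ => (hinv _ ζ hζ).smul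
          ((hdd ζ (hs ζ hζ)).continuousAt.clm_comp (hwd ζ (hs ζ hζ)).continuousAt)
    let L : (H →L[ℂ] W) →L[ℂ] ℂ := (trCLM W) ∘L ((ContinuousLinearMap.compL ℂ W H W).flip (y z))
    have e2 : ∮ ζ in C(z, ε), ((ζ - z) ^ (N + 1))⁻¹ • trCLM W (w ζ ∘L y ζ) =
        trCLM W ((∮ ζ in C(z, ε), ((ζ - z) ^ (N + 1))⁻¹ • w ζ) ∘L y z) +
          ∮ ζ in C(z, ε), ((ζ - z) ^ N)⁻¹ • trCLM W (w ζ ∘L dslope y z ζ) := by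
      have h1 := map_circleIntegral L hint0
      change trCLM W ((∮ ζ in C(z, ε), ((ζ - z) ^ (N + 1))⁻¹ • w ζ) ∘L y z) = _ at h1
      rw [h1, ← circleIntegral.integral_add]
      · refine circleIntegral.integral_congr hε.le fun ζ hζ => ?_
        change _ = trCLM W ((((ζ - z) ^ (N + 1))⁻¹ • w ζ) ∘L y z) + _
        rw [← hcancel ζ hζ, hy' ζ, ContinuousLinearMap.comp_add, map_add,
          ContinuousLinearMap.comp_smul, map_smul, ContinuousLinearMap.smul_comp, map_smul,
          smul_add, mul_smul]
      · refine CircleIntegrable.of_continuousAt hε.le fun ζ hζ => ?_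
        exact L.continuous.continuousAt.comp
          ((hinv _ ζ hζ).smul (hwd ζ (hs ζ hζ)).continuousAt)
      · exact CircleIntegrable.of_continuousAt hε.le fun ζ hζ => (hinv _ ζ hζ).smul
          ((trCLM W).continuous.continuousAt.comp
            ((hwd ζ (hs ζ hζ)).continuousAt.clm_comp (hdd ζ (hs ζ hζ)).continuousAt))
    rw [e1, e2]
    exact (hasTrace_comp _ _).add (ih hd)

/-- The trace of the integral of a product of meromorphic operator functions which factors through
a finite-dimensional space. -/
theorem eventually_hasTrace_circleIntegral {z : ℂ} {y : ℂ → W →L[ℂ] H} {w : ℂ → H →L[ℂ] W}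
    (hy : MeromorphicAt y z) (hw : MeromorphicAt w z) :
    ∀ᶠ ε in 𝓝[>] (0 : ℝ), HasTrace (∮ ζ in C(z, ε), y ζ ∘L w ζ)
      (∮ ζ in C(z, ε), trCLM W (w ζ ∘L y ζ)) := by
  have : CompleteSpace W := FiniteDimensional.complete ℂ W
  obtain ⟨m, hm⟩ := hy
  obtain ⟨n, hn⟩ := hw
  obtain ⟨r, hr, hball⟩ := Metric.eventually_nhds_iff_ball.1
    (hm.eventually_analyticAt.and hn.eventually_analyticAt)
  filter_upwards [Ioo_mem_nhdsGT hr] with ε hε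
  have h := hasTrace_circleIntegral_of_differentiableOn hε.1 hε.2 (m + n)
    (w := fun ζ => (ζ - z) ^ n • w ζ)
    (fun ζ hζ => (hball ζ hζ).2.differentiableAt.differentiableWithinAt)
    (y := fun ζ => (ζ - z) ^ m • y ζ)
    (fun ζ hζ => (hball ζ hζ).1.differentiableAt.differentiableWithinAt)
  have hne : ∀ ζ ∈ Metric.sphere z ε, ζ - z ≠ 0 := fun ζ hζ h => by
    rw [Metric.mem_sphere, dist_eq_norm, h, norm_zero] at hζ
    exact hε.1.ne hζ
  rw [circleIntegral.integral_congr (g := fun ζ => y ζ ∘L w ζ) hε.1.le,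
    circleIntegral.integral_congr (g := fun ζ => trCLM W (w ζ ∘L y ζ)) hε.1.le] at h
  · exact h
  · intro ζ hζ
    have := hne ζ hζ
    simp only [ContinuousLinearMap.comp_smul, ContinuousLinearMap.smul_comp, map_smul, smul_eq_mul]
    rw [pow_add]
    field_simp
  · intro ζ hζ
    have := hne ζ hζ
    simp only [ContinuousLinearMap.comp_smul, ContinuousLinearMap.smul_comp, smul_smul]
    rw [pow_add]
    have h1 : ((ζ - z) ^ m * (ζ - z) ^ n)⁻¹ * ((ζ - z) ^ n * (ζ - z) ^ m) = 1 := by field_simp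
    rw [h1, one_smul]

end FiniteRankTrace

/-! ### Resolvents and their analyticity -/

theorem commute_ringInverse {R : Type*} [Ring R] {a b : R} (h : Commute a b) (hb : IsUnit b) :
    Commute a (Ring.inverse b) := by
  obtain ⟨u, rfl⟩ := hb
  rw [Ring.inverse_unit]
  exact h.units_inv_right

theorem HasDerivAt.ringInverse_of_isUnit {R : Type*} [NormedRing R] [NormedAlgebra ℂ R]
    [CompleteSpace R] {f : ℂ → R} {f' : R} {z : ℂ} (hf : HasDerivAt f f' z) (hu : IsUnit (f z)) :
    HasDerivAt (fun ζ => Ring.inverse (f ζ))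
      (-(Ring.inverse (f z) * f' * Ring.inverse (f z))) z := by
  obtain ⟨u, hu⟩ := hu
  have h1 := hasFDerivAt_ringInverse (𝕜 := ℂ) u
  rw [hu] at h1
  have h2 := h1.comp_hasDerivAt z hf
  refine h2.congr_deriv ?_
  rw [← hu, Ring.inverse_unit]
  simp

/-- The derivative of the inverse of an operator function. -/
theorem HasDerivAt.clm_ringInverse {E : Type*} [NormedAddCommGroup E] [NormedSpace ℂ E]
    [CompleteSpace E] {f : ℂ → E →L[ℂ] E} {f' : E →L[ℂ] E} {z : ℂ} (hf : HasDerivAt f f' z)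
    (hu : IsUnit (f z)) : HasDerivAt (fun ζ => Ring.inverse (f ζ))
      (-(Ring.inverse (f z) * f' * Ring.inverse (f z))) z :=
  HasDerivAt.ringInverse_of_isUnit hf hu

section Resolvent

variable {E : Type*} [NormedAddCommGroup E] [NormedSpace ℂ E] {T : E →ₗ.[ℂ] E} {z w : ℂ}

theorem IsResolventAt.unique {R R' : E →L[ℂ] E} (h : IsResolventAt T z R)
    (h' : IsResolventAt T z R') : R = R' := by
  ext x
  obtain ⟨hx, h1⟩ := h.1 x
  have := h'.2 ⟨R x, hx⟩
  rw [h1] at this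
  exact this.symm

theorem IsResolventAt.mem_rho {R : E →L[ℂ] E} (h : IsResolventAt T z R) : z ∈ rho T := ⟨R, h⟩

theorem isResolventAt_res (h : z ∈ rho T) : IsResolventAt T z (res T z) := by
  have h' : ∃ R : E →L[ℂ] E, IsResolventAt T z R := h
  rw [res, dif_pos h']
  exact h'.choose_spec

theorem IsResolventAt.res_eq {R : E →L[ℂ] E} (h : IsResolventAt T z R) : res T z = R :=
  (isResolventAt_res h.mem_rho).unique h

theorem IsResolventAt.mem_domain {R : E →L[ℂ] E} (h : IsResolventAt T z R) (x : E) :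
    R x ∈ T.domain := (h.1 x).1

theorem IsResolventAt.apply_eq {R : E →L[ℂ] E} (h : IsResolventAt T z R) (x : E) :
    T ⟨R x, h.mem_domain x⟩ = x + z • R x :=
  sub_eq_iff_eq_add.1 (h.1 x).2

theorem IsResolventAt.apply_ne_zero {R : E →L[ℂ] E} (h : IsResolventAt T z R) {x : E}
    (hx : x ≠ 0) : R x ≠ 0 := by
  intro h0
  have h1 := h.apply_eq x
  have h2 : (⟨R x, h.mem_domain x⟩ : T.domain) = 0 := Subtype.ext h0
  rw [h2, h0, LinearPMap.map_zero, smul_zero, add_zero] at h1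
  exact hx h1.symm

/-- The first resolvent identity. -/
theorem res_sub_res (hz : z ∈ rho T) (hw : w ∈ rho T) :
    res T z - res T w = (z - w) • (res T z * res T w) := by
  ext x
  have h1 := (isResolventAt_res hz).2 ⟨res T w x, (isResolventAt_res hw).mem_domain x⟩
  rw [(isResolventAt_res hw).apply_eq] at h1
  simp only [map_sub, map_add, map_smul] at h1
  simp only [sub_apply, smul_apply, mul_apply_eq_comp]
  have h2 : res T z x = res T w x + (z - w) • res T z (res T w x) := by
    rw [sub_smul]
    nth_rewrite 1 [← h1]
    abel
  rw [h2]; abel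

theorem res_comm (hz : z ∈ rho T) (hw : w ∈ rho T) : Commute (res T z) (res T w) := by
  by_cases h : z = w
  · rw [h]
  have h1 := res_sub_res hz hw
  have h2 := res_sub_res hw hz
  have h3 : (z - w) • (res T z * res T w) = (z - w) • (res T w * res T z) := by
    rw [← h1, ← neg_sub, h2, ← neg_smul, neg_sub]
  exact smul_right_injective _ (sub_ne_zero.2 h) h3

/-- An operator related to a resolvent by the resolvent identities is a resolvent. -/
theorem IsResolventAt.of_identity {R R' : E →L[ℂ] E} (h : IsResolventAt T w R)
    (h1 : R' - R = (z - w) • (R * R')) (h2 : R' - R = (z - w) • (R' * R)) :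
    IsResolventAt T z R' := by
  have e1 : ∀ x, R' x = R (x + (z - w) • R' x) := fun x => by
    have := congrArg (fun S : E →L[ℂ] E => S x) h1
    simp only [sub_apply, smul_apply, mul_apply_eq_comp] at this
    rw [map_add, map_smul, ← this]; abel
  have hm : ∀ x, R' x ∈ T.domain := fun x => by rw [e1]; exact h.mem_domain _
  refine ⟨fun x => ⟨hm x, ?_⟩, fun x => ?_⟩
  · have h3 := h.apply_eq (x + (z - w) • R' x)
    have h4 : (⟨R' x, hm x⟩ : T.domain) = ⟨R (x + (z - w) • R' x), h.mem_domain _⟩ :=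
      Subtype.ext (e1 x)
    rw [h4, h3, ← e1, sub_smul]; abel
  · have h3 := h.2 x
    have h4 := congrArg (fun S : E →L[ℂ] E => S (T x - w • (x : E))) h2
    simp only [sub_apply, smul_apply, mul_apply_eq_comp] at h4
    rw [h3] at h4
    have h5 : T x - z • (x : E) = (T x - w • (x : E)) - (z - w) • (x : E) := by
      rw [sub_smul]; abel
    rw [h5, map_sub, map_smul, ← h4]; abel

/-- The factors are (T - z)(T - w)⁻¹ and (T - w)(T - z)⁻¹, written without unbounded operators. -/
theorem one_sub_smul_res_mul (hz : z ∈ rho T) (hw : w ∈ rho T) :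
    (1 - (z - w) • res T w) * (1 + (z - w) • res T z) = 1 := by
  have h := res_sub_res hz hw
  rw [(res_comm hz hw).eq] at h
  rw [sub_mul, one_mul, mul_add, mul_one, smul_mul_smul_comm, mul_smul, ← h, smul_sub]
  abel

theorem mul_one_sub_smul_res (hz : z ∈ rho T) (hw : w ∈ rho T) :
    (1 + (z - w) • res T z) * (1 - (z - w) • res T w) = 1 := by
  have h : Commute (1 + (z - w) • res T z) (1 - (z - w) • res T w) :=
    ((Commute.one_right _).sub_right
      ((Commute.one_left _).add_left (((res_comm hz hw).smul_left _).smul_right _)))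
  rw [h.eq, one_sub_smul_res_mul hz hw]

theorem isResolventAt_of_isUnit (hw : w ∈ rho T) (hu : IsUnit (1 - (z - w) • res T w)) :
    IsResolventAt T z (res T w * Ring.inverse (1 - (z - w) • res T w)) := by
  have hc : Commute (res T w) (Ring.inverse (1 - (z - w) • res T w)) :=
    commute_ringInverse (Commute.sub_right (Commute.one_right (res T w))
      ((Commute.refl (res T w)).smul_right (z - w))) hu
  have h1 : res T w * Ring.inverse (1 - (z - w) • res T w) - res T w =
      (z - w) • (res T w * Ring.inverse (1 - (z - w) • res T w) * res T w) := by
    have h2 := Ring.inverse_mul_cancel _ hu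
    rw [mul_sub, mul_one, mul_smul_comm, sub_eq_iff_eq_add] at h2
    conv_lhs => rw [h2]
    rw [mul_add, mul_one, mul_smul_comm, mul_assoc]; abel
  refine (isResolventAt_res hw).of_identity ?_ h1
  rw [h1, mul_assoc, ← hc.eq]

variable [CompleteSpace E]

theorem eventually_isUnit_one_sub_smul (R : E →L[ℂ] E) (w : ℂ) :
    ∀ᶠ ζ in 𝓝 w, IsUnit (1 - (ζ - w) • R) := by
  have hc : ContinuousAt (fun ζ : ℂ => 1 - (ζ - w) • R) w := by fun_prop
  refine hc.eventually (p := IsUnit) ?_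
  have h1 : (1 : E →L[ℂ] E) - (w - w) • R = 1 := by rw [sub_self, zero_smul, sub_zero]
  change ∀ᶠ S in 𝓝 (1 - (w - w) • R), IsUnit S
  rw [h1]
  exact Units.isOpen.mem_nhds isUnit_one

theorem isOpen_rho (T : E →ₗ.[ℂ] E) : IsOpen (rho T) := by
  rw [isOpen_iff_mem_nhds]
  intro w hw
  filter_upwards [eventually_isUnit_one_sub_smul (res T w) w] with ζ hζ
  exact (isResolventAt_of_isUnit hw hζ).mem_rho

theorem hasDerivAt_res (hw : w ∈ rho T) : HasDerivAt (res T) (res T w * res T w) w := by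
  have hev : res T =ᶠ[𝓝 w] fun ζ => res T w * Ring.inverse (1 - (ζ - w) • res T w) := by
    filter_upwards [eventually_isUnit_one_sub_smul (res T w) w] with ζ hζ
    exact (isResolventAt_of_isUnit hw hζ).res_eq
  have hd : DifferentiableAt ℂ (fun ζ => res T w * Ring.inverse (1 - (ζ - w) • res T w)) w := by
    refine DifferentiableAt.const_mul ?_ _
    have h1 : HasDerivAt (fun ζ : ℂ => 1 - (ζ - w) • res T w) (-((1 : ℂ) • res T w)) w :=
      (((hasDerivAt_id w).sub_const w).smul_const (res T w)).const_sub 1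
    refine (HasDerivAt.clm_ringInverse h1 ?_).differentiableAt
    rw [sub_self, zero_smul, sub_zero]
    exact isUnit_one
  -- The Neumann form is used only for continuity; the value of the derivative is read off from the
  -- resolvent identity.
  have hcont : ContinuousAt (res T) w := (hd.congr_of_eventuallyEq hev).continuousAt
  rw [hasDerivAt_iff_tendsto_slope]
  have h1 : Tendsto (fun ζ => res T ζ * res T w) (𝓝[≠] w) (𝓝 (res T w * res T w)) :=
    (hcont.tendsto.mono_left nhdsWithin_le_nhds).mul_const _
  refine h1.congr' ?_
  filter_upwards [self_mem_nhdsWithin, nhdsWithin_le_nhds ((isOpen_rho T).mem_nhds hw)] with ζ h2 h3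
  rw [slope_def_module, res_sub_res h3 hw, smul_smul, inv_mul_cancel₀ (sub_ne_zero.2 h2), one_smul]

theorem differentiableAt_res (hw : w ∈ rho T) : DifferentiableAt ℂ (res T) w :=
  (hasDerivAt_res hw).differentiableAt

end Resolvent

/-! ### Riesz projections and algebraic multiplicity -/

section Riesz

variable {E : Type*} [NormedAddCommGroup E] [NormedSpace ℂ E] [CompleteSpace E]
  {T : E →ₗ.[ℂ] E} {z : ℂ}

/-- By Cauchy's theorem on an annulus the integral is constant for small radii, so the limit
defining `rieszProj` is attained. -/
theorem eventually_rieszIntegral_eq (h : ∀ᶠ ζ in 𝓝[≠] z, ζ ∈ rho T) :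
    ∀ᶠ ε in 𝓝[>] (0 : ℝ), rieszIntegral T z ε = rieszProj T z := by
  obtain ⟨r, hr, hball⟩ := Metric.eventually_nhds_iff_ball.1 (eventually_nhdsWithin_iff.1 h)
  have hmem : ∀ ε ∈ Set.Ioo 0 r, rieszIntegral T z ε = rieszIntegral T z (r / 2) := by
    have key : ∀ a b, 0 < a → a ≤ b → b < r → rieszIntegral T z b = rieszIntegral T z a := by
      intro a b ha hab hb
      have hρ : ∀ ζ ∈ Metric.closedBall z b \ Metric.ball z a, ζ ∈ rho T := by
        rintro ζ ⟨h1, h2⟩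
        refine hball ζ (Metric.closedBall_subset_ball hb h1) ?_
        rintro rfl
        exact h2 (Metric.mem_ball_self ha)
      rw [rieszIntegral, rieszIntegral,
        Complex.circleIntegral_eq_of_differentiable_on_annulus_off_countable ha hab
          Set.countable_empty
          (fun ζ hζ => (differentiableAt_res (hρ ζ hζ)).continuousAt.continuousWithinAt)
          (fun ζ hζ => differentiableAt_res (hρ ζ ⟨Metric.ball_subset_closedBall hζ.1.1,
            fun h => hζ.1.2 (Metric.ball_subset_closedBall h)⟩))]
    rintro ε ⟨h1, h2⟩
    rcases le_total ε (r / 2) with h | h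
    · exact (key _ _ h1 h (by linarith)).symm
    · exact key _ _ (by linarith) h h2
  have hev : ∀ᶠ ε in 𝓝[>] (0 : ℝ), rieszIntegral T z ε = rieszIntegral T z (r / 2) :=
    Filter.mem_of_superset (Ioo_mem_nhdsGT hr) hmem
  have hlim : rieszProj T z = rieszIntegral T z (r / 2) :=
    (tendsto_const_nhds.congr' (hev.mono fun _ h => h.symm)).limUnder_eq
  rw [hlim]
  exact hev

/-- The regular part of the resolvent at an isolated point of the spectrum. -/
theorem exists_regular_part_res (h : ∀ᶠ ζ in 𝓝[≠] z, ζ ∈ rho T) :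
    ∃ S : ℂ → E →L[ℂ] E, AnalyticAt ℂ S z ∧
      ∀ᶠ ζ in 𝓝[≠] z, S ζ = res T ζ * (1 - rieszProj T z) := by
  obtain ⟨ε, hε, hPε, hρ⟩ := ((eventually_mem_nhdsWithin (a := (0 : ℝ)) (s := Set.Ioi 0)).and
    ((eventually_rieszIntegral_eq h).and (eventually_closedBall_of_punctured h))).exists
  have hε : 0 < ε := hε
  have hne : ∀ ζ ∈ Metric.sphere z ε, ζ ≠ z := fun ζ hζ h0 => by
    rw [h0, Metric.mem_sphere, dist_self] at hζ
    exact hε.ne hζ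
  have hρs : ∀ ζ ∈ Metric.sphere z ε, ζ ∈ rho T := fun ζ hζ =>
    hρ ζ (Metric.sphere_subset_closedBall hζ) (hne ζ hζ)
  have hci : CircleIntegrable (res T) z ε := CircleIntegrable.of_continuousAt hε.le fun ζ hζ =>
    (differentiableAt_res (hρs ζ hζ)).continuousAt
  have hps := hasFPowerSeriesOn_cauchy_integral (R := ⟨ε, hε.le⟩) hci hε
  refine ⟨_, hps.analyticAt, ?_⟩
  filter_upwards [nhdsWithin_le_nhds (Metric.ball_mem_nhds z hε), self_mem_nhdsWithin] with w hw hwz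
  have hwρ : w ∈ rho T := hρ w (Metric.ball_subset_closedBall hw) hwz
  have hnew : ∀ ζ ∈ Metric.sphere z ε, ζ - w ≠ 0 := fun ζ hζ h0 => by
    rw [sub_eq_zero.1 h0] at hζ
    exact (Metric.mem_ball.1 hw).ne hζ
  have hcw : CircleIntegrable (fun ζ : ℂ => (ζ - w)⁻¹) z ε :=
    CircleIntegrable.of_continuousAt hε.le fun ζ hζ =>
      ContinuousAt.inv₀ (by fun_prop) (hnew ζ hζ)
  -- The candidate is the Cauchy integral of the resolvent, which is analytic inside the circle. The
  -- resolvent identity (ζ - w)⁻¹ R(ζ) = (ζ - w)⁻¹ R(w) + R(w) R(ζ) evaluates it as R(w) - R(w) P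
  -- for w ≠ z.
  have e1 : ∮ ζ in C(z, ε), (ζ - w)⁻¹ • res T ζ =
      (∮ ζ in C(z, ε), (ζ - w)⁻¹) • res T w + res T w * ∮ ζ in C(z, ε), res T ζ := by
    have h1 := map_circleIntegral (ContinuousLinearMap.mul ℂ (E →L[ℂ] E) (res T w)) hci
    rw [ContinuousLinearMap.mul_apply'] at h1
    have hsc : ∮ ζ in C(z, ε), (ζ - w)⁻¹ • res T w = (∮ ζ in C(z, ε), (ζ - w)⁻¹) • res T w :=
      circleIntegral.integral_smul_const _ _ _ _
    rw [h1, ← hsc, ← circleIntegral.integral_add]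
    · refine circleIntegral.integral_congr hε.le fun ζ hζ => ?_
      have h2 := res_sub_res (hρs ζ hζ) hwρ
      rw [(res_comm (hρs ζ hζ) hwρ).eq] at h2
      simp only [ContinuousLinearMap.mul_apply']
      have h3 := congrArg ((ζ - w)⁻¹ • ·) h2
      simp only [smul_sub, smul_smul, inv_mul_cancel₀ (hnew ζ hζ), one_smul] at h3
      rw [← h3]
      abel
    · exact CircleIntegrable.of_continuousAt hε.le fun ζ hζ =>
        ContinuousAt.smul (f := fun ζ : ℂ => (ζ - w)⁻¹)
          (ContinuousAt.inv₀ (by fun_prop) (hnew ζ hζ)) continuousAt_const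
    · exact CircleIntegrable.of_continuousAt hε.le fun ζ hζ =>
        (ContinuousLinearMap.continuous _).continuousAt.comp
          (differentiableAt_res (hρs ζ hζ)).continuousAt
  change (2 * (Real.pi : ℂ) * Complex.I)⁻¹ • (∮ ζ in C(z, ε), (ζ - w)⁻¹ • res T ζ) = _
  rw [e1, circleIntegral.integral_sub_inv_of_mem_ball hw, smul_add, smul_smul,
    inv_mul_cancel₀ Complex.two_pi_I_ne_zero, one_smul, ← hPε, rieszIntegral, mul_sub, mul_one,
    mul_neg, mul_smul_comm, sub_neg_eq_add]

theorem circleIntegral_eq_zero_of_analyticAt {F : Type*} [NormedAddCommGroup F] [NormedSpace ℂ F]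
    [CompleteSpace F] {S : ℂ → F} (hS : AnalyticAt ℂ S z) :
    ∀ᶠ ε in 𝓝[>] (0 : ℝ), ∮ ζ in C(z, ε), S ζ = 0 := by
  obtain ⟨r, hr, hball⟩ := Metric.eventually_nhds_iff_ball.1 hS.eventually_analyticAt
  filter_upwards [Ioo_mem_nhdsGT hr] with ε hε
  have hsub : Metric.closedBall z ε ⊆ Metric.ball z r := Metric.closedBall_subset_ball hε.2
  exact Complex.circleIntegral_eq_zero_of_differentiable_on_off_countable hε.1.le
    Set.countable_empty (fun ζ hζ => (hball ζ (hsub hζ)).continuousAt.continuousWithinAt)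
    (fun ζ hζ => (hball ζ (hsub (Metric.ball_subset_closedBall hζ.1))).differentiableAt)

theorem circleIntegrable_res (h : ∀ᶠ ζ in 𝓝[≠] z, ζ ∈ rho T) :
    ∀ᶠ ε in 𝓝[>] (0 : ℝ), CircleIntegrable (res T) z ε := by
  filter_upwards [eventually_sphere_of_punctured h, self_mem_nhdsWithin] with ε hε h0
  exact CircleIntegrable.of_continuousAt (le_of_lt h0) fun ζ hζ =>
    (differentiableAt_res (hε ζ hζ)).continuousAt

/-- The regular part R(ζ)(1 - P) has zero integral, which says P(1 - P) = 0; no double contour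
integral is needed. -/
theorem rieszProj_mul_self (h : ∀ᶠ ζ in 𝓝[≠] z, ζ ∈ rho T) :
    rieszProj T z * rieszProj T z = rieszProj T z := by
  obtain ⟨S, hS, hSe⟩ := exists_regular_part_res h
  obtain ⟨ε, h0, h1, h2, h3, h4⟩ := ((eventually_mem_nhdsWithin (a := (0 : ℝ)) (s := Set.Ioi 0)).and
    ((circleIntegral_eq_zero_of_analyticAt hS).and ((eventually_sphere_of_punctured hSe).and
    ((eventually_rieszIntegral_eq h).and (circleIntegrable_res h))))).exists
  have h5 := map_circleIntegral
    ((ContinuousLinearMap.mul ℂ (E →L[ℂ] E)).flip (1 - rieszProj T z)) h4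
  simp only [ContinuousLinearMap.flip_apply, ContinuousLinearMap.mul_apply'] at h5
  rw [← circleIntegral.integral_congr (le_of_lt h0) h2, h1] at h5
  have h6 : rieszProj T z * (1 - rieszProj T z) = 0 := by
    nth_rewrite 1 [← h3]
    rw [rieszIntegral, neg_mul, smul_mul_assoc, h5, smul_zero, neg_zero]
  rw [mul_sub, mul_one, sub_eq_zero] at h6
  exact h6.symm

theorem rieszProj_comm_of_forall (h : ∀ᶠ ζ in 𝓝[≠] z, ζ ∈ rho T) {Q : E →L[ℂ] E}
    (hQ : ∀ ζ ∈ rho T, Commute (res T ζ) Q) : Commute (rieszProj T z) Q := by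
  obtain ⟨ε, h0, h1, h2, h3⟩ := ((eventually_mem_nhdsWithin (a := (0 : ℝ)) (s := Set.Ioi 0)).and
    ((eventually_sphere_of_punctured h).and
    ((eventually_rieszIntegral_eq h).and (circleIntegrable_res h)))).exists
  have h4 := map_circleIntegral (ContinuousLinearMap.mul ℂ (E →L[ℂ] E) Q) h3
  have h5 := map_circleIntegral ((ContinuousLinearMap.mul ℂ (E →L[ℂ] E)).flip Q) h3
  simp only [ContinuousLinearMap.flip_apply, ContinuousLinearMap.mul_apply'] at h4 h5
  have h6 : (∮ ζ in C(z, ε), res T ζ) * Q = Q * ∮ ζ in C(z, ε), res T ζ := by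
    rw [h4, h5]
    exact circleIntegral.integral_congr (le_of_lt h0) fun ζ hζ => (hQ ζ (h1 ζ hζ)).eq
  rw [← h2, rieszIntegral]
  exact (Commute.smul_left h6 _).neg_left

theorem rieszProj_comm_res (h : ∀ᶠ ζ in 𝓝[≠] z, ζ ∈ rho T) {w : ℂ} (hw : w ∈ rho T) :
    Commute (rieszProj T z) (res T w) :=
  rieszProj_comm_of_forall h fun _ hζ => res_comm hζ hw

theorem rieszProj_eq_zero_of_mem_rho (h : z ∈ rho T) : rieszProj T z = 0 := by
  have h' : ∀ᶠ ζ in 𝓝 z, ζ ∈ rho T := (isOpen_rho T).mem_nhds h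
  have han : AnalyticAt ℂ (res T) z :=
    Complex.analyticAt_iff_eventually_differentiableAt.2 (h'.mono fun ζ hζ => differentiableAt_res hζ)
  obtain ⟨ε, h1, h2⟩ := ((circleIntegral_eq_zero_of_analyticAt han).and
    (eventually_rieszIntegral_eq (h'.filter_mono nhdsWithin_le_nhds))).exists
  rw [← h2, rieszIntegral, h1, smul_zero, neg_zero]

/-- If P = 0, the regular part is the resolvent itself and extends to z; the resolvent identities
pass to the limit and make its value there a resolvent. -/
theorem mem_rho_of_rieszProj_eq_zero (h : ∀ᶠ ζ in 𝓝[≠] z, ζ ∈ rho T) (h0 : rieszProj T z = 0) :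
    z ∈ rho T := by
  obtain ⟨S, hS, hSe⟩ := exists_regular_part_res h
  obtain ⟨w, hw⟩ := h.exists
  have hSt : Tendsto S (𝓝[≠] z) (𝓝 (S z)) := hS.continuousAt.tendsto.mono_left nhdsWithin_le_nhds
  have hzt : Tendsto (fun ζ : ℂ => ζ - w) (𝓝[≠] z) (𝓝 (z - w)) :=
    (continuousAt_id.sub continuousAt_const).tendsto.mono_left nhdsWithin_le_nhds
  have hSe' : ∀ᶠ ζ in 𝓝[≠] z, S ζ = res T ζ := hSe.mono fun ζ hζ => by
    rw [hζ, h0, sub_zero, mul_one]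
  have h1 : S z - res T w = (z - w) • (S z * res T w) := by
    refine tendsto_nhds_unique_of_eventuallyEq (hSt.sub_const _) (hzt.smul (hSt.mul_const _)) ?_
    filter_upwards [hSe', h] with ζ h2 h3
    rw [h2, res_sub_res h3 hw]
  have h2 : S z - res T w = (z - w) • (res T w * S z) := by
    refine tendsto_nhds_unique_of_eventuallyEq (hSt.sub_const _) (hzt.smul (hSt.const_mul _)) ?_
    filter_upwards [hSe', h] with ζ h2 h3
    rw [h2, res_sub_res h3 hw, (res_comm h3 hw).eq]
  exact ((isResolventAt_res hw).of_identity h2 h1).mem_rho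

/-- The range of P is nonzero, finite-dimensional and invariant under R(w), so it contains an
eigenvector v of R(w), hence of T, with some eigenvalue μ. If μ ≠ z, then R(ζ) v = (μ - ζ)⁻¹ v is
analytic at z and P v = 0, contrary to P v = v. Thus the eigenvalue clause in the definition of
multiplicity holds automatically. -/
theorem exists_eigenvector (h : ∀ᶠ ζ in 𝓝[≠] z, ζ ∈ rho T) (hz : z ∉ rho T)
    (hf : FiniteDimensional ℂ (LinearMap.range (rieszProj T z : E →ₗ[ℂ] E))) :
    ∃ x : T.domain, (x : E) ≠ 0 ∧ T x = z • (x : E) := by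
  set P := rieszProj T z with hP
  set V := LinearMap.range (P : E →ₗ[ℂ] E) with hV
  obtain ⟨w, hw⟩ := h.exists
  have hPv : ∀ v ∈ V, P v = v := by
    rintro _ ⟨x, rfl⟩
    exact congrArg (fun S : E →L[ℂ] E => S x) (rieszProj_mul_self h)
  have hnt : Nontrivial V := by
    rw [Submodule.nontrivial_iff_ne_bot]
    intro hb
    refine hz (mem_rho_of_rieszProj_eq_zero h ?_)
    ext x
    have : P x ∈ V := ⟨x, rfl⟩
    rw [hb] at this
    exact (Submodule.mem_bot ℂ).1 this
  have hinv : ∀ v ∈ V, (res T w : E →ₗ[ℂ] E) v ∈ V := by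
    rintro _ ⟨x, rfl⟩
    exact ⟨res T w x, congrArg (fun S : E →L[ℂ] E => S x) (rieszProj_comm_res h hw).eq⟩
  obtain ⟨c, hc⟩ := Module.End.exists_eigenvalue ((res T w : E →ₗ[ℂ] E).restrict hinv)
  obtain ⟨v, hv⟩ := hc.exists_hasEigenvector
  have hv0 : (v : E) ≠ 0 := fun h0 => hv.2 (Subtype.ext h0)
  have hcv : res T w v = c • (v : E) := congrArg Subtype.val hv.apply_eq_smul
  have hR := isResolventAt_res hw
  have hc0 : c ≠ 0 := by
    rintro rfl
    rw [zero_smul] at hcv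
    exact hR.apply_ne_zero hv0 hcv
  have hdom : (v : E) ∈ T.domain := by
    have : (v : E) = c⁻¹ • res T w v := by rw [hcv, smul_smul, inv_mul_cancel₀ hc0, one_smul]
    rw [this]
    exact T.domain.smul_mem _ (hR.mem_domain _)
  have hTv : T ⟨v, hdom⟩ = (w + c⁻¹) • (v : E) := by
    have h1 := hR.apply_eq v
    have h2 : (⟨res T w v, hR.mem_domain v⟩ : T.domain) = c • ⟨v, hdom⟩ := Subtype.ext hcv
    rw [h2, LinearPMap.map_smul, hcv] at h1
    have h3 := congrArg (fun x => c⁻¹ • x) h1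
    simp only [smul_add, smul_smul, inv_mul_cancel₀ hc0, one_smul] at h3
    rw [h3, add_smul, add_comm]
    congr 2
    field_simp
  by_cases hμ : w + c⁻¹ = z
  · exact ⟨⟨v, hdom⟩, hv0, by rw [hTv, hμ]⟩
  exfalso
  set μ := w + c⁻¹
  have hres : ∀ ζ ∈ rho T, μ ≠ ζ → res T ζ v = (μ - ζ)⁻¹ • (v : E) := by
    intro ζ hζ hne
    have h1 := (isResolventAt_res hζ).2 ⟨v, hdom⟩
    rw [hTv] at h1
    change res T ζ (μ • (v : E) - ζ • (v : E)) = v at h1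
    rw [← sub_smul, map_smul] at h1
    rw [eq_inv_smul_iff₀ (sub_ne_zero.2 hne), h1]
  have hμz : ∀ᶠ ζ in 𝓝 z, μ - ζ ≠ 0 :=
    (continuousAt_const.sub continuousAt_id).eventually_ne (sub_ne_zero.2 hμ)
  have han : AnalyticAt ℂ (fun ζ : ℂ => (μ - ζ)⁻¹ • (v : E)) z := by
    refine AnalyticAt.smul (AnalyticAt.inv ?_ (sub_ne_zero.2 hμ)) analyticAt_const
    fun_prop
  obtain ⟨ε, h0, h1, h2, h3, h4, h5⟩ :=
    ((eventually_mem_nhdsWithin (a := (0 : ℝ)) (s := Set.Ioi 0)).and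
    ((circleIntegral_eq_zero_of_analyticAt han).and ((eventually_sphere_of_punctured h).and
    ((eventually_rieszIntegral_eq h).and ((circleIntegrable_res h).and
    (eventually_sphere_of_punctured (hμz.filter_mono nhdsWithin_le_nhds))))))).exists
  have h6 := map_circleIntegral (ContinuousLinearMap.apply ℂ E (v : E)) h4
  simp only [ContinuousLinearMap.apply_apply] at h6
  rw [circleIntegral.integral_congr (g := fun ζ : ℂ => (μ - ζ)⁻¹ • (v : E)) (le_of_lt h0)
    (fun ζ hζ => hres ζ (h2 ζ hζ) (sub_ne_zero.1 (h5 ζ hζ))), h1] at h6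
  refine hv0 ?_
  rw [← hPv v v.2, hP, ← h3, rieszIntegral]
  simp [h6]

/-- The multiplicity at an isolated point of the spectrum with a Riesz projection of finite
rank. -/
theorem opMult_eq_finrank (h : ∀ᶠ ζ in 𝓝[≠] z, ζ ∈ rho T)
    (hf : FiniteDimensional ℂ (LinearMap.range (rieszProj T z : E →ₗ[ℂ] E))) :
    opMult z T =
      ((Module.finrank ℂ (LinearMap.range (rieszProj T z : E →ₗ[ℂ] E)) : ℤ) : WithTop ℤ) := by
  by_cases hz : z ∈ rho T
  · rw [opMult, if_pos hz, rieszProj_eq_zero_of_mem_rho hz]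
    have : LinearMap.range ((0 : E →L[ℂ] E) : E →ₗ[ℂ] E) = ⊥ := LinearMap.range_zero
    rw [this, finrank_bot]
    rfl
  · rw [opMult, if_neg hz, if_pos ⟨hz, h, exists_eigenvector h hz hf, hf⟩]

theorem opMult_eq_top (h : ¬ ∀ᶠ ζ in 𝓝[≠] z, ζ ∈ rho T) : opMult z T = ⊤ := by
  rw [opMult, if_neg, if_neg]
  · exact fun h' => h h'.2.1
  · exact fun hz => h (nhdsWithin_le_nhds ((isOpen_rho T).mem_nhds hz))

theorem eventually_mem_rho_of_mem_phiTilde (h : z ∈ phiTilde T) : ∀ᶠ ζ in 𝓝[≠] z, ζ ∈ rho T := by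
  by_cases hz : z ∈ rho T
  · exact nhdsWithin_le_nhds ((isOpen_rho T).mem_nhds hz)
  · by_contra h'
    exact h ⟨hz, fun h2 => h' h2.2.1⟩

theorem finiteDimensional_range_rieszProj (h : z ∈ phiTilde T) :
    FiniteDimensional ℂ (LinearMap.range (rieszProj T z : E →ₗ[ℂ] E)) := by
  by_cases hz : z ∈ rho T
  · rw [rieszProj_eq_zero_of_mem_rho hz]
    have : LinearMap.range ((0 : E →L[ℂ] E) : E →ₗ[ℂ] E) = ⊥ := LinearMap.range_zero
    rw [this]
    infer_instance
  · by_contra h'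
    exact h ⟨hz, fun h2 => h' h2.2.2.2⟩

end Riesz

/-! ### Products of closed and bounded operators -/

section UnboundedProducts

variable {E F G : Type*}
  [NormedAddCommGroup E] [NormedSpace ℂ E]
  [NormedAddCommGroup F] [NormedSpace ℂ F]
  [NormedAddCommGroup G] [NormedSpace ℂ G]

theorem mem_prodOp_domain {S : F →ₗ.[ℂ] G} {T : E →ₗ.[ℂ] F} {x : E} :
    x ∈ (prodOp S T).domain ↔ ∃ h : x ∈ T.domain, T ⟨x, h⟩ ∈ S.domain := by
  constructor
  · rintro ⟨⟨y, hy, rfl⟩, h⟩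
    exact ⟨h, hy⟩
  · rintro ⟨h, h'⟩
    exact ⟨⟨⟨x, h⟩, h', rfl⟩, h⟩

theorem HasBddExt.bddExt_apply {S : E →ₗ.[ℂ] F} (h : HasBddExt S) (x : S.domain) :
    bddExt S x = S x := by
  rw [bddExt, dif_pos h]
  exact h.choose_spec x

theorem clm_ext_of_dense {V : Submodule ℂ E} (hV : Dense (V : Set E)) {T T' : E →L[ℂ] F}
    (h : ∀ x ∈ V, T x = T' x) : T = T' :=
  ContinuousLinearMap.ext fun x => congrFun (Continuous.ext_on hV T.continuous T'.continuous h) x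

theorem LinearPMap.eq_of_tendsto {A : E →ₗ.[ℂ] F} (hA : A.IsClosed) {u : ℕ → E}
    {hu : ∀ n, u n ∈ A.domain} {x : E} {y : F} (hx : Tendsto u atTop (𝓝 x))
    (hy : Tendsto (fun n => A ⟨u n, hu n⟩) atTop (𝓝 y)) : ∃ h : x ∈ A.domain, A ⟨x, h⟩ = y := by
  have h1 : (x, y) ∈ (A.graph : Set (E × F)) := by
    refine IsClosed.mem_of_tendsto hA (hx.prodMk_nhds hy) (Eventually.of_forall fun n => ?_)
    exact A.mem_graph ⟨u n, hu n⟩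
  obtain ⟨a, rfl, rfl⟩ := A.mem_graph_iff.1 h1
  exact ⟨a.2, rfl⟩

/-- The product of a closed operator and a bounded operator with range in its domain is bounded. -/
theorem exists_clm_eq_of_isClosed [CompleteSpace E] [CompleteSpace G] {A : F →ₗ.[ℂ] G}
    (hA : A.IsClosed) (R : E →L[ℂ] F) (hR : ∀ x, R x ∈ A.domain) :
    ∃ M : E →L[ℂ] G, ∀ x, M x = A ⟨R x, hR x⟩ := by
  let g : E →ₗ[ℂ] G := A.toFun ∘ₗ (R : E →ₗ[ℂ] F).codRestrict A.domain hR
  have hg : Continuous g := by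
    refine g.continuous_of_seq_closed_graph fun u x y hu hy => ?_
    obtain ⟨h1, h2⟩ := LinearPMap.eq_of_tendsto hA (u := fun n => R (u n)) (hu := fun n => hR _)
      ((R.continuous.tendsto x).comp hu) hy
    exact h2.symm
  exact ⟨⟨g, hg⟩, fun x => rfl⟩

end UnboundedProducts

/-! ### Kato's factorized perturbations and the perturbed operator -/

section Adjoint

variable {H K : Type*}
  [NormedAddCommGroup H] [InnerProductSpace ℂ H] [CompleteSpace H]
  [NormedAddCommGroup K] [InnerProductSpace ℂ K] [CompleteSpace K]

/-- The adjoint of a closed operator has a dense domain. -/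
theorem dense_adjoint_domain {B : H →ₗ.[ℂ] K} (hc : B.IsClosed) :
    Dense (B.adjoint.domain : Set K) := by
  rw [Submodule.dense_iff_topologicalClosure_eq_top, Submodule.topologicalClosure_eq_top_iff,
    Submodule.eq_bot_iff]
  intro y hy
  let g : Submodule ℂ (WithLp 2 (H × K)) :=
    B.graph.comap ((WithLp.prodContinuousLinearEquiv 2 ℂ H K).toLinearEquiv : _ →ₗ[ℂ] H × K)
  have hg : IsClosed (g : Set (WithLp 2 (H × K))) :=
    IsClosed.preimage (WithLp.prodContinuousLinearEquiv 2 ℂ H K).continuous hc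
  -- If y is orthogonal to dom B*, then (0, y) lies in the double orthogonal complement of the
  -- closed graph, hence in the graph, and y = B 0 = 0. The graph sits in the Hilbert sum so that
  -- this complement makes sense.
  have hmem : WithLp.toLp 2 ((0 : H), y) ∈ gᗮᗮ := by
    rw [Submodule.mem_orthogonal]
    intro u hu
    rw [Submodule.mem_orthogonal] at hu
    have h1 : ∀ x : B.domain, inner ℂ (x : H) u.fst + inner ℂ (B x) u.snd = 0 := fun x =>
      hu (WithLp.toLp 2 ((x : H), B x)) (B.mem_graph x)
    have h2 : u.snd ∈ B.adjoint.domain := by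
      refine LinearPMap.mem_adjoint_domain_of_exists _ ⟨-u.fst, fun x => ?_⟩
      have h3 := congrArg (starRingEnd ℂ) (h1 x)
      simp only [map_add, inner_conj_symm, map_zero] at h3
      rw [inner_neg_left, neg_eq_iff_add_eq_zero]
      exact h3
    rw [WithLp.prod_inner_apply]
    change inner ℂ u.fst (0 : H) + inner ℂ u.snd y = 0
    rw [inner_zero_right, zero_add]
    exact hy _ h2
  rw [Submodule.orthogonal_orthogonal_eq_closure, hg.submodule_topologicalClosure_eq] at hmem
  obtain ⟨x, hx, hy⟩ := B.mem_graph_iff.1 hmem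
  have hx0 : x = 0 := Subtype.ext hx
  rw [hx0, LinearPMap.map_zero] at hy
  exact hy.symm

theorem adjoint_res_mem_domain {T : H →ₗ.[ℂ] H} {z : ℂ} (hz : z ∈ rho T) (x : H) :
    ContinuousLinearMap.adjoint (res T z) x ∈ T.adjoint.domain := by
  refine LinearPMap.mem_adjoint_domain_of_exists _
    ⟨x + (starRingEnd ℂ z) • ContinuousLinearMap.adjoint (res T z) x, fun u => ?_⟩
  have h := (isResolventAt_res hz).2 u
  have h1 : inner ℂ (ContinuousLinearMap.adjoint (res T z) x) (T u - z • (u : H)) =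
      inner ℂ x (u : H) := by
    rw [ContinuousLinearMap.adjoint_inner_left, h]
  rw [inner_sub_right, sub_eq_iff_eq_add, inner_smul_right] at h1
  rw [h1, inner_add_left, inner_smul_left, Complex.conj_conj]

/-- The hypotheses of Kato's theory of perturbations in factorized form. -/
structure IsKatoTriple (H₀ : H →ₗ.[ℂ] H) (A B : H →ₗ.[ℂ] K) : Prop where
  closed_left : A.IsClosed
  dense_right : Dense (B.domain : Set H)
  closed_right : B.IsClosed
  domain_le : H₀.domain ≤ A.domain
  adjoint_domain_le : H₀.adjoint.domain ≤ B.domain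
  exists_hasBddExt : ∃ z ∈ rho H₀, HasBddExt (sandwich H₀ A B z)

/-- `A R₀(z)` as a bounded operator. -/
def leftFactor (H₀ : H →ₗ.[ℂ] H) (A : H →ₗ.[ℂ] K) (z : ℂ) : H →L[ℂ] K :=
  bddExt (prodOp A (ofBdd (res H₀ z)))

/-- The closure of `R₀(z) B*` as a bounded operator. -/
def rightFactor (H₀ : H →ₗ.[ℂ] H) (B : H →ₗ.[ℂ] K) (z : ℂ) : K →L[ℂ] H :=
  bddExt (prodOp (ofBdd (res H₀ z)) B.adjoint)

variable {H₀ : H →ₗ.[ℂ] H} {A B : H →ₗ.[ℂ] K} {z w : ℂ}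

namespace IsKatoTriple

theorem res_mem (h : IsKatoTriple H₀ A B) (hz : z ∈ rho H₀) (x : H) : res H₀ z x ∈ A.domain :=
  h.domain_le ((isResolventAt_res hz).mem_domain x)

theorem leftFactor_apply (h : IsKatoTriple H₀ A B) (hz : z ∈ rho H₀) (x : H) :
    leftFactor H₀ A z x = A ⟨res H₀ z x, h.res_mem hz x⟩ := by
  have hmem : ∀ x, x ∈ (prodOp A (ofBdd (res H₀ z))).domain := fun x =>
    mem_prodOp_domain.2 ⟨Submodule.mem_top, h.res_mem hz x⟩
  obtain ⟨M, hM⟩ := exists_clm_eq_of_isClosed h.closed_left (res H₀ z) (h.res_mem hz)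
  have hb : HasBddExt (prodOp A (ofBdd (res H₀ z))) := ⟨M, fun x => hM x⟩
  exact hb.bddExt_apply ⟨x, hmem x⟩

/-- The operator B R₀(z)* is everywhere defined, because R₀(z)* maps into dom H₀*, and bounded by
the closed graph theorem. Its adjoint is the bounded extension of R₀(z) B*. -/
theorem rightFactor_apply (h : IsKatoTriple H₀ A B) (hz : z ∈ rho H₀) (y : B.adjoint.domain) :
    rightFactor H₀ B z y = res H₀ z (B.adjoint y) := by
  have hmem : (y : K) ∈ (prodOp (ofBdd (res H₀ z)) B.adjoint).domain :=
    mem_prodOp_domain.2 ⟨y.2, Submodule.mem_top⟩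
  obtain ⟨M, hM⟩ := exists_clm_eq_of_isClosed h.closed_right
    (ContinuousLinearMap.adjoint (res H₀ z))
    (fun x => h.adjoint_domain_le (adjoint_res_mem_domain hz x))
  have key : ∀ y : B.adjoint.domain,
      ContinuousLinearMap.adjoint M y = res H₀ z (B.adjoint y) := by
    intro y
    refine ext_inner_left ℂ fun x => ?_
    rw [ContinuousLinearMap.adjoint_inner_right, hM,
      ← ContinuousLinearMap.adjoint_inner_left (res H₀ z)]
    exact (LinearPMap.adjoint_isFormalAdjoint h.dense_right).symm
      ⟨ContinuousLinearMap.adjoint (res H₀ z) x, _⟩ y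
  have hb : HasBddExt (prodOp (ofBdd (res H₀ z)) B.adjoint) := by
    refine ⟨ContinuousLinearMap.adjoint M, fun y => ?_⟩
    obtain ⟨h1, h2⟩ := mem_prodOp_domain.1 y.2
    exact key ⟨y, h1⟩
  exact hb.bddExt_apply ⟨y, hmem⟩

theorem dense (h : IsKatoTriple H₀ A B) : Dense (B.adjoint.domain : Set K) :=
  dense_adjoint_domain h.closed_right

theorem leftFactor_eq (h : IsKatoTriple H₀ A B) (hz : z ∈ rho H₀) (hw : w ∈ rho H₀) :
    leftFactor H₀ A z = leftFactor H₀ A w + (z - w) • leftFactor H₀ A w ∘L res H₀ z := by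
  ext x
  rw [h.leftFactor_apply hz]
  simp only [add_apply, smul_apply, ContinuousLinearMap.comp_apply]
  rw [h.leftFactor_apply hw, h.leftFactor_apply hw, ← LinearPMap.map_smul, ← LinearPMap.map_add]
  congr 1
  refine Subtype.ext ?_
  have h1 := congrArg (fun S : H →L[ℂ] H => S x) (res_sub_res hz hw)
  rw [(res_comm hz hw).eq] at h1
  exact sub_eq_iff_eq_add'.1 h1

theorem rightFactor_eq (h : IsKatoTriple H₀ A B) (hz : z ∈ rho H₀) (hw : w ∈ rho H₀) :
    rightFactor H₀ B z = rightFactor H₀ B w + (z - w) • res H₀ z ∘L rightFactor H₀ B w := by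
  refine clm_ext_of_dense h.dense fun y hy => ?_
  have h1 := congrArg (fun S : H →L[ℂ] H => S (B.adjoint ⟨y, hy⟩)) (res_sub_res hz hw)
  simp only [add_apply, smul_apply, ContinuousLinearMap.comp_apply]
  rw [h.rightFactor_apply hz ⟨y, hy⟩, h.rightFactor_apply hw ⟨y, hy⟩]
  exact sub_eq_iff_eq_add'.1 h1

theorem mem_sandwich_domain (h : IsKatoTriple H₀ A B) (hz : z ∈ rho H₀) (y : B.adjoint.domain) :
    (y : K) ∈ (sandwich H₀ A B z).domain :=
  mem_prodOp_domain.2 ⟨mem_prodOp_domain.2 ⟨y.2, Submodule.mem_top⟩, h.res_mem hz _⟩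

/-- One point w suffices: by the resolvent identity, A R₀ B* changes from w to z by a product of two
bounded factors. -/
theorem hasBddExt_sandwich (h : IsKatoTriple H₀ A B) (hz : z ∈ rho H₀) :
    HasBddExt (sandwich H₀ A B z) := by
  obtain ⟨w, hw, M, hM⟩ := h.exists_hasBddExt
  refine ⟨M + (z - w) • leftFactor H₀ A z ∘L rightFactor H₀ B w, fun ⟨y, hy⟩ => ?_⟩
  have hyB : y ∈ B.adjoint.domain := by
    obtain ⟨h', -⟩ := mem_prodOp_domain.1 hy
    exact (mem_prodOp_domain.1 h').1
  have h1 : M y = A ⟨res H₀ w (B.adjoint ⟨y, hyB⟩), h.res_mem hw _⟩ :=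
    hM ⟨y, h.mem_sandwich_domain hw ⟨y, hyB⟩⟩
  simp only [add_apply, smul_apply, ContinuousLinearMap.comp_apply]
  rw [h.rightFactor_apply hw ⟨y, hyB⟩, h.leftFactor_apply hz, h1, ← LinearPMap.map_smul,
    ← LinearPMap.map_add]
  refine congrArg A (Subtype.ext ?_)
  have h2 := congrArg (fun S : H →L[ℂ] H => S (B.adjoint ⟨y, hyB⟩)) (res_sub_res hz hw)
  exact (sub_eq_iff_eq_add'.1 h2).symm

theorem bsKernel_apply (h : IsKatoTriple H₀ A B) (hz : z ∈ rho H₀) (y : B.adjoint.domain) :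
    bsKernel H₀ A B z y = -A ⟨res H₀ z (B.adjoint y), h.res_mem hz _⟩ := by
  rw [bsKernel]
  exact congrArg (- ·) ((h.hasBddExt_sandwich hz).bddExt_apply ⟨y, h.mem_sandwich_domain hz y⟩)

theorem bsKernel_eq (h : IsKatoTriple H₀ A B) (hz : z ∈ rho H₀) (hw : w ∈ rho H₀) :
    bsKernel H₀ A B z =
      bsKernel H₀ A B w - (z - w) • leftFactor H₀ A z ∘L rightFactor H₀ B w := by
  refine clm_ext_of_dense h.dense fun y hy => ?_
  have h2 := congrArg (fun S : H →L[ℂ] H => S (B.adjoint ⟨y, hy⟩)) (res_sub_res hz hw)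
  simp only [sub_apply, smul_apply, ContinuousLinearMap.comp_apply]
  rw [h.bsKernel_apply hz ⟨y, hy⟩, h.bsKernel_apply hw ⟨y, hy⟩, h.rightFactor_apply hw ⟨y, hy⟩,
    h.leftFactor_apply hz, ← LinearPMap.map_smul, ← neg_add', ← LinearPMap.map_add]
  refine congrArg (- ·) (congrArg A (Subtype.ext ?_))
  exact sub_eq_iff_eq_add'.1 h2

/-- On dom B* this is the definition of K; since A is closed, it survives the passage to the closure
of R₀(z) B*. -/
theorem exists_apply_rightFactor (h : IsKatoTriple H₀ A B) (hz : z ∈ rho H₀) (y : K) :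
    ∃ h' : rightFactor H₀ B z y ∈ A.domain,
      A ⟨rightFactor H₀ B z y, h'⟩ = -bsKernel H₀ A B z y := by
  obtain ⟨u, hu, hlim⟩ := mem_closure_iff_seq_limit.1 (h.dense y)
  refine LinearPMap.eq_of_tendsto h.closed_left (u := fun n => rightFactor H₀ B z (u n))
    (hu := fun n => ?_) (((rightFactor H₀ B z).continuous.tendsto y).comp hlim) ?_
  · rw [h.rightFactor_apply hz ⟨u n, hu n⟩]
    exact h.res_mem hz _
  · refine ((((bsKernel H₀ A B z).continuous.tendsto y).comp hlim).neg).congr fun n => ?_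
    simp only [Function.comp_apply]
    rw [h.bsKernel_apply hz ⟨u n, hu n⟩, neg_neg]
    exact congrArg A (Subtype.ext (h.rightFactor_apply hz ⟨u n, hu n⟩).symm)

theorem pertRes_eq : pertRes H₀ A B z = res H₀ z - rightFactor H₀ B z ∘L
    (Ring.inverse (1 - bsKernel H₀ A B z)) ∘L leftFactor H₀ A z := rfl

/-- The resolvent identity for the perturbed resolvents. -/
theorem pertRes_sub_pertRes (h : IsKatoTriple H₀ A B) (hz : z ∈ rho H₀) (hw : w ∈ rho H₀)
    (hz' : IsUnit (1 - bsKernel H₀ A B z)) (hw' : IsUnit (1 - bsKernel H₀ A B w)) :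
    pertRes H₀ A B z - pertRes H₀ A B w = (z - w) • (pertRes H₀ A B z * pertRes H₀ A B w) := by
  set R := res H₀ z
  set R' := res H₀ w
  set J := Ring.inverse (1 - bsKernel H₀ A B z) with hJ
  set J' := Ring.inverse (1 - bsKernel H₀ A B w) with hJ'
  set Γ := rightFactor H₀ B z
  set Γ' := rightFactor H₀ B w
  set Λ := leftFactor H₀ A z
  set Λ' := leftFactor H₀ A w
  have e1 : ∀ x, (z - w) • R (R' x) = R x - R' x := fun x =>
    (congrArg (fun S : H →L[ℂ] H => S x) (res_sub_res hz hw)).symm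
  have e2 : ∀ y, (z - w) • R (Γ' y) = Γ y - Γ' y := fun y =>
    eq_sub_iff_add_eq'.2 (congrArg (fun S : K →L[ℂ] H => S y) (h.rightFactor_eq hz hw)).symm
  have e3 : ∀ x, (z - w) • Λ (R' x) = Λ x - Λ' x := fun x => by
    have := (congrArg (fun S : H →L[ℂ] K => S x) (h.leftFactor_eq hw hz))
    change Λ' x = Λ x + (w - z) • Λ (R' x) at this
    rw [this, ← neg_sub w z, neg_smul]; abel
  have e4 : ∀ y, (z - w) • Λ (Γ' y) = bsKernel H₀ A B w y - bsKernel H₀ A B z y := fun y => by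
    have := (congrArg (fun S : K →L[ℂ] K => S y) (h.bsKernel_eq hz hw))
    change _ = bsKernel H₀ A B w y - (z - w) • Λ (Γ' y) at this
    rw [this]; abel
  have e5 : ∀ y, J (bsKernel H₀ A B w (J' y) - bsKernel H₀ A B z (J' y)) = J' y - J y := by
    intro y
    have h1 : J ((1 - bsKernel H₀ A B z) (J' y)) = J' y :=
      congrArg (fun S : K →L[ℂ] K => S (J' y)) (Ring.inverse_mul_cancel _ hz')
    have h2 : (1 - bsKernel H₀ A B w) (J' y) = y :=
      congrArg (fun S : K →L[ℂ] K => S y) (Ring.mul_inverse_cancel _ hw')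
    have h3 : bsKernel H₀ A B w (J' y) - bsKernel H₀ A B z (J' y) =
        (1 - bsKernel H₀ A B z) (J' y) - (1 - bsKernel H₀ A B w) (J' y) := by
      simp only [sub_apply, one_apply_eq_self]; abel
    rw [h3, h2, map_sub, h1]
  ext x
  change R x - Γ (J (Λ x)) - (R' x - Γ' (J' (Λ' x))) =
    (z - w) • (R (R' x - Γ' (J' (Λ' x))) - Γ (J (Λ (R' x - Γ' (J' (Λ' x))))))
  have e6 : (z - w) • (R (R' x - Γ' (J' (Λ' x))) - Γ (J (Λ (R' x - Γ' (J' (Λ' x)))))) =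
      ((z - w) • R (R' x) - (z - w) • R (Γ' (J' (Λ' x)))) -
        (Γ (J ((z - w) • Λ (R' x))) - Γ (J ((z - w) • Λ (Γ' (J' (Λ' x)))))) := by
    simp only [map_sub, map_smul, smul_sub]
  rw [e6, e1, e2, e3, e4, e5]
  simp only [map_sub]
  abel

/-- If R(z) x = 0, then R₀(z) x is the right factor applied to y = (1 - K)⁻¹ A R₀(z) x. Applying A
gives (1 - K) y = -K y, so y = 0, R₀(z) x = 0 and x = 0. -/
theorem pertRes_injective (h : IsKatoTriple H₀ A B) (hz : z ∈ rho H₀)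
    (hz' : IsUnit (1 - bsKernel H₀ A B z)) {x : H} (hx : pertRes H₀ A B z x = 0) : x = 0 := by
  set J := Ring.inverse (1 - bsKernel H₀ A B z) with hJ
  set y := J (leftFactor H₀ A z x) with hy
  have h1 : res H₀ z x = rightFactor H₀ B z y := sub_eq_zero.1 hx
  obtain ⟨h2, h3⟩ := h.exists_apply_rightFactor hz y
  have h4 : leftFactor H₀ A z x = -bsKernel H₀ A B z y := by
    rw [h.leftFactor_apply hz, ← h3]
    exact congrArg A (Subtype.ext h1)
  have h5 : (1 - bsKernel H₀ A B z) y = leftFactor H₀ A z x :=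
    congrArg (fun S : K →L[ℂ] K => S (leftFactor H₀ A z x)) (Ring.mul_inverse_cancel _ hz')
  have h6 : y = 0 := by
    rw [h4, sub_apply, one_apply_eq_self, sub_eq_iff_eq_add, neg_add_cancel] at h5
    exact h5
  by_contra hne
  refine (isResolventAt_res hz).apply_ne_zero hne ?_
  rw [h1, h6, map_zero]

theorem isResolventAt_pertOp_self (h : IsKatoTriple H₀ A B) (hw : w ∈ rho H₀)
    (hw' : IsUnit (1 - bsKernel H₀ A B w)) :
    IsResolventAt (pertOp H₀ A B w) w (pertRes H₀ A B w) := by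
  set R := pertRes H₀ A B w with hR
  have hker : (ofBdd R).toFun.ker = ⊥ := by
    rw [LinearMap.ker_eq_bot']
    intro x hx
    exact Subtype.ext (h.pertRes_injective hw hw' hx)
  have hmem : ∀ x, R x ∈ (ofBdd R).inverse.domain := fun x => by
    rw [LinearPMap.inverse_domain]
    exact ⟨⟨x, Submodule.mem_top⟩, rfl⟩
  have hval : ∀ x, pertOp H₀ A B w ⟨R x, hmem x⟩ = w • R x + x := fun x => by
    have h1 : (ofBdd R).inverse ⟨R x, hmem x⟩ = x :=
      LinearPMap.inverse_apply_eq hker (x := ⟨x, Submodule.mem_top⟩) rfl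
    exact congrArg (w • R x + ·) h1
  refine ⟨fun x => ⟨hmem x, ?_⟩, fun ⟨x, hx⟩ => ?_⟩
  · rw [hval]; abel
  · have hx' : x ∈ (ofBdd R).inverse.domain := hx
    rw [LinearPMap.inverse_domain] at hx'
    obtain ⟨⟨y, hy'⟩, hy⟩ := hx'
    have hy : R y = x := hy
    subst hy
    change R (pertOp H₀ A B w ⟨R y, hmem y⟩ - w • R y) = R y
    rw [hval]; congr 1; abel

theorem isResolventAt_pertOp (h : IsKatoTriple H₀ A B) (hz : z ∈ rho H₀) (hw : w ∈ rho H₀)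
    (hz' : IsUnit (1 - bsKernel H₀ A B z)) (hw' : IsUnit (1 - bsKernel H₀ A B w)) :
    IsResolventAt (pertOp H₀ A B w) z (pertRes H₀ A B z) := by
  refine (h.isResolventAt_pertOp_self hw hw').of_identity ?_
    (h.pertRes_sub_pertRes hz hw hz' hw')
  have h1 := h.pertRes_sub_pertRes hw hz hw' hz'
  rw [← neg_sub, h1, ← neg_smul, neg_sub]

/-- By the Fredholm alternative, failure yields K(z) y = y with y ≠ 0. The vector x obtained by
applying the right factor at z to y satisfies A x = -y, so x ≠ 0, and (z - w) R(w) x = x. This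
contradicts the invertibility of 1 - (z - w) R(w) for z in ρ(H). -/
theorem isUnit_of_mem_rho_pertOp (h : IsKatoTriple H₀ A B) (hz : z ∈ rho H₀) (hw : w ∈ rho H₀)
    (hc : IsCompactOperator (bsKernel H₀ A B z)) (hw' : IsUnit (1 - bsKernel H₀ A B w))
    (hzH : z ∈ rho (pertOp H₀ A B w)) : IsUnit (1 - bsKernel H₀ A B z) := by
  rcases hc.hasEigenvalue_or_mem_resolventSet (one_ne_zero (α := ℂ)) with h1 | h1
  · exfalso
    obtain ⟨y, hy⟩ := h1.exists_hasEigenvector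
    have hKy : bsKernel H₀ A B z y = y := by simpa using hy.apply_eq_smul
    set x := rightFactor H₀ B z y with hx
    have hx0 : x ≠ 0 := by
      intro h0
      obtain ⟨h2, h3⟩ := h.exists_apply_rightFactor hz y
      have h4 : (⟨rightFactor H₀ B z y, h2⟩ : A.domain) = 0 := Subtype.ext h0
      rw [h4, LinearPMap.map_zero, hKy, eq_comm, neg_eq_zero] at h3
      exact hy.2 h3
    have hrw : res (pertOp H₀ A B w) w = pertRes H₀ A B w :=
      (h.isResolventAt_pertOp_self hw hw').res_eq
    have hu := mul_one_sub_smul_res hzH (h.isResolventAt_pertOp_self hw hw').mem_rho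
    rw [hrw] at hu
    have e2 : (z - w) • res H₀ w x = x - rightFactor H₀ B w y := by
      have := congrArg (fun S : K →L[ℂ] H => S y) (h.rightFactor_eq hw hz)
      change rightFactor H₀ B w y = x + (w - z) • res H₀ w x at this
      rw [this, ← neg_sub w z, neg_smul]; abel
    have e4 : (z - w) • leftFactor H₀ A w x = -((1 - bsKernel H₀ A B w) y) := by
      have := congrArg (fun S : K →L[ℂ] K => S y) (h.bsKernel_eq hw hz)
      change bsKernel H₀ A B w y = bsKernel H₀ A B z y - (w - z) • leftFactor H₀ A w x at this
      rw [sub_apply, one_apply_eq_self, this, hKy, ← neg_sub w z, neg_smul]; abel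
    have e5 : Ring.inverse (1 - bsKernel H₀ A B w) ((1 - bsKernel H₀ A B w) y) = y :=
      congrArg (fun S : K →L[ℂ] K => S y) (Ring.inverse_mul_cancel _ hw')
    have e6 : (z - w) • pertRes H₀ A B w x = x := by
      change (z - w) • (res H₀ w x - rightFactor H₀ B w
        (Ring.inverse (1 - bsKernel H₀ A B w) (leftFactor H₀ A w x))) = x
      rw [smul_sub, e2, ← map_smul, ← map_smul, e4, map_neg, map_neg, e5]; abel
    have h2 := congrArg (fun S : H →L[ℂ] H => S x) hu
    change (1 + (z - w) • res (pertOp H₀ A B w) z) (x - (z - w) • pertRes H₀ A B w x) = x at h2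
    rw [e6, sub_self, map_zero] at h2
    exact hx0 h2.symm
  · rw [spectrum.mem_resolventSet_iff, map_one] at h1
    exact h1

end IsKatoTriple
end Adjoint

/-! ### Analyticity of the determinant along a curve of kernels -/

section LocalFactorization

variable {K : Type*} [NormedAddCommGroup K] [InnerProductSpace ℂ K] [CompleteSpace K]
  {W : Type*} [NormedAddCommGroup W] [NormedSpace ℂ W] [FiniteDimensional ℂ W]

theorem schattenSum_comp_le {p : ℕ} (hp : 1 ≤ p) (Y : W →L[ℂ] K) (S : K →L[ℂ] W) :
    schattenSum p (Y ∘L S) ≤ Module.finrank ℂ W * ‖Y ∘L S‖ₑ ^ p := by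
  refine schattenSum_lt_top_of_rank_le p hp _ ?_
  have h1 : LinearMap.range ((Y ∘L S : K →L[ℂ] K) : K →ₗ[ℂ] K) ≤ LinearMap.range (Y : W →ₗ[ℂ] K) := by
    rintro _ ⟨x, rfl⟩
    exact ⟨S x, rfl⟩
  refine (Submodule.rank_mono h1).trans ?_
  rw [← Module.finrank_eq_rank]
  exact_mod_cast LinearMap.finrank_range_le _

theorem schattenSum_comp_lt_top {p : ℕ} (hp : 1 ≤ p) (Y : W →L[ℂ] K) (S : K →L[ℂ] W) :
    schattenSum p (Y ∘L S) < ∞ :=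
  (schattenSum_comp_le hp Y S).trans_lt
    (ENNReal.mul_lt_top (by simp) (ENNReal.pow_lt_top enorm_lt_top))

variable {Y : W →L[ℂ] K} {S : ℂ → K →L[ℂ] W} {G k : ℂ → K →L[ℂ] K} {z : ℂ} {p : ℕ}

theorem schattenSum_lt_top_of_eq_add (hp : 1 ≤ p) (hk : k z = G z + Y ∘L S z)
    (hkp : schattenSum p (k z) < ∞) : schattenSum p (G z) < ∞ := by
  have h : G z = k z + -(Y ∘L S z) := by rw [hk]; abel
  rw [h]
  refine schattenSum_add_lt_top hkp ?_
  rw [schattenSum_neg]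
  exact schattenSum_comp_lt_top hp _ _

/-- Removing Y S from k preserves 𝓑_p-differentiability: through a finite-dimensional W, operator
norm convergence of the difference quotients of S controls the Schatten sums. -/
theorem differentiableAt_logTailExt_of_eq_add (hp : 1 ≤ p)
    (hk : ∀ᶠ ζ in 𝓝 z, k ζ = G ζ + Y ∘L S ζ) (hG : ‖G z‖ < 1 / 4)
    (hS : DifferentiableAt ℂ S z) (hkp : schattenSum p (k z) < ∞) {D : K →L[ℂ] K}
    (hDp : schattenSum p D < ∞)
    (hD : Tendsto (fun ζ => schattenSum p ((ζ - z)⁻¹ • (k ζ - k z) - D)) (𝓝[≠] z) (𝓝 0)) :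
    DifferentiableAt ℂ (fun ζ => logTailExt p (G ζ)) z := by
  have hGp := schattenSum_lt_top_of_eq_add hp hk.self_of_nhds hkp
  have hS' := hasDerivAt_iff_tendsto_slope.1 hS.hasDerivAt
  set S' := deriv S z
  refine differentiableAt_logTailExt_comp hp hG hGp (D := D + -(Y ∘L S')) ?_ ?_
  · refine schattenSum_add_lt_top hDp ?_
    rw [schattenSum_neg]
    exact schattenSum_comp_lt_top hp _ _
  have h1 : Tendsto (fun ζ => ‖Y ∘L (slope S z ζ - S')‖ₑ) (𝓝[≠] z) (𝓝 0) := by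
    have h2 : Tendsto (fun ζ => Y ∘L (slope S z ζ - S')) (𝓝[≠] z) (𝓝 (Y ∘L (S' - S'))) :=
      ((ContinuousLinearMap.compL ℂ K W K Y).continuous.tendsto _).comp (hS'.sub_const S')
    rw [sub_self, ContinuousLinearMap.comp_zero] at h2
    simpa [enorm_eq_nnnorm] using h2.enorm
  have h2 : Tendsto (fun ζ => schattenSum p (Y ∘L (slope S z ζ - S'))) (𝓝[≠] z) (𝓝 0) := by
    refine tendsto_of_tendsto_of_tendsto_of_le_of_le tendsto_const_nhds ?_ (fun _ => zero_le)
      (fun ζ => schattenSum_comp_le hp _ _)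
    have h3 := ENNReal.Tendsto.const_mul (a := (Module.finrank ℂ W : ℝ≥0∞))
      (((ENNReal.continuous_pow p).tendsto _).comp h1) (Or.inr (by simp))
    rw [zero_pow (by omega), mul_zero] at h3
    exact h3
  have h3 : Tendsto (fun ζ => 2 * 2 ^ p * (schattenSum p ((ζ - z)⁻¹ • (k ζ - k z) - D) +
      schattenSum p (Y ∘L (slope S z ζ - S')))) (𝓝[≠] z) (𝓝 0) := by
    have := ENNReal.Tendsto.const_mul (a := (2 * 2 ^ p : ℝ≥0∞)) (hD.add h2)
      (Or.inr (by finiteness))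
    simpa using this
  refine tendsto_of_tendsto_of_tendsto_of_le_of_le' tendsto_const_nhds h3
    (Eventually.of_forall fun _ => zero_le) ?_
  filter_upwards [nhdsWithin_le_nhds hk] with ζ hζ
  have h4 : (ζ - z)⁻¹ • (G ζ - G z) - (D + -(Y ∘L S')) =
      ((ζ - z)⁻¹ • (k ζ - k z) - D) - Y ∘L (slope S z ζ - S') := by
    rw [hζ, hk.self_of_nhds, slope_def_module, ContinuousLinearMap.comp_sub,
      ContinuousLinearMap.comp_smul, ContinuousLinearMap.comp_sub]
    simp only [smul_sub, smul_add]
    abel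
  rw [h4]
  exact schattenSum_sub_le p _ _

theorem differentiableAt_traceCorrection (hG : DifferentiableAt ℂ G z)
    (hS : DifferentiableAt ℂ S z) :
    DifferentiableAt ℂ (fun ζ => traceCorrection p Y (S ζ) (G ζ)) z := by
  unfold traceCorrection
  refine DifferentiableAt.fun_sum fun j _ => DifferentiableAt.const_mul
    (DifferentiableAt.fun_sum fun i _ => ?_) _
  refine (trCLM W).differentiableAt.comp z ?_
  refine hS.clm_comp ?_
  refine DifferentiableAt.clm_comp ?_ (differentiableAt_const _)
  have h1 : DifferentiableAt ℂ (fun ζ => G ζ ^ (j - 1 - i)) z := hG.fun_pow _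
  have h2 : DifferentiableAt ℂ (fun ζ => (G ζ + Y ∘L S ζ) ^ i) z :=
    (hG.add ((differentiableAt_const Y).clm_comp hS)).fun_pow _
  exact h1.clm_comp h2

theorem detP_eq_schurDet_mul_exp (hp : 1 ≤ p) (hk : k z = G z + Y ∘L S z) (hG : ‖G z‖ < 1 / 4)
    (hkp : schattenSum p (k z) < ∞) : detP p (k z) = schurDet Y (S z) (G z) *
      Complex.exp (traceCorrection p Y (S z) (G z) - logTailExt p (G z)) := by
  rw [hk, detP_eq hp Y (S z) hG (schattenSum_lt_top_of_eq_add hp hk hkp), mul_assoc,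
    ← Complex.exp_add, sub_eq_add_neg]

theorem HasDerivAt.clm_inverse_one_sub {G' : K →L[ℂ] K} (hG : ‖G z‖ < 1 / 4)
    (hd : HasDerivAt G G' z) : HasDerivAt (fun ζ => Ring.inverse (1 - G ζ))
      (Ring.inverse (1 - G z) * G' * Ring.inverse (1 - G z)) z := by
  have h := HasDerivAt.clm_ringInverse (hd.const_sub 1)
    (isUnit_one_sub_of_norm_lt_one (R := K →L[ℂ] K) (hG.trans (by norm_num)))
  refine h.congr_deriv ?_
  rw [mul_neg, neg_mul, neg_neg]

theorem HasDerivAt.one_sub_comp {G' : K →L[ℂ] K} {S' : K →L[ℂ] W} (hG : ‖G z‖ < 1 / 4)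
    (hd : HasDerivAt G G' z) (hS : HasDerivAt S S' z) :
    HasDerivAt (fun ζ => 1 - S ζ ∘L Ring.inverse (1 - G ζ) ∘L Y)
      (-(S' ∘L Ring.inverse (1 - G z) ∘L Y + S z ∘L
        (Ring.inverse (1 - G z) * G' * Ring.inverse (1 - G z)) ∘L Y)) z := by
  have h1 := (HasDerivAt.clm_inverse_one_sub hG hd).clm_comp (hasDerivAt_const z Y)
  rw [ContinuousLinearMap.comp_zero, add_zero] at h1
  exact (hS.clm_comp h1).const_sub 1

theorem differentiableAt_schurDet (hG : ‖G z‖ < 1 / 4) (hd : DifferentiableAt ℂ G z)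
    (hS : DifferentiableAt ℂ S z) : DifferentiableAt ℂ (fun ζ => schurDet Y (S ζ) (G ζ)) z :=
  DifferentiableAt.comp (g := fun T : W →L[ℂ] W => LinearMap.det (T : W →ₗ[ℂ] W)) z
    differentiable_det.differentiableAt (HasDerivAt.one_sub_comp hG hd.hasDerivAt hS.hasDerivAt).differentiableAt

theorem differentiableAt_detP (hp : 1 ≤ p) (hmem : ∀ᶠ ζ in 𝓝 z, schattenSum p (k ζ) < ∞)
    (hkd : DifferentiableAt ℂ k z) {D : K →L[ℂ] K} (hDp : schattenSum p D < ∞)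
    (hD : Tendsto (fun ζ => schattenSum p ((ζ - z)⁻¹ • (k ζ - k z) - D)) (𝓝[≠] z) (𝓝 0)) :
    DifferentiableAt ℂ (fun ζ => detP p (k ζ)) z := by
  -- A fixed finite rank F with ‖k z - F‖ ≤ 1/8 is split off, so that the remainder k ζ - F stays
  -- below norm 1/4 near z and the factorization applies with constant Y and S.
  obtain ⟨F, hF, hFk⟩ := exists_finiteRank_schattenSum_sub_lt (k z) hmem.self_of_nhds
    (ε := ENNReal.ofReal (1 / 8) ^ p) (by positivity)
  have hn := norm_le_of_schattenSum_le hp (by norm_num) hFk.le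
  set V := LinearMap.range (F : K →ₗ[ℂ] K)
  set Y : V →L[ℂ] K := V.subtypeL
  set S : K →L[ℂ] V := F.codRestrict V fun x => ⟨x, rfl⟩
  have hYS : Y ∘L S = F := rfl
  have hGd : DifferentiableAt ℂ (fun ζ => k ζ - F) z := hkd.sub_const F
  have hG : ‖k z - F‖ < 1 / 4 := hn.trans_lt (by norm_num)
  have hk : ∀ ζ, k ζ = (fun ζ => k ζ - F) ζ + Y ∘L (fun _ => S) ζ := fun ζ => by
    simp only [hYS, sub_add_cancel]
  have hGn : ∀ᶠ ζ in 𝓝 z, ‖k ζ - F‖ < 1 / 4 := hGd.continuousAt.norm.eventually_lt_const hG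
  have h1 := differentiableAt_logTailExt_of_eq_add (S := fun _ => S) (G := fun ζ => k ζ - F) hp
    (Eventually.of_forall hk) hG (differentiableAt_const S) hmem.self_of_nhds hDp hD
  have h2 : DifferentiableAt ℂ (fun ζ => traceCorrection p Y S (k ζ - F)) z :=
    differentiableAt_traceCorrection (S := fun _ => S) (G := fun ζ => k ζ - F) hGd
      (differentiableAt_const S)
  have h3 : DifferentiableAt ℂ (fun ζ => schurDet Y S (k ζ - F)) z :=
    differentiableAt_schurDet (S := fun _ => S) (G := fun ζ => k ζ - F) hG hGd
      (differentiableAt_const S)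
  refine (h3.mul (h2.sub h1).cexp).congr_of_eventuallyEq ?_
  filter_upwards [hmem, hGn] with ζ h4 h5
  exact detP_eq_schurDet_mul_exp (S := fun _ => S) (G := fun ζ => k ζ - F) hp (hk ζ) h5 h4

end LocalFactorization

/-! ### Splitting the resolvent at a point of finite multiplicity -/

theorem ringInverse_eq_of_mul_eq_one {R : Type*} [Ring R] {a b : R} (h1 : a * b = 1)
    (h2 : b * a = 1) : Ring.inverse a = b :=
  Ring.inverse_unit ⟨a, b, h1, h2⟩

/-- The derivative is a perfect square. Applied to U = 1 + (ζ - w) R₀ it gives K' = -Λ U² Γ, the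
form needed to recognize d'/d in the trace computation. -/
theorem HasDerivAt.smul_one_add_smul {R : Type*} [NormedRing R] [NormedAlgebra ℂ R] {f : ℂ → R}
    {w ζ : ℂ} (hf : HasDerivAt f (f ζ * f ζ) ζ) :
    HasDerivAt (fun ζ => (ζ - w) • (1 + (ζ - w) • f ζ))
      ((1 + (ζ - w) • f ζ) * (1 + (ζ - w) • f ζ)) ζ := by
  have h1 : HasDerivAt (fun ζ : ℂ => ζ - w) 1 ζ := (hasDerivAt_id ζ).sub_const w
  refine (h1.fun_smul ((h1.fun_smul hf).const_add 1)).congr_deriv ?_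
  simp only [mul_add, add_mul, one_mul, mul_one, smul_mul_assoc, mul_smul_comm]
  module

theorem analyticAt_one_sub_smul {E : Type*} [NormedAddCommGroup E] [NormedSpace ℂ E]
    (a : E →L[ℂ] E) (w z : ℂ) : AnalyticAt ℂ (fun ζ : ℂ => 1 - (ζ - w) • a) z :=
  analyticAt_const.sub ((analyticAt_id.sub analyticAt_const).smul analyticAt_const)

section Splitting

variable {H : Type*} [NormedAddCommGroup H] [InnerProductSpace ℂ H]

/-- The operator `1 + (ζ - w) (T - ζ)⁻¹ = (T - w) (T - ζ)⁻¹`. -/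
def resQuot (T : H →ₗ.[ℂ] H) (w ζ : ℂ) : H →L[ℂ] H := 1 + (ζ - w) • res T ζ

theorem hasDerivAt_smul_resQuot [CompleteSpace H] {T : H →ₗ.[ℂ] H} {w ζ : ℂ} (hζ : ζ ∈ rho T) :
    HasDerivAt (fun ζ => (ζ - w) • resQuot T w ζ) (resQuot T w ζ * resQuot T w ζ) ζ :=
  HasDerivAt.smul_one_add_smul (R := H →L[ℂ] H) (hasDerivAt_res hζ)

/-- The splitting of `1 + (ζ - w) (T - ζ)⁻¹` at a point of finite multiplicity into an analytic part
and a meromorphic part on a finite-dimensional subspace. -/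
structure ResolventSplitting (T : H →ₗ.[ℂ] H) (w z : ℂ) where
  space : Submodule ℂ H
  finiteDimensional : FiniteDimensional ℂ space
  proj : H →L[ℂ] space
  sing : ℂ → space →L[ℂ] space
  reg : ℂ → H →L[ℂ] H
  meromorphicAt_sing : MeromorphicAt sing z
  analyticAt_reg : AnalyticAt ℂ reg z
  mem_rho : ∀ᶠ ζ in 𝓝[≠] z, ζ ∈ rho T
  resQuot_apply : ∀ᶠ ζ in 𝓝[≠] z, ∀ v : space, resQuot T w ζ v = sing ζ v
  resQuot_eq : ∀ᶠ ζ in 𝓝[≠] z, ∀ x, resQuot T w ζ x = reg ζ x + sing ζ (proj x)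
  proj_reg : ∀ᶠ ζ in 𝓝[≠] z, ∀ x, proj (reg ζ x) = 0
  hasDerivAt_reg : ∀ᶠ ζ in 𝓝[≠] z, HasDerivAt (fun ζ => (ζ - w) • reg ζ) (reg ζ ∘L reg ζ) ζ
  hasDerivAt_sing : ∀ᶠ ζ in 𝓝[≠] z, HasDerivAt (fun ζ => (ζ - w) • sing ζ) (sing ζ ∘L sing ζ) ζ

/-- The Riesz projection P commutes with U, so U is the sum of U(1 - P) and its restriction to ran
P. The first part extends analytically to z, the second is finite-dimensional, and each inherits the
derivative formula. -/
theorem nonempty_resolventSplitting [CompleteSpace H] {T : H →ₗ.[ℂ] H} {w z : ℂ} (hw : w ∈ rho T)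
    (hz : z ∈ phiTilde T) : Nonempty (ResolventSplitting T w z) := by
  have hρ := eventually_mem_rho_of_mem_phiTilde hz
  have hf := finiteDimensional_range_rieszProj hz
  obtain ⟨S, hS, hSe⟩ := exists_regular_part_res hρ
  set P := rieszProj T z with hP
  set V := LinearMap.range (P : H →ₗ[ℂ] H) with hV
  let π : H →L[ℂ] V := P.codRestrict V fun x => ⟨x, rfl⟩
  have hPP : ∀ x, P (P x) = P x := fun x =>
    congrArg (fun S : H →L[ℂ] H => S x) (rieszProj_mul_self hρ)
  have hPv : ∀ v : V, P v = v := by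
    rintro ⟨_, x, rfl⟩
    exact hPP x
  have hPU : ∀ ζ ∈ rho T, ∀ x, P (resQuot T w ζ x) = resQuot T w ζ (P x) := by
    intro ζ hζ x
    have h1 : P (res T ζ x) = res T ζ (P x) :=
      congrArg (fun S : H →L[ℂ] H => S x) (rieszProj_comm_res hρ hζ).eq
    simp only [resQuot, add_apply, one_apply_eq_self, smul_apply, map_add, map_smul, h1]
  let u : ℂ → V →L[ℂ] V := fun ζ => π ∘L resQuot T w ζ ∘L V.subtypeL
  -- Defined through the regular part S in order to be analytic at z itself; it agrees with U(1 - P)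
  -- only on a punctured neighbourhood.
  let r : ℂ → H →L[ℂ] H := fun ζ => (1 - P) + (ζ - w) • S ζ
  have hu : ∀ ζ ∈ rho T, ∀ v : V, resQuot T w ζ v = u ζ v := by
    intro ζ hζ v
    change _ = P (resQuot T w ζ v)
    rw [hPU ζ hζ, hPv]
  have hr : ∀ᶠ ζ in 𝓝[≠] z, r ζ = resQuot T w ζ ∘L (1 - P) := by
    filter_upwards [hSe] with ζ hζ
    change (1 - P) + (ζ - w) • S ζ = (1 + (ζ - w) • res T ζ) * (1 - P)
    rw [hζ, add_mul, one_mul, smul_mul_assoc]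
  refine ⟨{
    space := V
    finiteDimensional := hf
    proj := π
    sing := u
    reg := r
    meromorphicAt_sing := ?_
    analyticAt_reg := ?_
    mem_rho := hρ
    resQuot_apply := hρ.mono hu
    resQuot_eq := ?_
    proj_reg := ?_
    hasDerivAt_reg := ?_
    hasDerivAt_sing := ?_ }⟩
  -- On ran P the operator u ζ is the inverse of the polynomial 1 - (ζ - w) a, hence meromorphic by
  -- Cramer's rule.
  · set a : V →L[ℂ] V := π ∘L res T w ∘L V.subtypeL
    have ha : ∀ v : V, ((a v : V) : H) = res T w v := fun v => by
      change P (res T w v) = _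
      have h1 : P (res T w v) = res T w (P v) :=
        congrArg (fun S : H →L[ℂ] H => S v) (rieszProj_comm_res hρ hw).eq
      rw [h1, hPv]
    have hmul : ∀ ζ ∈ rho T, (1 - (ζ - w) • a) * u ζ = 1 ∧ u ζ * (1 - (ζ - w) • a) = 1 := by
      intro ζ hζ
      constructor
      · ext v
        change ((u ζ v : V) : H) - (ζ - w) • ((a (u ζ v) : V) : H) = v
        rw [ha, ← hu ζ hζ]
        exact congrArg (fun S : H →L[ℂ] H => S v) (one_sub_smul_res_mul hζ hw)
      · ext v
        change ((u ζ (v - (ζ - w) • a v) : V) : H) = v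
        rw [← hu ζ hζ, Submodule.coe_sub, Submodule.coe_smul, ha]
        exact congrArg (fun S : H →L[ℂ] H => S v) (mul_one_sub_smul_res hζ hw)
    have hmer : MeromorphicAt (fun ζ : ℂ => 1 - (ζ - w) • a) z :=
      (analyticAt_one_sub_smul a w z).meromorphicAt
    refine (MeromorphicAt.ringInverse hmer (hρ.mono fun ζ hζ =>
      isUnit_iff_exists.2 ⟨_, hmul ζ hζ⟩)).congr ?_
    filter_upwards [hρ] with ζ hζ
    exact ringInverse_eq_of_mul_eq_one (hmul ζ hζ).1 (hmul ζ hζ).2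
  · exact analyticAt_const.add ((analyticAt_id.sub analyticAt_const).smul hS)
  · filter_upwards [hρ, hr] with ζ hζ h1 x
    rw [h1, ← hu ζ hζ]
    change _ = resQuot T w ζ (x - P x) + resQuot T w ζ (P x)
    rw [map_sub, sub_add_cancel]
  · filter_upwards [hρ, hr] with ζ hζ h1 x
    rw [h1]
    refine Subtype.ext ?_
    change P (resQuot T w ζ (x - P x)) = 0
    rw [hPU ζ hζ, map_sub, hPP, sub_self, map_zero]
  · filter_upwards [hρ, hr, eventually_eventually_punctured hr] with ζ hζ h1 h2
    have h3 := (hasDerivAt_smul_resQuot (w := w) hζ).clm_comp (hasDerivAt_const ζ (1 - P))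
    rw [ContinuousLinearMap.comp_zero, add_zero] at h3
    refine (h3.congr_of_eventuallyEq (h2.mono fun ζ h4 => ?_)).congr_deriv ?_
    · simp only [h4, ContinuousLinearMap.smul_comp]
    · rw [h1]
      ext x
      change resQuot T w ζ (resQuot T w ζ (x - P x)) =
        resQuot T w ζ (resQuot T w ζ (x - P x) - P (resQuot T w ζ (x - P x)))
      rw [hPU ζ hζ, map_sub P, hPP, sub_self, map_zero, sub_zero]
  · filter_upwards [hρ] with ζ hζ
    have h3 := (hasDerivAt_const ζ π).clm_comp ((hasDerivAt_smul_resQuot (w := w) hζ).clm_comp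
      (hasDerivAt_const ζ V.subtypeL))
    simp only [ContinuousLinearMap.comp_zero, add_zero, ContinuousLinearMap.zero_comp,
      zero_add] at h3
    refine (h3.congr_of_eventuallyEq (Eventually.of_forall fun ζ => ?_)).congr_deriv ?_
    · simp only [u, ContinuousLinearMap.smul_comp, ContinuousLinearMap.comp_smul]
    · ext v
      change P (resQuot T w ζ (resQuot T w ζ v)) = ((u ζ (u ζ v) : V) : H)
      rw [hu ζ hζ v, ← hu ζ hζ (u ζ v), hPU ζ hζ, hPv]

end Splitting

/-! ### The trace identity behind the index formula -/

section TraceIdentity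

variable {H K V W : Type*} [NormedAddCommGroup H] [NormedSpace ℂ H] [NormedAddCommGroup K]
  [NormedSpace ℂ K] [NormedAddCommGroup V] [NormedSpace ℂ V] [FiniteDimensional ℂ V]
  [NormedAddCommGroup W] [NormedSpace ℂ W] [FiniteDimensional ℂ W]

theorem trCLM_comp_comm (f : V →L[ℂ] W) (g : W →L[ℂ] V) :
    trCLM V (g ∘L f) = trCLM W (f ∘L g) := by
  rw [trCLM_apply, trCLM_apply]
  exact LinearMap.trace_comp_comm' (f : V →ₗ[ℂ] W) (g : W →ₗ[ℂ] V)

/-- The algebraic identity behind the index formula: the traces of the finite rank pieces of the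
perturbed resolvent add up to the logarithmic derivative of the determinant. -/
theorem trace_pieces_eq {U r : H →L[ℂ] H} {j : W →L[ℂ] H} {π : H →L[ℂ] W} {u : W →L[ℂ] W}
    {Γ : K →L[ℂ] H} {Λ : H →L[ℂ] K} {N : K →L[ℂ] K} {Y : V →L[ℂ] K} {S : K →L[ℂ] V}
    {l : W →L[ℂ] V} {J : V →L[ℂ] V} (hUj : ∀ v, U (j v) = j (u v))
    (hU : ∀ x, U x = r x + j (u (π x))) (hπr : ∀ x, π (r x) = 0)
    (hl : ∀ v, Λ (j v) = Y (l v)) (hJ : J * (1 - S ∘L N ∘L Y) = 1) :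
    trCLM W ((u ∘L π ∘L Γ ∘L N ∘L Λ ∘L U) ∘L j) +
        trCLM W (π ∘L (r ∘L Γ ∘L N ∘L Λ ∘L j ∘L u)) +
        trCLM V ((J ∘L S ∘L N ∘L Λ ∘L U) ∘L (U ∘L Γ ∘L N ∘L Y)) =
      trCLM V (J * (l ∘L (u ∘L u) ∘L π ∘L Γ ∘L N ∘L Y + S ∘L N ∘L Λ ∘L (r ∘L r) ∘L Γ ∘L N ∘L Y)) := by
  have hJ' : ∀ v, J (S (N (Y v))) = J v - v := fun v => by
    have := congrArg (fun T : V →L[ℂ] V => T v) hJ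
    change J (v - S (N (Y v))) = v at this
    rw [map_sub, sub_eq_iff_eq_add] at this
    rw [this]; abel
  have hUU : ∀ x, U (U x) = r (r x) + j (u (u (π x))) := fun x => by
    have h1 : U (r x) = r (r x) := by rw [hU, hπr, map_zero, map_zero, add_zero]
    rw [hU x, map_add, h1, hUj]
  have e2 : π ∘L (r ∘L Γ ∘L N ∘L Λ ∘L j ∘L u) = 0 := by
    ext x
    exact hπr _
  have e1 : trCLM W ((u ∘L π ∘L Γ ∘L N ∘L Λ ∘L U) ∘L j) =
      trCLM W (u ∘L (u ∘L π ∘L Γ ∘L N ∘L Λ ∘L j)) := by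
    refine Eq.trans ?_ (trCLM_comp_comm u (u ∘L π ∘L Γ ∘L N ∘L Λ ∘L j))
    congr 1
    ext v
    simp only [ContinuousLinearMap.comp_apply, hUj]
  -- Here U² = r² + j u² π, Λ j = Y l and J S N Y = J - 1. The J-terms form the wanted right-hand
  -- side, and the -1 leaves a term whose trace cancels the first one by cyclicity.
  have e3 : (J ∘L S ∘L N ∘L Λ ∘L U) ∘L (U ∘L Γ ∘L N ∘L Y) =
      J * (l ∘L (u ∘L u) ∘L π ∘L Γ ∘L N ∘L Y + S ∘L N ∘L Λ ∘L (r ∘L r) ∘L Γ ∘L N ∘L Y) -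
        l ∘L (u ∘L u ∘L π ∘L Γ ∘L N ∘L Y) := by
    ext v
    simp only [ContinuousLinearMap.comp_apply, hUU, map_add, hl, hJ', mul_apply_eq_comp,
      add_apply, sub_apply]
    abel
  have e4 : trCLM V (l ∘L (u ∘L u ∘L π ∘L Γ ∘L N ∘L Y)) =
      trCLM W (u ∘L (u ∘L π ∘L Γ ∘L N ∘L Λ ∘L j)) := by
    rw [trCLM_comp_comm]
    congr 1
    ext v
    simp only [ContinuousLinearMap.comp_apply, hl]
  rw [e1, e2, e3, map_zero, map_sub, e4]
  ring

end TraceIdentity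

/-! ### Schur complements -/

section SchurComplement

variable {K V : Type*} [NormedAddCommGroup K] [NormedSpace ℂ K] [NormedAddCommGroup V]
  [NormedSpace ℂ V]

/-- The inverse of `1 - (G + Y S)` in terms of that of its Schur complement `1 - S (1 - G)⁻¹ Y`. -/
theorem inverse_one_sub_add_comp {G : K →L[ℂ] K} {Y : V →L[ℂ] K} {S : K →L[ℂ] V}
    (hG : IsUnit (1 - G)) (hD : IsUnit (1 - S ∘L Ring.inverse (1 - G) ∘L Y)) :
    IsUnit (1 - (G + Y ∘L S)) ∧ ∀ x, Ring.inverse (1 - (G + Y ∘L S)) x =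
      Ring.inverse (1 - G) x + Ring.inverse (1 - G)
        (Y (Ring.inverse (1 - S ∘L Ring.inverse (1 - G) ∘L Y) (S (Ring.inverse (1 - G) x)))) := by
  set N := Ring.inverse (1 - G)
  set J := Ring.inverse (1 - S ∘L N ∘L Y)
  have n1 : ∀ x, N x = x + G (N x) := fun x => by
    have : N x - G (N x) = x := congrArg (fun T : K →L[ℂ] K => T x) (Ring.mul_inverse_cancel _ hG)
    exact sub_eq_iff_eq_add.1 this
  have n2 : ∀ x, N (G x) = N x - x := fun x => by
    have : N (x - G x) = x := congrArg (fun T : K →L[ℂ] K => T x) (Ring.inverse_mul_cancel _ hG)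
    rw [map_sub, sub_eq_iff_eq_add] at this
    rw [this]; abel
  have j1 : ∀ v, S (N (Y (J v))) = J v - v := fun v => by
    have : J v - S (N (Y (J v))) = v :=
      congrArg (fun T : V →L[ℂ] V => T v) (Ring.mul_inverse_cancel _ hD)
    rw [sub_eq_iff_eq_add] at this
    nth_rewrite 2 [this]; abel
  have j2 : ∀ v, J (S (N (Y v))) = J v - v := fun v => by
    have : J (v - S (N (Y v))) = v :=
      congrArg (fun T : V →L[ℂ] V => T v) (Ring.inverse_mul_cancel _ hD)
    rw [map_sub, sub_eq_iff_eq_add] at this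
    rw [this]; abel
  set M : K →L[ℂ] K := N + N ∘L Y ∘L J ∘L S ∘L N
  have h1 : (1 - (G + Y ∘L S)) * M = 1 := by
    ext x
    change N x + N (Y (J (S (N x)))) - (G (N x + N (Y (J (S (N x))))) +
      Y (S (N x + N (Y (J (S (N x))))))) = x
    have e1 := n1 x
    have e2 := n1 (Y (J (S (N x))))
    simp only [map_add, map_sub, j1]
    nth_rewrite 1 [e1]
    nth_rewrite 1 [e2]
    abel
  have h2 : M * (1 - (G + Y ∘L S)) = 1 := by
    ext x
    change N (x - (G x + Y (S x))) + N (Y (J (S (N (x - (G x + Y (S x))))))) = x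
    simp only [map_add, map_sub, j2, n2]
    abel
  refine ⟨isUnit_iff_exists.2 ⟨M, h1, h2⟩, fun x => ?_⟩
  rw [ringInverse_eq_of_mul_eq_one h1 h2]
  rfl

/-- The inverse is 1 + S (1 - (G + Y S))⁻¹ Y, the mirror image of the formula for the inverse of the
full operator. -/
theorem isUnit_schurComplement {G : K →L[ℂ] K} {Y : V →L[ℂ] K} {S : K →L[ℂ] V}
    (hG : IsUnit (1 - G)) (hk : IsUnit (1 - (G + Y ∘L S))) :
    IsUnit (1 - S ∘L Ring.inverse (1 - G) ∘L Y) := by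
  set N := Ring.inverse (1 - G)
  set M := Ring.inverse (1 - (G + Y ∘L S))
  have n1 : ∀ x, N x = x + G (N x) := fun x => by
    have : N x - G (N x) = x := congrArg (fun T : K →L[ℂ] K => T x) (Ring.mul_inverse_cancel _ hG)
    exact sub_eq_iff_eq_add.1 this
  have n2 : ∀ x, N (G x) = N x - x := fun x => by
    have : N (x - G x) = x := congrArg (fun T : K →L[ℂ] K => T x) (Ring.inverse_mul_cancel _ hG)
    rw [map_sub, sub_eq_iff_eq_add] at this
    rw [this]; abel
  have aux : ∀ a b c x : K, a - (b + c) = x → c = a - b - x := by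
    rintro a b c x rfl
    abel
  have m1 : ∀ x, Y (S (M x)) = M x - G (M x) - x := fun x => by
    have : M x - (G (M x) + Y (S (M x))) = x :=
      congrArg (fun T : K →L[ℂ] K => T x) (Ring.mul_inverse_cancel _ hk)
    exact aux _ _ _ _ this
  have m2 : ∀ x, M (Y (S x)) = M x - M (G x) - x := fun x => by
    have : M (x - (G x + Y (S x))) = x :=
      congrArg (fun T : K →L[ℂ] K => T x) (Ring.inverse_mul_cancel _ hk)
    simp only [map_sub, map_add] at this
    exact aux _ _ _ _ this
  refine isUnit_iff_exists.2 ⟨1 + S ∘L M ∘L Y, ?_, ?_⟩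
  · ext v
    change v + S (M (Y v)) - S (N (Y (v + S (M (Y v))))) = v
    simp only [map_add, m1, map_sub, n2]
    abel
  · ext v
    change v - S (N (Y v)) + S (M (Y (v - S (N (Y v))))) = v
    have e := n1 (Y v)
    have e' : M (N (Y v)) = M (Y v) + M (G (N (Y v))) := by rw [← map_add, ← e]
    simp only [map_sub, m2, e', map_add]
    abel

end SchurComplement

/-! ### Splitting the kernel K -/

section Auxiliary

variable {E F G L : Type*} [NormedAddCommGroup E] [NormedSpace ℂ E] [NormedAddCommGroup F]
  [NormedSpace ℂ F] [NormedAddCommGroup G] [NormedSpace ℂ G] [NormedAddCommGroup L]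
  [NormedSpace ℂ L]

theorem MeromorphicAt.const_sub_comp_comp {f : ℂ → F →L[ℂ] G} {w z : ℂ} (hf : MeromorphicAt f z)
    (c : E →L[ℂ] L) (a : G →L[ℂ] L) (b : E →L[ℂ] F) :
    MeromorphicAt (fun ζ => c - a ∘L ((ζ - w) • f ζ) ∘L b) z :=
  (MeromorphicAt.const c z).fun_sub (MeromorphicAt.clm_comp (MeromorphicAt.const a z)
    (MeromorphicAt.clm_comp (((analyticAt_id.sub analyticAt_const).meromorphicAt).smul hf)
      (MeromorphicAt.const b z)))

theorem HasDerivAt.const_sub_comp_comp {f : ℂ → F →L[ℂ] G} {f' : F →L[ℂ] G} {z : ℂ}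
    (hf : HasDerivAt f f' z) (c : E →L[ℂ] L) (a : G →L[ℂ] L) (b : E →L[ℂ] F) :
    HasDerivAt (fun ζ => c - a ∘L f ζ ∘L b) (-(a ∘L f' ∘L b)) z := by
  have h := (hasDerivAt_const z a).clm_comp (hf.clm_comp (hasDerivAt_const z b))
  simp only [ContinuousLinearMap.comp_zero, add_zero, ContinuousLinearMap.zero_comp, zero_add] at h
  exact h.const_sub c

end Auxiliary

section Kernel

variable {H K : Type*}
  [NormedAddCommGroup H] [InnerProductSpace ℂ H] [CompleteSpace H]
  [NormedAddCommGroup K] [InnerProductSpace ℂ K] [CompleteSpace K]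
  {H₀ : H →ₗ.[ℂ] H} {A B : H →ₗ.[ℂ] K} {w z : ℂ}

namespace IsKatoTriple

theorem leftFactor_eq_comp_resQuot (h : IsKatoTriple H₀ A B) (hw : w ∈ rho H₀) {ζ : ℂ}
    (hζ : ζ ∈ rho H₀) : leftFactor H₀ A ζ = leftFactor H₀ A w ∘L resQuot H₀ w ζ := by
  rw [h.leftFactor_eq hζ hw]
  ext x
  simp [resQuot]

theorem rightFactor_eq_resQuot_comp (h : IsKatoTriple H₀ A B) (hw : w ∈ rho H₀) {ζ : ℂ}
    (hζ : ζ ∈ rho H₀) : rightFactor H₀ B ζ = resQuot H₀ w ζ ∘L rightFactor H₀ B w := by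
  rw [h.rightFactor_eq hζ hw]
  ext x
  simp [resQuot]

theorem bsKernel_eq_resQuot (h : IsKatoTriple H₀ A B) (hw : w ∈ rho H₀) {ζ : ℂ}
    (hζ : ζ ∈ rho H₀) : bsKernel H₀ A B ζ = bsKernel H₀ A B w -
      leftFactor H₀ A w ∘L ((ζ - w) • resQuot H₀ w ζ) ∘L rightFactor H₀ B w := by
  rw [h.bsKernel_eq hζ hw, h.leftFactor_eq_comp_resQuot hw hζ]
  ext x
  simp

theorem differentiableAt_bsKernel (h : IsKatoTriple H₀ A B) (hz : z ∈ rho H₀) :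
    DifferentiableAt ℂ (bsKernel H₀ A B) z := by
  have h1 := ((hasDerivAt_const z (leftFactor H₀ A z)).clm_comp
    ((hasDerivAt_smul_resQuot (w := z) hz).clm_comp
      (hasDerivAt_const z (rightFactor H₀ B z)))).differentiableAt.const_sub (bsKernel H₀ A B z)
  refine h1.congr_of_eventuallyEq ?_
  filter_upwards [(isOpen_rho H₀).mem_nhds hz] with ζ hζ
  exact h.bsKernel_eq_resQuot hz hζ

end IsKatoTriple

/-- The decomposition of `K(ζ)` near a point of finite multiplicity into a small analytic part and a
meromorphic part of finite rank. -/
structure KernelSplitting (H₀ : H →ₗ.[ℂ] H) (A B : H →ₗ.[ℂ] K) {w z : ℂ}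
    (s : ResolventSplitting H₀ w z) where
  space : Submodule ℂ K
  finiteDimensional : FiniteDimensional ℂ space
  left : s.space →L[ℂ] space
  reg : ℂ → K →L[ℂ] K
  sing : ℂ → K →L[ℂ] space
  analyticAt_reg : AnalyticAt ℂ reg z
  norm_reg_lt : ‖reg z‖ < 1 / 4
  meromorphicAt_sing : MeromorphicAt sing z
  leftFactor_apply : ∀ v : s.space, leftFactor H₀ A w v = left v
  bsKernel_eq : ∀ᶠ ζ in 𝓝[≠] z, bsKernel H₀ A B ζ = reg ζ + space.subtypeL ∘L sing ζ
  hasDerivAt_reg : ∀ᶠ ζ in 𝓝[≠] z, HasDerivAt reg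
    (-(leftFactor H₀ A w ∘L (s.reg ζ ∘L s.reg ζ) ∘L rightFactor H₀ B w)) ζ
  hasDerivAt_sing : ∀ᶠ ζ in 𝓝[≠] z, HasDerivAt sing
    (-(left ∘L (s.sing ζ ∘L s.sing ζ) ∘L s.proj ∘L rightFactor H₀ B w)) ζ

/-- The splitting of U gives K = r - Λ q with r analytic at z, but r(z) need not be small, nor is it
itself a value of K when z is a spectral point. At a nearby point ζ of ρ(H₀), however, r(ζ) is K(ζ)
plus a finite rank operator, and K(ζ) is approximable by finite rank; what remains after subtraction
is small at z by continuity of r. -/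
theorem IsKatoTriple.nonempty_kernelSplitting (h : IsKatoTriple H₀ A B) (hw : w ∈ rho H₀)
    (s : ResolventSplitting H₀ w z) {p : ℕ} (hp : 1 ≤ p)
    (hmem : ∀ ζ ∈ rho H₀, schattenSum p (bsKernel H₀ A B ζ) < ∞) :
    Nonempty (KernelSplitting H₀ A B s) := by
  have := s.finiteDimensional
  set Λ := leftFactor H₀ A w with hΛ
  set Γ := rightFactor H₀ B w with hΓ
  let r : ℂ → K →L[ℂ] K := fun ζ => bsKernel H₀ A B w - Λ ∘L ((ζ - w) • s.reg ζ) ∘L Γ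
  have hsm : AnalyticAt ℂ (fun ζ => (ζ - w) • s.reg ζ) z :=
    (analyticAt_id.sub analyticAt_const).smul s.analyticAt_reg
  have hran : AnalyticAt ℂ r z := by
    rw [Complex.analyticAt_iff_eventually_differentiableAt]
    filter_upwards [hsm.eventually_analyticAt] with ζ hζ
    exact ((differentiableAt_const Λ).clm_comp (hζ.differentiableAt.clm_comp
      (differentiableAt_const Γ))).const_sub _
  let q : ℂ → K →L[ℂ] s.space := fun ζ => ((ζ - w) • s.sing ζ) ∘L s.proj ∘L Γ
  have hK : ∀ᶠ ζ in 𝓝[≠] z, bsKernel H₀ A B ζ = r ζ - Λ ∘L s.space.subtypeL ∘L q ζ := by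
    filter_upwards [s.mem_rho, s.resQuot_eq] with ζ h1 h2
    rw [h.bsKernel_eq_resQuot hw h1]
    ext x
    simp only [r, q, sub_apply, ContinuousLinearMap.comp_apply, smul_apply, h2, smul_add, map_add,
      Submodule.subtypeL_apply, Submodule.coe_smul, ← hΛ, ← hΓ]
    abel
  have hclose : ∀ᶠ ζ in 𝓝[≠] z, ‖r ζ - r z‖ < 1 / 16 := by
    have h1 : Tendsto (fun ζ => ‖r ζ - r z‖) (𝓝 z) (𝓝 0) := by
      simpa using (hran.continuousAt.sub continuousAt_const : ContinuousAt (fun ζ => r ζ - r z) z).norm.tendsto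
    exact nhdsWithin_le_nhds (h1.eventually_lt_const (by norm_num))
  obtain ⟨ζ, hζρ, hζK, hζc⟩ := (s.mem_rho.and (hK.and hclose)).exists
  obtain ⟨F, hF, hFk⟩ := exists_finiteRank_schattenSum_sub_lt (bsKernel H₀ A B ζ) (hmem ζ hζρ)
    (ε := ENNReal.ofReal (1 / 16) ^ p) (by positivity)
  have hn := norm_le_of_schattenSum_le hp (by norm_num) hFk.le
  -- Large enough for both the constant finite rank operator moved out of r and the singular part of
  -- K.
  let V : Submodule ℂ K := LinearMap.range (F : K →ₗ[ℂ] K) ⊔ s.space.map (Λ : H →ₗ[ℂ] K)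
  have hVf : FiniteDimensional ℂ V := inferInstance
  have hΛV : ∀ v : s.space, Λ v ∈ V := fun v => Submodule.mem_sup_right ⟨v, v.2, rfl⟩
  let l : s.space →L[ℂ] V := (Λ ∘L s.space.subtypeL).codRestrict V hΛV
  -- With this choice r(z) - F' = (K(ζ) - F) - (r(ζ) - r(z)), of norm below 1/16 + 1/16.
  let F' : K →L[ℂ] K := F + Λ ∘L s.space.subtypeL ∘L q ζ
  have hF'V : ∀ x, F' x ∈ V := fun x =>
    V.add_mem (Submodule.mem_sup_left ⟨x, rfl⟩) (hΛV _)
  let F'' : K →L[ℂ] V := F'.codRestrict V hF'V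
  refine ⟨{
    space := V
    finiteDimensional := hVf
    left := l
    reg := fun ζ => r ζ - F'
    sing := fun ζ => F'' - l ∘L q ζ
    analyticAt_reg := hran.sub analyticAt_const
    norm_reg_lt := ?_
    meromorphicAt_sing := ?_
    leftFactor_apply := fun v => rfl
    bsKernel_eq := ?_
    hasDerivAt_reg := ?_
    hasDerivAt_sing := ?_ }⟩
  · have h1 : r z - F' = (bsKernel H₀ A B ζ - F) - (r ζ - r z) := by
      rw [hζK]; simp only [F']; abel
    rw [h1]
    exact (norm_sub_le _ _).trans_lt (by linarith)
  · exact MeromorphicAt.const_sub_comp_comp s.meromorphicAt_sing F'' l (s.proj ∘L Γ)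
  · filter_upwards [hK] with ζ' h1
    rw [h1]
    ext x
    change _ = (r ζ' x - F' x) + (F' x - Λ (q ζ' x))
    simp only [sub_apply, ContinuousLinearMap.comp_apply, Submodule.subtypeL_apply]
    abel
  · filter_upwards [s.hasDerivAt_reg] with ζ h1
    exact (HasDerivAt.const_sub_comp_comp h1 (bsKernel H₀ A B w) Λ Γ).sub_const F'
  · filter_upwards [s.hasDerivAt_sing] with ζ h1
    exact HasDerivAt.const_sub_comp_comp h1 F'' l (s.proj ∘L Γ)

end Kernel

/-! ### The index formula for the Riesz projections -/

theorem eventually_circleIntegrable_of_meromorphicAt {E : Type*} [NormedAddCommGroup E]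
    [NormedSpace ℂ E] {f : ℂ → E} {z : ℂ} (hf : MeromorphicAt f z) :
    ∀ᶠ ε in 𝓝[>] (0 : ℝ), CircleIntegrable f z ε := by
  filter_upwards [eventually_sphere_of_punctured hf.eventually_continuousAt, self_mem_nhdsWithin]
    with ε h1 h0
  exact CircleIntegrable.of_continuousAt (le_of_lt h0) h1

theorem eventually_hasTrace_and_circleIntegrable {E H : Type*} [NormedAddCommGroup E]
    [NormedSpace ℂ E] [FiniteDimensional ℂ E] [NormedAddCommGroup H] [InnerProductSpace ℂ H]
    [CompleteSpace H] {z : ℂ} {f : ℂ → E →L[ℂ] H} {g : ℂ → H →L[ℂ] E} (hf : MeromorphicAt f z)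
    (hg : MeromorphicAt g z) : ∀ᶠ ε in 𝓝[>] (0 : ℝ),
      HasTrace (∮ ζ in C(z, ε), f ζ ∘L g ζ) (∮ ζ in C(z, ε), trCLM E (g ζ ∘L f ζ)) ∧
      CircleIntegrable (fun ζ => f ζ ∘L g ζ) z ε ∧
      CircleIntegrable (fun ζ => trCLM E (g ζ ∘L f ζ)) z ε :=
  (eventually_hasTrace_circleIntegral hf hg).and
    ((eventually_circleIntegrable_of_meromorphicAt (MeromorphicAt.clm_comp hf hg)).and
    (eventually_circleIntegrable_of_meromorphicAt
      (MeromorphicAt.clm_map (trCLM E) (MeromorphicAt.clm_comp hg hf))))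

section Index

variable {H K : Type*}
  [NormedAddCommGroup H] [InnerProductSpace ℂ H] [CompleteSpace H]
  [NormedAddCommGroup K] [InnerProductSpace ℂ K] [CompleteSpace K]
  {H₀ : H →ₗ.[ℂ] H} {A B : H →ₗ.[ℂ] K} {w z : ℂ}

namespace KernelSplitting

variable {s : ResolventSplitting H₀ w z} (t : KernelSplitting H₀ A B s)

/-- The operator function on a finite-dimensional space whose determinant is the meromorphic factor
of the perturbation determinant. -/
def schur (ζ : ℂ) : t.space →L[ℂ] t.space :=
  1 - t.sing ζ ∘L Ring.inverse (1 - t.reg ζ) ∘L t.space.subtypeL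

theorem eventually_norm_reg_lt : ∀ᶠ ζ in 𝓝 z, ‖t.reg ζ‖ < 1 / 4 :=
  t.analyticAt_reg.continuousAt.norm.eventually_lt_const t.norm_reg_lt

theorem isUnit_one_sub_reg {ζ : ℂ} (hζ : ‖t.reg ζ‖ < 1 / 4) : IsUnit (1 - t.reg ζ) :=
  isUnit_one_sub_of_norm_lt_one (R := K →L[ℂ] K) (hζ.trans (by norm_num))

theorem analyticAt_inverse : AnalyticAt ℂ (fun ζ => Ring.inverse (1 - t.reg ζ)) z := by
  rw [Complex.analyticAt_iff_eventually_differentiableAt]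
  filter_upwards [t.eventually_norm_reg_lt, t.analyticAt_reg.eventually_analyticAt] with ζ h1 h2
  exact (HasDerivAt.clm_inverse_one_sub h1 h2.differentiableAt.hasDerivAt).differentiableAt

theorem meromorphicAt_schur : MeromorphicAt t.schur z :=
  (MeromorphicAt.const _ z).fun_sub (MeromorphicAt.clm_comp t.meromorphicAt_sing
    (MeromorphicAt.clm_comp t.analyticAt_inverse.meromorphicAt (MeromorphicAt.const _ z)))

theorem eventually_isUnit_iff : ∀ᶠ ζ in 𝓝[≠] z,
    (IsUnit (1 - bsKernel H₀ A B ζ) ↔ IsUnit (t.schur ζ)) := by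
  filter_upwards [nhdsWithin_le_nhds t.eventually_norm_reg_lt, t.bsKernel_eq] with ζ h1 h2
  rw [h2]
  exact ⟨fun h => isUnit_schurComplement (t.isUnit_one_sub_reg h1) h,
    fun h => (inverse_one_sub_add_comp (t.isUnit_one_sub_reg h1) h).1⟩

end KernelSplitting

namespace IsKatoTriple

/-- Expand R₀ - R = U Γ (1 - K)⁻¹ Λ U using U = r + j u π and (1 - K)⁻¹ = N + N Y J S N. Apart from
one analytic term, every piece factors through a finite-dimensional space, and the traces of these
pieces add up to the logarithmic derivative of the determinant. -/
theorem eventually_hasTrace_rieszProj (h : IsKatoTriple H₀ A B) (hw : w ∈ rho H₀)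
    (hw' : IsUnit (1 - bsKernel H₀ A B w)) (hz : z ∈ phiTilde H₀)
    {s : ResolventSplitting H₀ w z} (t : KernelSplitting H₀ A B s)
    (hu : ∀ᶠ ζ in 𝓝[≠] z, IsUnit (t.schur ζ)) :
    ∀ᶠ ε in 𝓝[>] (0 : ℝ), HasTrace (rieszProj (pertOp H₀ A B w) z)
      (Module.finrank ℂ (LinearMap.range (rieszProj H₀ z : H →ₗ[ℂ] H)) +
        logIntegral (fun ζ => LinearMap.det (t.schur ζ : t.space →ₗ[ℂ] t.space)) z ε) := by
  have := s.finiteDimensional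
  have := t.finiteDimensional
  have hρ := s.mem_rho
  set Λ := leftFactor H₀ A w
  set Γ := rightFactor H₀ B w
  set j := s.space.subtypeL
  set Y := t.space.subtypeL
  set U := resQuot H₀ w
  set N : ℂ → K →L[ℂ] K := fun ζ => Ring.inverse (1 - t.reg ζ) with hN
  set J : ℂ → t.space →L[ℂ] t.space := fun ζ => Ring.inverse (t.schur ζ) with hJ
  set d : ℂ → ℂ := fun ζ => LinearMap.det (t.schur ζ : t.space →ₗ[ℂ] t.space) with hd
  have hNm : MeromorphicAt N z := t.analyticAt_inverse.meromorphicAt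
  have hrm : MeromorphicAt s.reg z := s.analyticAt_reg.meromorphicAt
  have hJm : MeromorphicAt J z := MeromorphicAt.ringInverse t.meromorphicAt_schur hu
  have hUm : MeromorphicAt U z := by
    have h1 : MeromorphicAt (fun ζ => s.reg ζ + j ∘L s.sing ζ ∘L s.proj) z :=
      hrm.fun_add (MeromorphicAt.clm_comp (MeromorphicAt.const j z)
        (MeromorphicAt.clm_comp s.meromorphicAt_sing (MeromorphicAt.const s.proj z)))
    refine h1.congr ?_
    filter_upwards [s.resQuot_eq] with ζ h2
    ext x
    exact (h2 x).symm
  have hNΛ : ∀ {E : Type _} [NormedAddCommGroup E] [NormedSpace ℂ E] {f : ℂ → E →L[ℂ] H},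
      MeromorphicAt f z → MeromorphicAt (fun ζ => Γ ∘L N ζ ∘L Λ ∘L f ζ) z := fun hf =>
    MeromorphicAt.clm_comp (MeromorphicAt.const Γ z) (MeromorphicAt.clm_comp hNm
      (MeromorphicAt.clm_comp (MeromorphicAt.const Λ z) hf))
  let Z₁ : ℂ → H →L[ℂ] s.space := fun ζ => s.sing ζ ∘L s.proj ∘L Γ ∘L N ζ ∘L Λ ∘L U ζ
  let Y₂ : ℂ → s.space →L[ℂ] H := fun ζ => s.reg ζ ∘L Γ ∘L N ζ ∘L Λ ∘L j ∘L s.sing ζ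
  let Z₃ : ℂ → H →L[ℂ] t.space := fun ζ => J ζ ∘L t.sing ζ ∘L N ζ ∘L Λ ∘L U ζ
  let Y₃ : ℂ → t.space →L[ℂ] H := fun ζ => U ζ ∘L Γ ∘L N ζ ∘L Y
  -- The only piece that need not have finite rank; it is analytic at z and disappears upon
  -- integration.
  let Q : ℂ → H →L[ℂ] H := fun ζ => s.reg ζ ∘L Γ ∘L N ζ ∘L Λ ∘L s.reg ζ
  have hZ₁ : MeromorphicAt Z₁ z := MeromorphicAt.clm_comp s.meromorphicAt_sing
    (MeromorphicAt.clm_comp (MeromorphicAt.const s.proj z) (hNΛ hUm))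
  have hY₂ : MeromorphicAt Y₂ z := MeromorphicAt.clm_comp hrm
    (hNΛ (MeromorphicAt.clm_comp (MeromorphicAt.const j z) s.meromorphicAt_sing))
  have hZ₃ : MeromorphicAt Z₃ z := MeromorphicAt.clm_comp hJm
    (MeromorphicAt.clm_comp t.meromorphicAt_sing (MeromorphicAt.clm_comp hNm
      (MeromorphicAt.clm_comp (MeromorphicAt.const Λ z) hUm)))
  have hY₃ : MeromorphicAt Y₃ z := MeromorphicAt.clm_comp hUm
    (MeromorphicAt.clm_comp (MeromorphicAt.const Γ z) (MeromorphicAt.clm_comp hNm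
      (MeromorphicAt.const Y z)))
  have hQ : AnalyticAt ℂ Q z := by
    rw [Complex.analyticAt_iff_eventually_differentiableAt]
    filter_upwards [t.analyticAt_inverse.eventually_analyticAt,
      s.analyticAt_reg.eventually_analyticAt] with ζ h1 h2
    exact h2.differentiableAt.clm_comp ((differentiableAt_const Γ).clm_comp
      (h1.differentiableAt.clm_comp ((differentiableAt_const Λ).clm_comp h2.differentiableAt)))
  have hjm : MeromorphicAt (fun _ : ℂ => j) z := MeromorphicAt.const j z
  have hπm : MeromorphicAt (fun _ : ℂ => s.proj) z := MeromorphicAt.const s.proj z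
  have hres : ∀ᶠ ζ in 𝓝[≠] z, res (pertOp H₀ A B w) ζ =
      res H₀ ζ - (Q ζ + j ∘L Z₁ ζ + Y₂ ζ ∘L s.proj + Y₃ ζ ∘L Z₃ ζ) := by
    filter_upwards [hρ, hu, t.bsKernel_eq, nhdsWithin_le_nhds t.eventually_norm_reg_lt,
      s.resQuot_eq] with ζ h1 h2 h3 h4 h5
    obtain ⟨h6, h7⟩ := inverse_one_sub_add_comp (t.isUnit_one_sub_reg h4) h2
    rw [← h3] at h6 h7
    rw [(h.isResolventAt_pertOp h1 hw h6 hw').res_eq, pertRes_eq,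
      h.leftFactor_eq_comp_resQuot hw h1, h.rightFactor_eq_resQuot_comp hw h1]
    ext x
    change res H₀ ζ x - U ζ (Γ (Ring.inverse (1 - bsKernel H₀ A B ζ) (Λ (U ζ x)))) =
      res H₀ ζ x - (s.reg ζ (Γ (N ζ (Λ (s.reg ζ x)))) +
        ((s.sing ζ (s.proj (Γ (N ζ (Λ (U ζ x))))) : s.space) : H) +
        s.reg ζ (Γ (N ζ (Λ ((s.sing ζ (s.proj x) : s.space) : H)))) +
        U ζ (Γ (N ζ ((J ζ (t.sing ζ (N ζ (Λ (U ζ x)))) : t.space) : K))))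
    have h8 : Ring.inverse (1 - bsKernel H₀ A B ζ) (Λ (U ζ x)) = N ζ (Λ (U ζ x)) +
        N ζ ((J ζ (t.sing ζ (N ζ (Λ (U ζ x)))) : t.space) : K) := h7 _
    have h9 : ∀ y, U ζ y = s.reg ζ y + ((s.sing ζ (s.proj y) : s.space) : H) := h5
    have h10 : U ζ (Γ (N ζ (Λ (U ζ x)))) = s.reg ζ (Γ (N ζ (Λ (s.reg ζ x)))) +
        s.reg ζ (Γ (N ζ (Λ ((s.sing ζ (s.proj x) : s.space) : H)))) +
        ((s.sing ζ (s.proj (Γ (N ζ (Λ (U ζ x))))) : s.space) : H) := by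
      rw [h9 (Γ (N ζ (Λ (U ζ x)))), ← map_add, ← map_add, ← map_add, ← map_add, ← h9 x]
    rw [h8, map_add, map_add, h10]
    abel
  have hdlog : ∀ᶠ ζ in 𝓝[≠] z, deriv d ζ / d ζ = trCLM s.space (Z₁ ζ ∘L j) +
      trCLM s.space (s.proj ∘L Y₂ ζ) + trCLM t.space (Z₃ ζ ∘L Y₃ ζ) := by
    filter_upwards [hu, nhdsWithin_le_nhds t.eventually_norm_reg_lt, s.resQuot_eq,
      s.resQuot_apply, s.proj_reg, t.hasDerivAt_reg, t.hasDerivAt_sing] with ζ h2 h4 h5 h6 h7 h8 h9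
    have h10 := HasDerivAt.one_sub_comp (Y := Y) h4 h8 h9
    have h11 := (HasDerivAt.linearMap_det (D := t.schur) (J := J ζ) h10
      (Ring.mul_inverse_cancel _ h2)).deriv
    have h12 : d ζ ≠ 0 := (isUnit_iff_det_ne_zero _).1 h2
    have h13 := trace_pieces_eq (j := j) (Y := Y) (Λ := Λ) (Γ := Γ) (N := N ζ) (l := t.left) h6 h5 h7 t.leftFactor_apply
      (Ring.inverse_mul_cancel _ h2 : J ζ * t.schur ζ = 1)
    change deriv d ζ = d ζ * _ at h11
    rw [h11, mul_div_cancel_left₀ _ h12]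
    refine Eq.trans ?_ h13.symm
    congr 2
    ext v
    simp
    exact add_comm _ _
  have hρH : ∀ᶠ ζ in 𝓝[≠] z, ζ ∈ rho (pertOp H₀ A B w) := by
    filter_upwards [hρ, hu, t.eventually_isUnit_iff] with ζ h1 h2 h3
    exact (h.isResolventAt_pertOp h1 hw (h3.2 h2) hw').mem_rho
  have hQm := hQ.meromorphicAt
  filter_upwards [self_mem_nhdsWithin, eventually_hasTrace_and_circleIntegrable hjm hZ₁, eventually_hasTrace_and_circleIntegrable hY₂ hπm, eventually_hasTrace_and_circleIntegrable hY₃ hZ₃,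
    eventually_circleIntegrable_of_meromorphicAt hQm, circleIntegral_eq_zero_of_analyticAt hQ,
    circleIntegrable_res hρ, eventually_rieszIntegral_eq hρ, eventually_rieszIntegral_eq hρH,
    eventually_sphere_of_punctured hres, eventually_sphere_of_punctured hdlog]
    with ε h0 ⟨a1, b1, c1⟩ ⟨a2, b2, c2⟩ ⟨a3, b3, c3⟩ h4 h5 h6 h7 h8 h9 h10
  have h0' : 0 ≤ ε := le_of_lt h0
  have e1 : ∮ ζ in C(z, ε), res (pertOp H₀ A B w) ζ = (∮ ζ in C(z, ε), res H₀ ζ) -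
      ((∮ ζ in C(z, ε), j ∘L Z₁ ζ) + (∮ ζ in C(z, ε), Y₂ ζ ∘L s.proj) +
        ∮ ζ in C(z, ε), Y₃ ζ ∘L Z₃ ζ) := by
    rw [circleIntegral.integral_congr h0' h9, circleIntegral.integral_sub h6
      (((h4.fun_add b1).fun_add b2).fun_add b3), circleIntegral.integral_add
      ((h4.fun_add b1).fun_add b2) b3, circleIntegral.integral_add (h4.fun_add b1) b2,
      circleIntegral.integral_add h4 b1, h5, zero_add]
  have e2 : ∮ ζ in C(z, ε), deriv d ζ / d ζ = (∮ ζ in C(z, ε), trCLM s.space (Z₁ ζ ∘L j)) +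
      (∮ ζ in C(z, ε), trCLM s.space (s.proj ∘L Y₂ ζ)) +
        ∮ ζ in C(z, ε), trCLM t.space (Z₃ ζ ∘L Y₃ ζ) := by
    rw [circleIntegral.integral_congr h0' h10, circleIntegral.integral_add (c1.fun_add c2) c3,
      circleIntegral.integral_add c1 c2]
  have e3 : rieszProj (pertOp H₀ A B w) z = rieszProj H₀ z + (2 * (Real.pi : ℂ) * Complex.I)⁻¹ •
      ((∮ ζ in C(z, ε), j ∘L Z₁ ζ) + (∮ ζ in C(z, ε), Y₂ ζ ∘L s.proj) +
        ∮ ζ in C(z, ε), Y₃ ζ ∘L Z₃ ζ) := by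
    rw [← h7, ← h8, rieszIntegral, rieszIntegral, e1, smul_sub]
    abel
  rw [e3, logIntegral, e2]
  exact (hasTrace_of_idempotent (rieszProj_mul_self hρ)
    (finiteDimensional_range_rieszProj hz)).add (((a1.add a2).add a3).smul _)

end IsKatoTriple
end Index

/-! ### The global Weinstein–Aronszajn formula -/

section GlobalFormula

variable {H K : Type*}
  [NormedAddCommGroup H] [InnerProductSpace ℂ H] [CompleteSpace H]
  [NormedAddCommGroup K] [InnerProductSpace ℂ K] [CompleteSpace K]
  {H₀ : H →ₗ.[ℂ] H} {A B : H →ₗ.[ℂ] K} {w z : ℂ} {p : ℕ}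

namespace IsKatoTriple

/-- The contour integral is the difference of the traces of two finite rank projections, hence of
their ranks. This also shows, without the argument principle, that it is an integer independent of
ε. -/
theorem opMult_pertOp_eq_add (h : IsKatoTriple H₀ A B) (hw : w ∈ rho H₀)
    (hw' : IsUnit (1 - bsKernel H₀ A B w)) (hz : z ∈ phiTilde H₀)
    {s : ResolventSplitting H₀ w z} (t : KernelSplitting H₀ A B s)
    (hu : ∀ᶠ ζ in 𝓝[≠] z, IsUnit (t.schur ζ)) :
    ∃ k : ℤ, (∀ᶠ ε in 𝓝[>] (0 : ℝ),
      logIntegral (fun ζ => LinearMap.det (t.schur ζ : t.space →ₗ[ℂ] t.space)) z ε = k) ∧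
      opMult z (pertOp H₀ A B w) = opMult z H₀ + (k : WithTop ℤ) := by
  have hρH : ∀ᶠ ζ in 𝓝[≠] z, ζ ∈ rho (pertOp H₀ A B w) := by
    filter_upwards [s.mem_rho, hu, t.eventually_isUnit_iff] with ζ h1 h2 h3
    exact (h.isResolventAt_pertOp h1 hw (h3.2 h2) hw').mem_rho
  have htr := h.eventually_hasTrace_rieszProj hw hw' hz t hu
  obtain ⟨ε, hε⟩ := htr.exists
  have hf := hε.finiteDimensional
  refine ⟨(Module.finrank ℂ (LinearMap.range (rieszProj (pertOp H₀ A B w) z : H →ₗ[ℂ] H)) : ℤ) -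
    Module.finrank ℂ (LinearMap.range (rieszProj H₀ z : H →ₗ[ℂ] H)), ?_, ?_⟩
  · filter_upwards [htr] with ε hε
    have h1 := (hasTrace_of_idempotent (rieszProj_mul_self hρH) hf).unique hε
    push_cast
    rw [h1]
    ring
  · rw [opMult_eq_finrank hρH hf, opMult_eq_finrank s.mem_rho (finiteDimensional_range_rieszProj hz)]
    rw [← WithTop.coe_add, add_sub_cancel]

theorem opMult_pertOp_eq_top (h : IsKatoTriple H₀ A B) (hw : w ∈ rho H₀)
    (hw' : IsUnit (1 - bsKernel H₀ A B w))
    (hc : ∀ ζ ∈ rho H₀, IsCompactOperator (bsKernel H₀ A B ζ))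
    {s : ResolventSplitting H₀ w z} (t : KernelSplitting H₀ A B s)
    (hu : ∀ᶠ ζ in 𝓝[≠] z, ¬ IsUnit (t.schur ζ)) : opMult z (pertOp H₀ A B w) = ⊤ := by
  refine opMult_eq_top fun hρ => ?_
  obtain ⟨ζ, h1, h2, h3, h4⟩ := (hρ.and (hu.and (s.mem_rho.and t.eventually_isUnit_iff))).exists
  exact h2 (h4.1 (h.isUnit_of_mem_rho_pertOp h3 hw (hc ζ h3) hw' h1))

theorem differentiableOn_detP (h : IsKatoTriple H₀ A B) (hp : 1 ≤ p)
    (hmem : ∀ ζ ∈ rho H₀, MemSchatten p (bsKernel H₀ A B ζ))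
    (han : SchattenAnalyticOn p (bsKernel H₀ A B) (rho H₀)) :
    DifferentiableOn ℂ (fun ζ => detP p (bsKernel H₀ A B ζ)) (rho H₀) := by
  intro ζ hζ
  obtain ⟨D, hD, hlim⟩ := han ζ hζ
  refine (differentiableAt_detP hp ?_ (h.differentiableAt_bsKernel hζ) ((memSchatten_iff hp D).1 hD)
    ((tendsto_schattenNorm_iff hp _).1 hlim)).differentiableWithinAt
  filter_upwards [(isOpen_rho H₀).mem_nhds hζ] with ξ hξ
  exact (memSchatten_iff hp _).1 (hmem ξ hξ)

/-- The exponent is claimed to be differentiable only off z: the trace correction may have a pole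
there, and the regular part of K at z is not known to lie in 𝓑_p. -/
theorem exists_detP_eq_mul_exp (hp : 1 ≤ p)
    (hmem : ∀ ζ ∈ rho H₀, MemSchatten p (bsKernel H₀ A B ζ))
    (han : SchattenAnalyticOn p (bsKernel H₀ A B) (rho H₀))
    {s : ResolventSplitting H₀ w z} (t : KernelSplitting H₀ A B s) :
    ∃ g : ℂ → ℂ, (∀ᶠ ζ in 𝓝[≠] z, DifferentiableAt ℂ g ζ) ∧
      ∀ᶠ ζ in 𝓝[≠] z, detP p (bsKernel H₀ A B ζ) =
        LinearMap.det (t.schur ζ : t.space →ₗ[ℂ] t.space) * Complex.exp (g ζ) := by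
  have := t.finiteDimensional
  refine ⟨fun ζ => traceCorrection p t.space.subtypeL (t.sing ζ) (t.reg ζ) -
    logTailExt p (t.reg ζ), ?_, ?_⟩
  · filter_upwards [s.mem_rho, eventually_eventually_punctured t.bsKernel_eq,
      nhdsWithin_le_nhds t.eventually_norm_reg_lt, t.hasDerivAt_reg, t.hasDerivAt_sing]
      with ζ h1 h2 h3 h4 h5
    obtain ⟨D, hD, hlim⟩ := han ζ h1
    exact (differentiableAt_traceCorrection h4.differentiableAt h5.differentiableAt).sub
      (differentiableAt_logTailExt_of_eq_add hp h2 h3 h5.differentiableAt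
        ((memSchatten_iff hp _).1 (hmem ζ h1)) ((memSchatten_iff hp D).1 hD)
        ((tendsto_schattenNorm_iff hp _).1 hlim))
  · filter_upwards [s.mem_rho, t.bsKernel_eq, nhdsWithin_le_nhds t.eventually_norm_reg_lt]
      with ζ h1 h2 h3
    exact detP_eq_schurDet_mul_exp hp h2 h3 ((memSchatten_iff hp _).1 (hmem ζ h1))

/-- The global Weinstein–Aronszajn formula. -/
theorem opMult_pertOp_eq (h : IsKatoTriple H₀ A B) (hw : w ∈ rho H₀)
    (hw' : IsUnit (1 - bsKernel H₀ A B w))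
    (hc : ∀ ζ ∈ rho H₀, IsCompactOperator (bsKernel H₀ A B ζ)) (hp : 1 ≤ p)
    (hmem : ∀ ζ ∈ rho H₀, MemSchatten p (bsKernel H₀ A B ζ))
    (han : SchattenAnalyticOn p (bsKernel H₀ A B) (rho H₀)) (hz : z ∈ phiTilde H₀) :
    ((∀ᶠ ζ in 𝓝[≠] z, detP p (bsKernel H₀ A B ζ) = 0) ∨
      (∀ᶠ ζ in 𝓝[≠] z, detP p (bsKernel H₀ A B ζ) ≠ 0)) ∧
    opMult z (pertOp H₀ A B w) =
      opMult z H₀ + funMult z (fun ζ => detP p (bsKernel H₀ A B ζ)) := by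
  obtain ⟨s⟩ := nonempty_resolventSplitting hw hz
  obtain ⟨t⟩ := h.nonempty_kernelSplitting hw s hp fun ζ hζ => (memSchatten_iff hp _).1 (hmem ζ hζ)
  have := t.finiteDimensional
  obtain ⟨g, hg, hf⟩ := exists_detP_eq_mul_exp hp hmem han t
  have hd := MeromorphicAt.linearMap_det t.meromorphicAt_schur
  -- The exponential factor has no zeros, so the dichotomy for the meromorphic d is inherited by
  -- det_p, although det_p need not be meromorphic at z.
  rcases hd.eventually_eq_zero_or_eventually_ne_zero with h0 | h0
  · have hf0 : ∀ᶠ ζ in 𝓝[≠] z, detP p (bsKernel H₀ A B ζ) = 0 := by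
      filter_upwards [h0, hf] with ζ h1 h2
      rw [h2, h1, zero_mul]
    refine ⟨Or.inl hf0, ?_⟩
    have hmer : MeromorphicAt (fun ζ => detP p (bsKernel H₀ A B ζ)) z :=
      (MeromorphicAt.const 0 z).congr (hf0.mono fun _ h => h.symm)
    rw [h.opMult_pertOp_eq_top hw hw' hc t (h0.mono fun ζ h1 h2 =>
      (isUnit_iff_det_ne_zero _).1 h2 h1), funMult, if_pos hmer,
      meromorphicOrderAt_eq_top_iff.2 hf0, add_top]
  · refine ⟨Or.inr ?_, ?_⟩
    · filter_upwards [h0, hf] with ζ h1 h2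
      rw [h2]
      exact mul_ne_zero h1 (Complex.exp_ne_zero _)
    · obtain ⟨k, hk, hop⟩ := h.opMult_pertOp_eq_add hw hw' hz t
        (h0.mono fun ζ h1 => (isUnit_iff_det_ne_zero _).2 h1)
      rw [hop, funMult_eq_of_eq_mul_exp hf hd h0 hg hk]

end IsKatoTriple
end GlobalFormula

end WA

end

theorem theorem5p4 {H K : Type*}
    [NormedAddCommGroup H] [InnerProductSpace ℂ H] [CompleteSpace H]
    [TopologicalSpace.SeparableSpace H]
    [NormedAddCommGroup K] [InnerProductSpace ℂ K] [CompleteSpace K]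
    [TopologicalSpace.SeparableSpace K]
    (H₀ : H →ₗ.[ℂ] H) (A B : H →ₗ.[ℂ] K)
    (hH₀_dense : Dense (H₀.domain : Set H)) (hH₀_closed : H₀.IsClosed)
    (hA_dense : Dense (A.domain : Set H)) (hA_closed : A.IsClosed)
    (hB_dense : Dense (B.domain : Set H)) (hB_closed : B.IsClosed)
    (hA : H₀.domain ≤ A.domain) (hB : H₀.adjoint.domain ≤ B.domain)
    (hK_bdd : ∃ z ∈ WA.rho H₀, WA.HasBddExt (WA.sandwich H₀ A B z))
    (z₀ : ℂ) (hz₀ : z₀ ∈ WA.rho H₀)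
    (hKz₀ : (1 : ℂ) ∈ resolventSet ℂ (WA.bsKernel H₀ A B z₀))
    (hK_compact : ∀ z ∈ WA.rho H₀, IsCompactOperator (WA.bsKernel H₀ A B z))
    (p : ℕ) (hp : 1 ≤ p)
    (hK_mem : ∀ z ∈ WA.rho H₀, WA.MemSchatten p (WA.bsKernel H₀ A B z))
    (hK_an : WA.SchattenAnalyticOn p (WA.bsKernel H₀ A B) (WA.rho H₀)) :
    DifferentiableOn ℂ (fun z => WA.detP p (WA.bsKernel H₀ A B z)) (WA.rho H₀) ∧
    ∀ z ∈ WA.phiTilde H₀,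
      ((∀ᶠ ζ in 𝓝[≠] z, WA.detP p (WA.bsKernel H₀ A B ζ) = 0) ∨
        (∀ᶠ ζ in 𝓝[≠] z, WA.detP p (WA.bsKernel H₀ A B ζ) ≠ 0)) ∧
      WA.opMult z (WA.pertOp H₀ A B z₀) =
        WA.opMult z H₀ + WA.funMult z (fun ζ => WA.detP p (WA.bsKernel H₀ A B ζ)) := by
  have h : WA.IsKatoTriple H₀ A B := ⟨hA_closed, hB_dense, hB_closed, hA, hB, hK_bdd⟩
  have hu : IsUnit (1 - WA.bsKernel H₀ A B z₀) := by
    rwa [spectrum.mem_resolventSet_iff, map_one] at hKz₀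
  exact ⟨h.differentiableOn_detP hp hK_mem hK_an, fun z hz =>
    h.opMult_pertOp_eq hz₀ hu hK_compact hp hK_mem hK_an hz⟩
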